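/- **Setting.** Fix real constants $0<\vartheta<1$, $r>\vartheta$, $1-\vartheta<\varphi<1$, $\gamma\in(0,1)$, $A>0$, $\omega_0\in(0,1/2)$, put $\zeta=(\sqrt r-\sqrt\vartheta)^2$ and assume $\zeta\le\vartheta$ (equivalently $r\le 4\vartheta$). Fix $q$ with $0<q\le \frac{(r+\vartheta-\zeta)^2}{4r}$. Let $\tau_p=\sqrt{2r\log p}$ and $$\eta=\frac{\vartheta r}{(\vartheta+r)\sqrt{1+2\omega_0}}\min\Big\{\frac{2\vartheta}{r},\,1-\frac{\vartheta}{r},\,\sqrt{2(1-\omega_0)}-1+\frac{\vartheta}{r}\Big\}.$$ Let $\mathcal M_p$ be the set of $p\times p$ correlation matrices $\Omega$ with $\sum_{j}|\Omega(i,j)|^\gamma\le A$ for all $i$ and $\max\{\|U\|_1,\|U\|_\infty\}\le\omega_0$, where $U$ is the strictly upper triangular part of $\Omega$, and $\|U\|_1$, $\|U\|_\infty$ are its maximal absolute column and row sums. *Model.* Let $n=n_p$ be $p^\varphi$ rounded to an integer ($|n-p^\varphi|<1$) and $Y=X\beta+\epsilon$, where $X\in\mathbb R^{n\times p}$, $\beta$,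 $\epsilon$ are independent, the rows of $X$ are i.i.d. $N(0,\frac1n\Omega)$ with $\Omega\in\mathcal M_p$, $\epsilon\sim N(0,I_n)$, and the $\beta_i$ are i.i.d. with law $(1-p^{-\vartheta})\,\delta_0+p^{-\vartheta}h_1$, $\delta_0$ being the point mass at $0$ and $h_1=h_{1,p}$ a probability distribution supported in $[\tau_p,(1+\eta)\tau_p]$. Let $\theta_i=1(\beta_i\ne0)$. For a decision rule $\delta\in\{0,1\}^p$ let $$\mathrm{mFDR}=\frac{E\sum_i(1-\theta_i)\delta_i}{E\sum_i\delta_i},\qquad \mathrm{mFNR}=\frac{E\sum_i\theta_i(1-\delta_i)}{E\sum_i(1-\delta_i)}.$$ *UPT procedure with tuning parameters $(t_1,t_2,t_3)$.* Let $\hat\Omega$ be $X'X$ with the entries of absolute value at most $(\log p)^{-2}$ set to $0$, and join distinct $i,j\in\{1,\dots,p\}$ by an edge when $\hat\Omega_{i,j}\ne0$. Let $\mathcal U_p=\{i: |(X'Y)_i|>t_1\}$. On each connected component $\mathcal I$ of the subgraph induced on $\mathcal U_p$, let $\hat\mu_{\mathcal I}$ minimize $$\tfrac12\big[(X'Y)^{\mathcal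 I}-(X'X)^{\mathcal I,\mathcal I}\mu\big]'\big((X'X)^{\mathcal I,\mathcal I}\big)^{-1}\big[(X'Y)^{\mathcal I}-(X'X)^{\mathcal I,\mathcal I}\mu\big]+\tfrac12t_2^2\|\mu\|_0$$ over all $\mu\in\{0,t_3\}^{\mathcal I}$, where $\|\mu\|_0$ is the number of nonzero coordinates (ties are broken in any measurable way). Reject $H_i:\beta_i=0$, that is, set $\delta_i=1$, if and only if $i\in\mathcal U_p$ and the corresponding coordinate of $\hat\mu$ is nonzero. *Multi-log terms.* A sequence $L_p>0$ is a multi-log term if $L_pp^{\varkappa}\to\infty$ and $L_pp^{-\varkappa}\to0$ for every $\varkappa>0$. **Theorem.** There is a constant $K_0$, depending only on $(\vartheta,r,\varphi,\gamma,A,\omega_0,q)$, such that the following holds for every $K\ge K_0$ and every $\alpha\in(0,1)$. Let $$M=\frac{\alpha\sqrt\pi\,(r+\vartheta-\zeta)}{(2e)^K\sqrt r\,(1-\alpha)},\qquad t_1=\sqrt{2q\log p},\qquad t_3=\sqrt{2r\log p},$$ $$t_2^*=\sqrt{2(\vartheta-\zeta)\log p+\frac{4r}{r+\vartheta-\zeta}\Big[\big(K-\tfrac12\big)\log\log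 p-\log M\Big]}.$$ Then, as $p\to\infty$, the UPT procedure with parameters $(t_1,t_2^*,t_3)$ satisfies $$\mathrm{mFDR}\le\alpha(1+o(1))\qquad\text{and}\qquad \mathrm{mFNR}\le L_p\,p^{-[\vartheta+(\sqrt r-\sqrt\vartheta)^2]}$$ with a multi-log term $L_p$; the denominators of both rates are positive for all large $p$. The $o(1)$ and $L_p$ are uniform over $n$, $\Omega\in\mathcal M_p$ and $h_1$ as above and over the tie-breaking. -/

import Mathlib

open MeasureTheory ProbabilityTheory Filter Topology Matrix

noncomputable section

namespace UPT

/-! ### Constants of the rare/weak model -/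

/-- The signal strength `τ_p = √(2 r log p)`. -/
def tau (r : ℝ) (p : ℕ) : ℝ := Real.sqrt (2 * r * Real.log p)

/-- `ζ = (√r - √ϑ)²`. -/
def zeta (r ϑ : ℝ) : ℝ := (Real.sqrt r - Real.sqrt ϑ) ^ 2

/-- The constant `η` that bounds the relative spread of the signals. -/
def eta (r ϑ ω₀ : ℝ) : ℝ :=
  ϑ * r / ((ϑ + r) * Real.sqrt (1 + 2 * ω₀)) *
    min (2 * ϑ / r) (min (1 - ϑ / r) (Real.sqrt (2 * (1 - ω₀)) - 1 + ϑ / r))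

/-! ### The class of correlation matrices -/

/-- The strictly upper triangular part of a square matrix. -/
def upperPart {p : ℕ} (Ω : Matrix (Fin p) (Fin p) ℝ) : Matrix (Fin p) (Fin p) ℝ :=
  Matrix.of fun i j => if i < j then Ω i j else 0

/-- `d(Ω) = max {‖U‖₁, ‖U‖_∞}`, where `U` is the upper part of `Ω`, `‖U‖₁` is the largest absolute
column sum and `‖U‖_∞` the largest absolute row sum. -/
def upperNorm {p : ℕ} (Ω : Matrix (Fin p) (Fin p) ℝ) : ℝ :=
  max (⨆ j, ∑ i, |upperPart Ω i j|) (⨆ i, ∑ j, |upperPart Ω i j|)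

/-- The class `M_p` of `p × p` correlation matrices (positive semidefinite, unit diagonal) whose rows
satisfy `∑_j |Ω(i,j)|^γ ≤ A` and for which `d(Ω) ≤ ω₀`. -/
structure CorrelationClass (γ A ω₀ : ℝ) {p : ℕ} (Ω : Matrix (Fin p) (Fin p) ℝ) : Prop where
  posSemidef : Ω.PosSemidef
  diag_eq_one : ∀ i, Ω i i = 1
  row_sum_le : ∀ i, ∑ j, |Ω i j| ^ γ ≤ A
  upperNorm_le : upperNorm Ω ≤ ω₀

/-! ### The model -/

/-- Designs: `X j` is the `j`-th row of the design matrix. -/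
abbrev Design (n p : ℕ) : Type := Fin n → EuclideanSpace ℝ (Fin p)

/-- The design matrix with the given rows. -/
def designMatrix {n p : ℕ} (X : Design n p) : Matrix (Fin n) (Fin p) ℝ :=
  Matrix.of fun j i => X j i

/-- Law of the random design: the rows are i.i.d. `N(0, Ω / n)`. -/
def designLaw (n : ℕ) {p : ℕ} (Ω : Matrix (Fin p) (Fin p) ℝ) : Measure (Design n p) :=
  Measure.pi fun _ => multivariateGaussian 0 ((n : ℝ)⁻¹ • Ω)

/-- Law of one coefficient: `(1 - π₁) δ₀ + π₁ h₁` with `π₁ = p ^ (-ϑ)`. -/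
def coefLaw (ϑ : ℝ) (p : ℕ) (h₁ : Measure ℝ) : Measure ℝ :=
  ENNReal.ofReal (1 - (p : ℝ) ^ (-ϑ)) • Measure.dirac 0 + ENNReal.ofReal ((p : ℝ) ^ (-ϑ)) • h₁

/-- Joint law of `(X, β, ε)`: the design, the coefficients (i.i.d. from `coefLaw`) and the noise
(i.i.d. standard Gaussian) are independent. -/
def modelLaw (n : ℕ) {p : ℕ} (ϑ : ℝ) (Ω : Matrix (Fin p) (Fin p) ℝ) (h₁ : Measure ℝ) :
    Measure (Design n p × (Fin p → ℝ) × (Fin n → ℝ)) :=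
  (designLaw n Ω).prod
    ((Measure.pi fun _ => coefLaw ϑ p h₁).prod (Measure.pi fun _ => gaussianReal 0 1))

/-- The response `Y = X β + ε`. -/
def response {n p : ℕ} (ω : Design n p × (Fin p → ℝ) × (Fin n → ℝ)) : Fin n → ℝ :=
  designMatrix ω.1 *ᵥ ω.2.1 + ω.2.2

/-! ### The UPT procedure -/

/-- The Gram matrix `X'X`. -/
def gramMatrix {n p : ℕ} (X : Design n p) : Matrix (Fin p) (Fin p) ℝ :=
  (designMatrix X)ᵀ * designMatrix X

/-- The marginal correlations `X'Y`. -/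
def marginal {n p : ℕ} (X : Design n p) (Y : Fin n → ℝ) : Fin p → ℝ :=
  (designMatrix X)ᵀ *ᵥ Y

/-- The regularized Gram matrix: the entries of `X'X` larger than `(log p)⁻²` in absolute value are
kept, the others are set to zero. -/
def regGram {n p : ℕ} (X : Design n p) : Matrix (Fin p) (Fin p) ℝ :=
  Matrix.of fun i j => if (Real.log p ^ 2)⁻¹ < |gramMatrix X i j| then gramMatrix X i j else 0

/-- The graph on the predictors: distinct `i`, `j` are joined when `regGram X i j ≠ 0` (a symmetric
condition, since `X'X` is symmetric). -/
def gramGraph {n p : ℕ} (X : Design n p) : SimpleGraph (Fin p) :=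
  SimpleGraph.fromRel fun i j => regGram X i j ≠ 0

/-- The set of predictors that survive the screening at threshold `t₁`. -/
def survivors {n p : ℕ} (t₁ : ℝ) (X : Design n p) (Y : Fin n → ℝ) : Set (Fin p) :=
  {i | t₁ < |marginal X Y i|}

/-- `I` is (the vertex set of) a connected component of the subgraph induced on the survivors. -/
def IsComponent {n p : ℕ} (t₁ : ℝ) (X : Design n p) (Y : Fin n → ℝ) (I : Finset (Fin p)) : Prop :=
  ∃ C : ((gramGraph X).induce (survivors t₁ X Y)).ConnectedComponent,
    (I : Set (Fin p)) = Subtype.val '' C.supp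

open Classical in
/-- The penalized criterion on a subgraph `I`:
`½ [(X'Y)^I - (X'X)^{I,I} μ]' ((X'X)^{I,I})⁻¹ [(X'Y)^I - (X'X)^{I,I} μ] + ½ t₂² ‖μ‖₀`,
where `‖μ‖₀` is the number of nonzero coordinates of `μ`. -/
def criterion {n p : ℕ} (t₂ : ℝ) (X : Design n p) (Y : Fin n → ℝ) (I : Finset (Fin p))
    (μ : I → ℝ) : ℝ :=
  let G : Matrix I I ℝ := (gramMatrix X).submatrix Subtype.val Subtype.val
  let res : I → ℝ := (fun i : I => marginal X Y i) - G *ᵥ μ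
  1 / 2 * (res ⬝ᵥ (G⁻¹ *ᵥ res)) + 1 / 2 * t₂ ^ 2 * ((Finset.univ.filter fun i => μ i ≠ 0).card : ℝ)

/-- `b` is a UPT estimate at the data `(X, Y)` with tuning parameters `(t₁, t₂, t₃)`: it vanishes off
the set of survivors, and on every component of that set it minimizes the penalized criterion among
the vectors with coordinates in `{0, t₃}`. -/
structure IsEstimate {n p : ℕ} (t₁ t₂ t₃ : ℝ) (X : Design n p) (Y : Fin n → ℝ)
    (b : Fin p → ℝ) : Prop where
  eq_zero : ∀ i, i ∉ survivors t₁ X Y → b i = 0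
  mem_pair : ∀ i, b i = 0 ∨ b i = t₃
  minimizes : ∀ I : Finset (Fin p), IsComponent t₁ X Y I →
    ∀ μ : I → ℝ, (∀ i, μ i = 0 ∨ μ i = t₃) →
      criterion t₂ X Y I (fun i => b i) ≤ criterion t₂ X Y I μ

/-- A UPT procedure: a measurable choice of a UPT estimate for all data `(X, Y)` (the criterion may
have several minimizers). -/
structure IsProcedure {n p : ℕ} (t₁ t₂ t₃ : ℝ)
    (est : Design n p × (Fin n → ℝ) → Fin p → ℝ) : Prop where
  measurable : Measurable est
  isEstimate : ∀ X Y, IsEstimate t₁ t₂ t₃ X Y (est (X, Y))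

/-! ### Error rates -/

open Classical in
/-- `θ_i = 1(β_i ≠ 0)`; applied to an estimate it gives the decision `δ_i`. -/
def ind (x : ℝ) : ℝ := if x ≠ 0 then 1 else 0

section rates

variable {n p : ℕ} (ν : Measure (Design n p × (Fin p → ℝ) × (Fin n → ℝ)))
  (est : Design n p × (Fin n → ℝ) → Fin p → ℝ)

/-- The true status `θ_i` of the `i`-th hypothesis. -/
def theta (ω : Design n p × (Fin p → ℝ) × (Fin n → ℝ)) (i : Fin p) : ℝ := ind (ω.2.1 i)

/-- The decision `δ_i`: the `i`-th hypothesis is rejected when the estimate is nonzero. -/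
def decision (ω : Design n p × (Fin p → ℝ) × (Fin n → ℝ)) (i : Fin p) : ℝ :=
  ind (est (ω.1, response ω) i)

/-- Expected number of rejections, `E ∑ δ_i`. -/
def expRejections : ℝ := ∫ ω, ∑ i, decision est ω i ∂ν

/-- Expected number of non-rejections, `E ∑ (1 - δ_i)`. -/
def expAcceptances : ℝ := ∫ ω, ∑ i, (1 - decision est ω i) ∂ν

/-- Marginal false discovery rate `E ∑ (1 - θ_i) δ_i / E ∑ δ_i`. -/
def mFDR : ℝ := (∫ ω, ∑ i, (1 - theta ω i) * decision est ω i ∂ν) / expRejections ν est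

/-- Marginal false non-discovery rate `E ∑ θ_i (1 - δ_i) / E ∑ (1 - δ_i)`. -/
def mFNR : ℝ := (∫ ω, ∑ i, theta ω i * (1 - decision est ω i) ∂ν) / expAcceptances ν est

end rates

/-! ### Tuning parameters and multi-log terms -/

/-- The constant `M = α √π (r + ϑ - ζ) / ((2e)^K √r (1 - α))`. -/
def tuneM (r ϑ α K : ℝ) : ℝ :=
  α * Real.sqrt Real.pi * (r + ϑ - zeta r ϑ) /
    ((2 * Real.exp 1) ^ K * Real.sqrt r * (1 - α))

/-- `t₁ = √(2 q log p)`. -/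
def tune₁ (q : ℝ) (p : ℕ) : ℝ := Real.sqrt (2 * q * Real.log p)

/-- `t₂* = √(2(ϑ - ζ) log p + 4r/(r + ϑ - ζ) · [(K - 1/2) log log p - log M])`. -/
def tune₂ (r ϑ α K : ℝ) (p : ℕ) : ℝ :=
  Real.sqrt (2 * (ϑ - zeta r ϑ) * Real.log p +
    4 * r / (r + ϑ - zeta r ϑ) *
      ((K - 1 / 2) * Real.log (Real.log p) - Real.log (tuneM r ϑ α K)))

/-- `t₃ = √(2 r log p)`. -/
def tune₃ (r : ℝ) (p : ℕ) : ℝ := Real.sqrt (2 * r * Real.log p)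

/-- `L` is a multi-log term: `L_p > 0`, and `L_p p^ϰ → ∞`, `L_p p^(-ϰ) → 0` for every `ϰ > 0`. -/
structure IsMultiLog (L : ℕ → ℝ) : Prop where
  pos : ∀ p, 0 < L p
  tendsto_atTop : ∀ ϰ : ℝ, 0 < ϰ → Tendsto (fun p : ℕ => L p * (p : ℝ) ^ ϰ) atTop atTop
  tendsto_zero : ∀ ϰ : ℝ, 0 < ϰ → Tendsto (fun p : ℕ => L p * (p : ℝ) ^ (-ϰ)) atTop (𝓝 0)

end UPT

end

/-!
The two rates reduce to the errors at a single index `i`, uniformly in `i`: the probability of a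
false rejection is `o(p^{-ϑ})` (`UPT.eventually_false_positive`), and that of a missed signal is at
most `p^{-(ϑ + ζ) + ν}` for every `ν > 0` (`UPT.eventually_false_negative`). As the expected numbers
of rejections and of acceptances are at least `½ p^{1-ϑ}` and `½ p` (`UPT.rates_le`), the marginal
false discovery rate even tends to `0`, and the exponent `ν` is absorbed in a multi-log term by a
diagonal argument (`UPT.exists_isMultiLog`).

*Localization.* Join `i` and `j` when `|Ω(i,j)| > t`, with `t` a small negative power of `p`. By the
`γ`-sparsity of the rows, balls of bounded radius have at most `p^ρ` elements, with `ρ` as small as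
desired. Outside an event of probability at most `p^{-2}` (`UPT.badProb_le`), the
Gram matrix `X'X` and the vector `X'Xβ` differ from `Ω` and `Ωβ` by a power `p^{-c}` (exponential
moments of the squared norms `|Xv|²`, and `n ≫ p^{1-ϑ}`), a ball contains at most `k₀` signals, and
boundedly many indices of it have a large noise score. So only boundedly many indices of a ball
survive the screening, and the component of `i` among the survivors stays in the ball and has at
most `m` elements, with `m` fixed (`UPT.GoodAt`). On a component `I` the penalized criterion is, up
to a constant, the quadratic function of the support `S ⊆ I` that is compared below.

*Comparison of supports.* Given the design, each comparison of two supports is a deviation of a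
linear form of the Gaussian vector `X'ε` whose variance is, up to `p^{-c}`, the quadratic form of
`Ω` at a sign vector of some `S`; as `ω₀ < 1/2`, this form is within `2 ω₀ (|S| - 1)` of `|S|`.

*Null index, no signal in the ball.* The estimate must prefer some `S ∋ i` to the empty set. For
`S = {i}` the identity `r + ϑ - ζ = 2 √(rϑ)` turns the penalty into the threshold
`√(2 ϑ log p) + w`, where `√(2 ϑ log p) w` is `(K - ½) log log p - log M`, which tends to infinity
for `K ≥ 1`: the tail is `o(p^{-ϑ})` (`UPT.eventually_isolated_tail`). For `|S| ≥ 2` there is a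
polynomial gain (`UPT.eventually_larger_set_tail`).

*Null index, signals in the ball.* Two signals have probability at most `p^{2ρ - 2ϑ}`. If `j` is the
only one, then either a noise score in the ball is of the order of `τ_p`, which costs an additional
power of `p`, or `j` survives and the support `{j}` beats every support that contains `i`.

*Signal index.* Another signal in the ball costs `p^{ρ - 2ϑ}`, and `ζ ≤ ϑ`. Otherwise `i` fails the
screening, which needs a deviation `τ_p - t₁ ≥ (√r - √ϑ) √(2 log p)` as `q ≤ ϑ`, or some support
without `i` is preferred to `{i}`; for the empty support this is a deviation of
`(√r - √ϑ) √(2 log p)`, and for the others of at least `½ √r √(2 log p)` standard deviations, which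
is no smaller since `ζ ≤ ϑ` means `√r ≤ 2 √ϑ`. In all these cases the Gaussian tail is at most
`p^{-ζ + ν}`.
-/

noncomputable section

namespace UPT

/-! ### Exponential moments and concentration -/

/-- Chernoff's bound for a sum of independent terms, in exponential form. -/
lemma pi_chernoff {ι E : Type*} [Fintype ι] [MeasurableSpace E] (μ : ι → Measure E)
    [∀ i, IsProbabilityMeasure (μ i)] (f : ι → E → ℝ) (b : ι → ℝ)
    (hint : ∀ i, Integrable (fun x => Real.exp (f i x)) (μ i))
    (hb : ∀ i, ∫ x, Real.exp (f i x) ∂(μ i) ≤ Real.exp (b i)) (a : ℝ) :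
    (Measure.pi μ).real {x | a ≤ ∑ i, f i (x i)} ≤ Real.exp (∑ i, b i - a) := by
  have hI : Integrable (fun x : ι → E => Real.exp (1 * ∑ i, f i (x i))) (Measure.pi μ) := by
    simp only [one_mul, Real.exp_sum]
    exact Integrable.fintype_prod hint
  have h := measure_ge_le_exp_mul_mgf a zero_le_one hI
  refine h.trans ?_
  have hm : mgf (fun x : ι → E => ∑ i, f i (x i)) (Measure.pi μ) 1 ≤ Real.exp (∑ i, b i) := by
    simp only [mgf, one_mul, Real.exp_sum]
    rw [integral_fintype_prod_eq_prod (fun i x => Real.exp (f i x))]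
    exact Finset.prod_le_prod (fun i _ => integral_nonneg fun _ => (Real.exp_pos _).le)
      fun i _ => hb i
  calc _ ≤ Real.exp (-1 * a) * Real.exp (∑ i, b i) := by gcongr
    _ = _ := by rw [← Real.exp_add]; ring_nf

/-- Gaussian tail bound for a linear form of the noise. -/
lemma noise_tail {n : ℕ} (c : Fin n → ℝ) {s x : ℝ} (hs : 0 < s) (hc : c ⬝ᵥ c ≤ s) (hx : 0 ≤ x) :
    (Measure.pi fun _ : Fin n => gaussianReal 0 1).real {e | x ≤ c ⬝ᵥ e} ≤
      Real.exp (-(x ^ 2 / (2 * s))) := by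
  have key := pi_chernoff (fun _ : Fin n => gaussianReal 0 1) (fun k y => (x / s * c k) * y)
    (fun k => (x / s * c k) ^ 2 / 2) (fun k => integrable_exp_mul_gaussianReal _)
    (fun k => by
      have := congrFun (mgf_fun_id_gaussianReal (μ := 0) (v := 1)) (x / s * c k)
      simp only [mgf] at this
      rw [this]; simp) (x / s * x)
  have hset : {e : Fin n → ℝ | x ≤ c ⬝ᵥ e} ⊆
      {e : Fin n → ℝ | x / s * x ≤ ∑ k, (x / s * c k) * e k} := by
    intro e he
    simp only [Set.mem_ofPred_eq, mul_assoc, ← Finset.mul_sum] at he ⊢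
    exact mul_le_mul_of_nonneg_left he (by positivity)
  refine (measureReal_mono hset).trans (key.trans (Real.exp_le_exp.2 ?_))
  have : ∑ k, (x / s * c k) ^ 2 / 2 = x ^ 2 / s ^ 2 / 2 * (c ⬝ᵥ c) := by
    simp only [dotProduct, Finset.mul_sum]
    exact Finset.sum_congr rfl fun k _ => by ring
  rw [this]
  have h2 : x ^ 2 / s ^ 2 / 2 * (c ⬝ᵥ c) ≤ x ^ 2 / s ^ 2 / 2 * s := by gcongr
  have h3 : x ^ 2 / s ^ 2 / 2 * s - x / s * x = -(x ^ 2 / (2 * s)) := by field_simp; ring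
  linarith

/-- The numerical inequality behind the exponential moments of a centred squared Gaussian. -/
lemma exp_neg_sub_sq_le {y : ℝ} (hy : |y| ≤ 1 / 2) : Real.exp (-y - y ^ 2) ≤ 1 - y := by
  rw [abs_le] at hy
  have h : 1 ≤ (1 - y) * Real.exp (y + y ^ 2) := by
    rcases le_total 0 y with h0 | h0
    · have := Real.quadratic_le_exp_of_nonneg (x := y + y ^ 2) (by positivity)
      refine le_trans ?_ (mul_le_mul_of_nonneg_left this (by linarith))
      nlinarith [mul_nonneg h0 h0, mul_nonneg (mul_nonneg h0 h0) (by linarith : 0 ≤ 1 - 2 * y),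
        pow_nonneg h0 3, pow_nonneg h0 4, pow_nonneg h0 5]
    · have := Real.add_one_le_exp (y + y ^ 2)
      refine le_trans ?_ (mul_le_mul_of_nonneg_left this (by linarith))
      nlinarith [pow_nonneg (neg_nonneg.2 h0) 3]
  have h2 : Real.exp (-y - y ^ 2) * Real.exp (y + y ^ 2) = 1 := by
    rw [← Real.exp_add]; simp
  nlinarith [Real.exp_pos (-y - y ^ 2), Real.exp_pos (y + y ^ 2)]

/-- Exponential moment of the square of a centred Gaussian variable. -/
lemma gaussian_sq_mgf (v : NNReal) {t : ℝ} (ht : |t * v| ≤ 1 / 4) :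
    Integrable (fun x => Real.exp (t * x ^ 2)) (gaussianReal 0 v) ∧
      ∫ x, Real.exp (t * x ^ 2) ∂(gaussianReal 0 v) ≤ Real.exp (t * v + 2 * t ^ 2 * v ^ 2) := by
  rcases eq_or_ne v 0 with rfl | hv
  · simp only [gaussianReal_zero_var]
    exact ⟨integrable_dirac (by simp), by simp⟩
  have hv0 : (0 : ℝ) < v := by positivity
  have hb : 0 < 1 / (2 * (v : ℝ)) - t := by
    rw [abs_le] at ht
    rw [sub_pos, lt_div_iff₀ (by positivity)]
    nlinarith
  have hpdf : ∀ x : ℝ, gaussianPDFReal 0 v x * Real.exp (t * x ^ 2) =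
      (√(2 * Real.pi * v))⁻¹ * Real.exp (-(1 / (2 * (v : ℝ)) - t) * x ^ 2) := by
    intro x
    rw [gaussianPDFReal, mul_assoc, ← Real.exp_add]
    congr 2
    field_simp
    ring
  constructor
  · rw [gaussianReal_of_var_ne_zero _ hv]
    rw [integrable_withDensity_iff_integrable_smul' (measurable_gaussianPDF _ _)
      (Eventually.of_forall fun _ => gaussianPDF_lt_top)]
    simp only [toReal_gaussianPDF, smul_eq_mul, hpdf]
    exact (integrable_exp_neg_mul_sq hb).const_mul _
  · rw [integral_gaussianReal_eq_integral_smul hv]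
    simp only [smul_eq_mul, hpdf]
    rw [integral_const_mul, integral_gaussian, ← Real.sqrt_inv, ← Real.sqrt_mul (by positivity),
      Real.sqrt_le_left (Real.exp_pos _).le]
    have hy := exp_neg_sub_sq_le (y := 2 * (t * v)) (by
      rw [abs_mul, abs_of_pos (by norm_num : (0 : ℝ) < 2)]; linarith)
    have h1 : (2 * Real.pi * (v : ℝ))⁻¹ * (Real.pi / (1 / (2 * (v : ℝ)) - t)) =
        (1 - 2 * (t * v))⁻¹ := by
      have : 1 / (2 * (v : ℝ)) - t = (1 - 2 * (t * v)) / (2 * v) := by field_simp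
      rw [this] at hb ⊢
      have h2 : 0 < 1 - 2 * (t * v) := by
        rw [abs_le] at ht; linarith
      field_simp
    rw [h1, ← Real.exp_nat_mul]
    refine (inv_anti₀ (Real.exp_pos _) hy).trans ?_
    rw [← Real.exp_neg]
    refine Real.exp_le_exp.2 (le_of_eq ?_)
    push_cast; ring

lemma multivariateGaussian_map_dotProduct {p : ℕ} {S : Matrix (Fin p) (Fin p) ℝ}
    (hS : S.PosSemidef) (v : Fin p → ℝ) :
    (multivariateGaussian 0 S).map (fun x : EuclideanSpace ℝ (Fin p) => v ⬝ᵥ (x : Fin p → ℝ)) =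
      gaussianReal 0 (v ⬝ᵥ S *ᵥ v).toNNReal := by
  let L : StrongDual ℝ (EuclideanSpace ℝ (Fin p)) := innerSL ℝ (WithLp.toLp 2 v)
  have h := IsGaussian.map_eq_gaussianReal (μ := multivariateGaussian 0 S) L
  have h0 : ∫ x, L x ∂(multivariateGaussian 0 S) = 0 := by
    rw [L.integral_comp_id_comm IsGaussian.integrable_id]
    simp
  rw [h0] at h
  have hf : ⇑L = fun x : EuclideanSpace ℝ (Fin p) => v ⬝ᵥ (x : Fin p → ℝ) := by
    ext x
    simp [L, PiLp.inner_apply, dotProduct, mul_comm]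
  have hv : Var[⇑L; multivariateGaussian 0 S] = v ⬝ᵥ S *ᵥ v := by
    have := covarianceBilin_self (μ := multivariateGaussian 0 S) IsGaussian.memLp_two_id
      (WithLp.toLp 2 v)
    rw [covarianceBilin_multivariateGaussian hS] at this
    simpa [L] using this.symm
  rw [hv, hf] at h
  exact h

instance {n p : ℕ} (Ω : Matrix (Fin p) (Fin p) ℝ) : IsProbabilityMeasure (designLaw n Ω) := by
  unfold designLaw; infer_instance

/-- Squared length of `X v`. -/
def normSq {n p : ℕ} (X : Design n p) (v : Fin p → ℝ) : ℝ :=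
  (designMatrix X *ᵥ v) ⬝ᵥ (designMatrix X *ᵥ v)

lemma normSq_eq_sum {n p : ℕ} (X : Design n p) (v : Fin p → ℝ) :
    normSq X v = ∑ k, (v ⬝ᵥ (X k : Fin p → ℝ)) ^ 2 := by
  simp only [normSq, dotProduct, mulVec, designMatrix, Matrix.of_apply, sq]
  exact Finset.sum_congr rfl fun k _ => by simp only [mul_comm]

lemma dotProduct_gram_mulVec {n p : ℕ} (X : Design n p) (u v : Fin p → ℝ) :
    u ⬝ᵥ (gramMatrix X *ᵥ v) = (designMatrix X *ᵥ u) ⬝ᵥ (designMatrix X *ᵥ v) := by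
  rw [gramMatrix, ← mulVec_mulVec, dotProduct_mulVec, vecMul_transpose]

lemma normSq_eq_gram {n p : ℕ} (X : Design n p) (v : Fin p → ℝ) :
    normSq X v = v ⬝ᵥ (gramMatrix X *ᵥ v) := (dotProduct_gram_mulVec X v v).symm

/-- One-sided concentration of `|X v|²` about `v'Ωv`; `σ = 1` gives the upper and `σ = -1` the lower
tail. -/
lemma normSq_conc_aux {n p : ℕ} (hn : 0 < n) {Ω : Matrix (Fin p) (Fin p) ℝ} (hΩ : Ω.PosSemidef)
    (v : Fin p → ℝ) {Q δ σ : ℝ} (hQ : 0 < Q) (hvQ : v ⬝ᵥ Ω *ᵥ v ≤ Q) (hδ : 0 < δ) (hδ1 : δ ≤ 1)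
    (hσ : σ = 1 ∨ σ = -1) :
    (designLaw n Ω).real {X | δ * Q ≤ σ * (normSq X v - v ⬝ᵥ Ω *ᵥ v)} ≤
      Real.exp (-(n * δ ^ 2 / 8)) := by
  have hn' : (0 : ℝ) < n := by exact_mod_cast hn
  have hσ2 : σ ^ 2 = 1 := by rcases hσ with rfl | rfl <;> norm_num
  set q := v ⬝ᵥ Ω *ᵥ v with hq
  have hq0 : 0 ≤ q := by simpa using hΩ.dotProduct_mulVec_nonneg v
  have hS : ((n : ℝ)⁻¹ • Ω).PosSemidef := hΩ.smul (by positivity)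
  have hvar : v ⬝ᵥ ((n : ℝ)⁻¹ • Ω) *ᵥ v = q / n := by
    rw [smul_mulVec, dotProduct_smul, smul_eq_mul]; field_simp; rfl
  set t : ℝ := σ * (n * δ / (4 * Q)) with ht
  have hts : |t * ((q / n).toNNReal : ℝ)| ≤ 1 / 4 := by
    rw [Real.coe_toNNReal _ (by positivity), ht]
    have : σ * (n * δ / (4 * Q)) * (q / n) = σ * (δ * (q / Q) / 4) := by field_simp
    rw [this, abs_mul]
    have h1 : |σ| = 1 := by rcases hσ with rfl | rfl <;> simp
    have h2 : q / Q ≤ 1 := (div_le_one hQ).2 hvQ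
    have h3 : 0 ≤ q / Q := by positivity
    rw [h1, abs_of_nonneg (by positivity)]
    nlinarith [mul_nonneg hδ.le h3]
  obtain ⟨hI, hE⟩ := gaussian_sq_mgf (q / n).toNNReal hts
  have hmap := multivariateGaussian_map_dotProduct hS v
  rw [hvar] at hmap
  have hmeas : Measurable (fun x : EuclideanSpace ℝ (Fin p) => v ⬝ᵥ (x : Fin p → ℝ)) := by
    unfold dotProduct; fun_prop
  rw [← hmap] at hI hE
  rw [integral_map hmeas.aemeasurable (by fun_prop)] at hE
  have hI' := hI.comp_measurable hmeas
  have key := pi_chernoff (fun _ : Fin n => multivariateGaussian 0 ((n : ℝ)⁻¹ • Ω))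
    (fun _ x => t * (v ⬝ᵥ (x : Fin p → ℝ)) ^ 2)
    (fun _ => t * ((q / n).toNNReal : ℝ) + 2 * t ^ 2 * ((q / n).toNNReal : ℝ) ^ 2)
    (fun _ => hI') (fun _ => hE) (n * δ / (4 * Q) * (δ * Q) + t * q)
  refine (measureReal_mono ?_).trans (key.trans (Real.exp_le_exp.2 ?_))
  · intro X hX
    simp only [Set.mem_ofPred_eq] at hX ⊢
    rw [← Finset.mul_sum, ← normSq_eq_sum]
    have := mul_le_mul_of_nonneg_left hX (show 0 ≤ n * δ / (4 * Q) by positivity)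
    rw [ht]
    linarith [this]
  · rw [Finset.sum_const, Finset.card_univ, Fintype.card_fin, nsmul_eq_mul,
      Real.coe_toNNReal _ (by positivity)]
    have e1 : (n : ℝ) * (t * (q / n) + 2 * t ^ 2 * (q / n) ^ 2) =
        t * q + n * δ ^ 2 / 8 * (q / Q) ^ 2 := by
      have : t ^ 2 = (n * δ / (4 * Q)) ^ 2 := by rw [ht, mul_pow, hσ2, one_mul]
      rw [this]
      field_simp
      ring
    have h2 : q / Q ≤ 1 := (div_le_one hQ).2 hvQ
    have h3 : 0 ≤ q / Q := by positivity
    have h4 : (q / Q) ^ 2 ≤ 1 := by nlinarith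
    have h5 : n * δ ^ 2 / 8 * (q / Q) ^ 2 ≤ n * δ ^ 2 / 8 * 1 := by gcongr
    have e2 : n * δ / (4 * Q) * (δ * Q) = n * δ ^ 2 / 4 := by field_simp
    rw [e1, e2]
    linarith

/-- Concentration of the bilinear form `u'(X'X)w` about `u'Ωw`, by polarization. -/
lemma gram_conc {n p : ℕ} (hn : 0 < n) {Ω : Matrix (Fin p) (Fin p) ℝ} (hΩ : Ω.PosSemidef)
    (hop : ∀ v, v ⬝ᵥ Ω *ᵥ v ≤ 2 * (v ⬝ᵥ v)) (u w : Fin p → ℝ) (hu : u ⬝ᵥ u ≤ 1) {R δ : ℝ}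
    (hR : 0 < R) (hw : w ⬝ᵥ w ≤ R ^ 2) (hδ : 0 < δ) (hδ1 : δ ≤ 1) :
    (designLaw n Ω).real {X | 4 * δ * R < |u ⬝ᵥ (gramMatrix X *ᵥ w) - u ⬝ᵥ Ω *ᵥ w|} ≤
      4 * Real.exp (-(n * δ ^ 2 / 8)) := by
  set w' : Fin p → ℝ := R⁻¹ • w with hw'
  have hww : w = R • w' := by rw [hw', smul_smul, mul_inv_cancel₀ hR.ne', one_smul]
  have hw1 : w' ⬝ᵥ w' ≤ 1 := by
    rw [hw', smul_dotProduct, dotProduct_smul, smul_eq_mul, smul_eq_mul]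
    have : R⁻¹ * (R⁻¹ * (w ⬝ᵥ w)) = (w ⬝ᵥ w) / R ^ 2 := by field_simp
    rw [this]; exact (div_le_one (by positivity)).2 hw
  have hsum : (u + w') ⬝ᵥ (u + w') + (u - w') ⬝ᵥ (u - w') = 2 * (u ⬝ᵥ u) + 2 * (w' ⬝ᵥ w') := by
    simp only [add_dotProduct, sub_dotProduct, dotProduct_add, dotProduct_sub]; ring
  have hnn : ∀ x : Fin p → ℝ, 0 ≤ x ⬝ᵥ x := fun x => by
    simp only [dotProduct]; exact Finset.sum_nonneg fun i _ => mul_self_nonneg _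
  have hp : (u + w') ⬝ᵥ Ω *ᵥ (u + w') ≤ 8 := (hop _).trans (by linarith [hnn (u - w')])
  have hm : (u - w') ⬝ᵥ Ω *ᵥ (u - w') ≤ 8 := (hop _).trans (by linarith [hnn (u + w')])
  have hpol : ∀ M : Matrix (Fin p) (Fin p) ℝ, Mᵀ = M →
      (u + w') ⬝ᵥ M *ᵥ (u + w') - (u - w') ⬝ᵥ M *ᵥ (u - w') = 4 * (u ⬝ᵥ M *ᵥ w') := by
    intro M hM
    have : w' ⬝ᵥ M *ᵥ u = u ⬝ᵥ M *ᵥ w' := by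
      rw [dotProduct_mulVec, ← mulVec_transpose, hM, dotProduct_comm]
    simp only [mulVec_add, mulVec_sub, add_dotProduct, sub_dotProduct, dotProduct_add,
      dotProduct_sub, this]
    ring
  have hΩt : Ωᵀ = Ω := by simpa using hΩ.1.eq
  have hGt : ∀ X : Design n p, (gramMatrix X)ᵀ = gramMatrix X := fun X => by
    simp [gramMatrix, transpose_mul]
  have a1 := normSq_conc_aux hn hΩ (u + w') (by norm_num : (0 : ℝ) < 8) hp hδ hδ1 (Or.inl rfl)
  have a2 := normSq_conc_aux hn hΩ (u + w') (by norm_num : (0 : ℝ) < 8) hp hδ hδ1 (Or.inr rfl)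
  have a3 := normSq_conc_aux hn hΩ (u - w') (by norm_num : (0 : ℝ) < 8) hm hδ hδ1 (Or.inl rfl)
  have a4 := normSq_conc_aux hn hΩ (u - w') (by norm_num : (0 : ℝ) < 8) hm hδ hδ1 (Or.inr rfl)
  have hsub : {X : Design n p | 4 * δ * R < |u ⬝ᵥ (gramMatrix X *ᵥ w) - u ⬝ᵥ Ω *ᵥ w|} ⊆
      (({X | δ * 8 ≤ 1 * (normSq X (u + w') - (u + w') ⬝ᵥ Ω *ᵥ (u + w'))} ∪
        {X | δ * 8 ≤ -1 * (normSq X (u + w') - (u + w') ⬝ᵥ Ω *ᵥ (u + w'))}) ∪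
        {X | δ * 8 ≤ 1 * (normSq X (u - w') - (u - w') ⬝ᵥ Ω *ᵥ (u - w'))}) ∪
        {X | δ * 8 ≤ -1 * (normSq X (u - w') - (u - w') ⬝ᵥ Ω *ᵥ (u - w'))} := by
    intro X hX
    by_contra hcon
    simp only [Set.mem_union, Set.mem_ofPred_eq, not_or, not_le] at hcon hX
    obtain ⟨⟨⟨h1, h2⟩, h3⟩, h4⟩ := hcon
    have g := hpol _ (hGt X)
    have o := hpol _ hΩt
    rw [← normSq_eq_gram, ← normSq_eq_gram] at g
    have e : u ⬝ᵥ (gramMatrix X *ᵥ w) - u ⬝ᵥ Ω *ᵥ w =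
        R * (u ⬝ᵥ (gramMatrix X *ᵥ w') - u ⬝ᵥ Ω *ᵥ w') := by
      rw [hww]; simp only [mulVec_smul, dotProduct_smul, smul_eq_mul]
      ring
    rw [e, abs_mul, abs_of_pos hR, mul_comm (4 * δ) R] at hX
    have hX' := lt_of_mul_lt_mul_left hX hR.le
    rcases lt_abs.1 hX' with h | h <;> linarith
  refine (measureReal_mono hsub).trans ?_
  refine (measureReal_union_le _ _).trans ?_
  have b1 := measureReal_union_le (μ := designLaw n Ω)
    ({X | δ * 8 ≤ 1 * (normSq X (u + w') - (u + w') ⬝ᵥ Ω *ᵥ (u + w'))} ∪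
        {X | δ * 8 ≤ -1 * (normSq X (u + w') - (u + w') ⬝ᵥ Ω *ᵥ (u + w'))})
        {X | δ * 8 ≤ 1 * (normSq X (u - w') - (u - w') ⬝ᵥ Ω *ᵥ (u - w'))}
  have b2 := measureReal_union_le (μ := designLaw n Ω)
    {X | δ * 8 ≤ 1 * (normSq X (u + w') - (u + w') ⬝ᵥ Ω *ᵥ (u + w'))}
        {X | δ * 8 ≤ -1 * (normSq X (u + w') - (u + w') ⬝ᵥ Ω *ᵥ (u + w'))}
  linarith

/-! ### Events of the model -/

/-- The signal density `π₁ = p ^ (-ϑ)`. -/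
def dens (ϑ : ℝ) (p : ℕ) : ℝ := (p : ℝ) ^ (-ϑ)

lemma dens_nonneg (ϑ : ℝ) (p : ℕ) : 0 ≤ dens ϑ p := Real.rpow_nonneg (Nat.cast_nonneg _) _

lemma dens_le_one {ϑ : ℝ} (hϑ : 0 < ϑ) {p : ℕ} (hp : 0 < p) : dens ϑ p ≤ 1 :=
  Real.rpow_le_one_of_one_le_of_nonpos (by exact_mod_cast hp) (by linarith)

lemma isProbabilityMeasure_coefLaw {ϑ : ℝ} (hϑ : 0 < ϑ) {p : ℕ} (hp : 0 < p) (h₁ : Measure ℝ)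
    [IsProbabilityMeasure h₁] : IsProbabilityMeasure (coefLaw ϑ p h₁) := by
  constructor
  have h0 := dens_nonneg ϑ p
  have h1 := dens_le_one hϑ hp
  unfold dens at h0 h1
  simp only [coefLaw, Measure.coe_add, Measure.coe_smul, Pi.add_apply, Pi.smul_apply,
    measure_univ, smul_eq_mul, mul_one]
  rw [← ENNReal.ofReal_add (by linarith) h0]
  simp

lemma coefLaw_ne_zero {ϑ : ℝ} {p : ℕ} (h₁ : Measure ℝ) [IsProbabilityMeasure h₁]
    (h0 : h₁ {0} = 0) : coefLaw ϑ p h₁ {0}ᶜ = ENNReal.ofReal (dens ϑ p) := by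
  have : h₁ {0}ᶜ = 1 := by
    rw [prob_compl_eq_one_iff (measurableSet_singleton _)]; exact h0
  simp [coefLaw, this, dens]

lemma coefLaw_real_ne_zero {ϑ : ℝ} {p : ℕ} (h₁ : Measure ℝ) [IsProbabilityMeasure h₁]
    (h0 : h₁ {0} = 0) : (coefLaw ϑ p h₁).real {0}ᶜ = dens ϑ p := by
  rw [measureReal_def, coefLaw_ne_zero h₁ h0, ENNReal.toReal_ofReal (dens_nonneg _ _)]

/-- The probability that all coefficients in a given set are signals. -/
lemma coef_pi_all_ne_zero {ϑ : ℝ} (hϑ : 0 < ϑ) {p : ℕ} (hp : 0 < p) (h₁ : Measure ℝ)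
    [IsProbabilityMeasure h₁] (h0 : h₁ {0} = 0) (T : Finset (Fin p)) :
    (Measure.pi fun _ : Fin p => coefLaw ϑ p h₁).real {b | ∀ j ∈ T, b j ≠ 0} =
      dens ϑ p ^ T.card := by
  classical
  have := isProbabilityMeasure_coefLaw hϑ hp h₁
  have hset : {b : Fin p → ℝ | ∀ j ∈ T, b j ≠ 0} =
      Set.univ.pi fun j => if j ∈ T then ({0}ᶜ : Set ℝ) else Set.univ := by
    ext b
    simp only [Set.mem_ofPred_eq, Set.mem_pi, Set.mem_univ, true_implies]
    refine forall_congr' fun j => ?_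
    by_cases hj : j ∈ T <;> simp [hj]
  rw [hset, measureReal_def, Measure.pi_pi, ENNReal.toReal_prod]
  have : ∀ j : Fin p, ((coefLaw ϑ p h₁) (if j ∈ T then ({0}ᶜ : Set ℝ) else Set.univ)).toReal =
      if j ∈ T then dens ϑ p else 1 := by
    intro j
    split_ifs
    · exact coefLaw_real_ne_zero h₁ h0
    · simp
  simp only [this]
  rw [Finset.prod_ite_mem, Finset.univ_inter, Finset.prod_const]

/-- The number of signals exceeds three times its mean with exponentially small probability. -/
lemma coef_pi_many_signals {ϑ : ℝ} (hϑ : 0 < ϑ) {p : ℕ} (hp : 0 < p) (h₁ : Measure ℝ)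
    [IsProbabilityMeasure h₁] (h0 : h₁ {0} = 0) :
    (Measure.pi fun _ : Fin p => coefLaw ϑ p h₁).real
      {b | 3 * (p * dens ϑ p) ≤ ∑ j, ind (b j)} ≤ Real.exp (-(p * dens ϑ p)) := by
  have := isProbabilityMeasure_coefLaw hϑ hp h₁
  have hd := dens_nonneg ϑ p
  have hind : (fun x => Real.exp (ind x)) =
      fun x => 1 + ({0}ᶜ : Set ℝ).indicator (fun _ => Real.exp 1 - 1) x := by
    ext x
    by_cases hx : x = 0 <;> simp [ind, hx]
  have hint : Integrable (({0}ᶜ : Set ℝ).indicator fun _ => Real.exp 1 - 1) (coefLaw ϑ p h₁) :=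
    (integrable_const _).indicator (measurableSet_singleton _).compl
  have key := pi_chernoff (fun _ : Fin p => coefLaw ϑ p h₁) (fun _ x => ind x)
    (fun _ => 2 * dens ϑ p) (fun _ => by
      rw [hind]; exact (integrable_const _).add hint) (fun _ => by
      rw [hind, integral_add (integrable_const _) hint,
        integral_indicator_const _ (measurableSet_singleton _).compl,
        coefLaw_real_ne_zero h₁ h0]
      have h1 := Real.add_one_le_exp (2 * dens ϑ p)
      have h2 := Real.exp_one_lt_d9
      simp only [integral_const, probReal_univ, smul_eq_mul, mul_one]
      nlinarith) (3 * (p * dens ϑ p))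
  refine key.trans (Real.exp_le_exp.2 (le_of_eq ?_))
  rw [Finset.sum_const, Finset.card_univ, Fintype.card_fin, nsmul_eq_mul]
  ring

lemma coefLaw_support {ϑ : ℝ} {p : ℕ} (h₁ : Measure ℝ) {s : Set ℝ} (hs : h₁ sᶜ = 0)
    (hsm : MeasurableSet s) : coefLaw ϑ p h₁ ({0} ∪ s)ᶜ = 0 := by
  have h2 : h₁ ({0} ∪ s)ᶜ = 0 := measure_mono_null (by simp) hs
  simp only [coefLaw, Measure.coe_add, Measure.coe_smul, Pi.add_apply, Pi.smul_apply, h2,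
    smul_zero, add_zero]
  rw [Measure.dirac_apply' _ ((measurableSet_singleton _).union hsm).compl]
  simp

/-- Almost surely every coefficient is zero or lies in the support of the signal law. -/
lemma coef_pi_support {ϑ : ℝ} (hϑ : 0 < ϑ) {p : ℕ} (hp : 0 < p) (h₁ : Measure ℝ)
    [IsProbabilityMeasure h₁] {s : Set ℝ} (hs : h₁ sᶜ = 0) (hsm : MeasurableSet s) :
    (Measure.pi fun _ : Fin p => coefLaw ϑ p h₁) {b | ¬ ∀ j, b j ∈ {0} ∪ s} = 0 := by
  have := isProbabilityMeasure_coefLaw hϑ hp h₁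
  have : {b : Fin p → ℝ | ¬ ∀ j, b j ∈ {0} ∪ s} = ⋃ j, Function.eval j ⁻¹' (({0} ∪ s)ᶜ) := by
    ext b; simp
  rw [this, measure_iUnion_null_iff]
  intro j
  exact Measure.pi_eval_preimage_null _ (coefLaw_support h₁ hs hsm)

section productEvents

variable {α β γ : Type*} [MeasurableSpace α] [MeasurableSpace β] [MeasurableSpace γ]
  (μ : Measure α) (ν : Measure β) (ρ : Measure γ)
  [IsProbabilityMeasure ν] [IsProbabilityMeasure ρ]

lemma prod_real_le_of_section [IsProbabilityMeasure μ] {E : Set (α × β)}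
    (hE : MeasurableSet E) {c : ℝ} (hc : 0 ≤ c)
    (h : ∀ a, ν.real {b | (a, b) ∈ E} ≤ c) : (μ.prod ν).real E ≤ c := by
  rw [measureReal_def]
  refine ENNReal.toReal_le_of_le_ofReal hc ?_
  rw [Measure.prod_apply hE]
  calc ∫⁻ a, ν (Prod.mk a ⁻¹' E) ∂μ ≤ ∫⁻ _, ENNReal.ofReal c ∂μ := by
        refine lintegral_mono fun a => ?_
        rw [← ENNReal.ofReal_toReal (measure_ne_top ν (Prod.mk a ⁻¹' E))]
        exact ENNReal.ofReal_le_ofReal (h a)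
    _ = ENNReal.ofReal c := by simp

lemma prod_real_le_of_section' [IsProbabilityMeasure μ] {E : Set (α × β)}
    (hE : MeasurableSet E) {c : ℝ} (hc : 0 ≤ c)
    (h : ∀ b, μ.real {a | (a, b) ∈ E} ≤ c) : (μ.prod ν).real E ≤ c := by
  rw [measureReal_def]
  refine ENNReal.toReal_le_of_le_ofReal hc ?_
  rw [Measure.prod_apply_symm hE]
  calc ∫⁻ b, μ ((fun a => (a, b)) ⁻¹' E) ∂ν ≤ ∫⁻ _, ENNReal.ofReal c ∂ν := by
        refine lintegral_mono fun b => ?_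
        rw [← ENNReal.ofReal_toReal (measure_ne_top μ ((fun a => (a, b)) ⁻¹' E))]
        exact ENNReal.ofReal_le_ofReal (h b)
    _ = ENNReal.ofReal c := by simp

/-- In a triple product, an event on the middle factor is independent of one on the others. -/
lemma prod_prod_real_inter {S : Set β} {T : Set (α × γ)} (hS : MeasurableSet S)
    (hT : MeasurableSet T) :
    (μ.prod (ν.prod ρ)).real {ω | ω.2.1 ∈ S ∧ (ω.1, ω.2.2) ∈ T} =
      ν.real S * (μ.prod ρ).real T := by
  have hE : MeasurableSet {ω : α × β × γ | ω.2.1 ∈ S ∧ (ω.1, ω.2.2) ∈ T} :=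
    (hS.preimage (by fun_prop)).inter (hT.preimage (by fun_prop))
  simp only [measureReal_def]
  rw [← ENNReal.toReal_mul]
  congr 1
  rw [Measure.prod_apply hE, Measure.prod_apply hT, ← lintegral_const_mul]
  · refine lintegral_congr fun a => ?_
    rw [← Measure.prod_prod]
    rfl
  · exact measurable_measure_prodMk_left hT

lemma prod_prod_real_left {T : Set (α × β)} (hT : MeasurableSet T) :
    (μ.prod (ν.prod ρ)).real {ω | (ω.1, ω.2.1) ∈ T} = (μ.prod ν).real T := by
  have hE : MeasurableSet {ω : α × β × γ | (ω.1, ω.2.1) ∈ T} := hT.preimage (by fun_prop)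
  simp only [measureReal_def]
  congr 1
  rw [Measure.prod_apply hE, Measure.prod_apply hT]
  refine lintegral_congr fun a => ?_
  have : Prod.mk a ⁻¹' {ω : α × β × γ | (ω.1, ω.2.1) ∈ T} = (Prod.mk a ⁻¹' T) ×ˢ Set.univ := by
    ext ⟨b, c⟩; simp
  rw [this, Measure.prod_prod]
  simp

end productEvents

lemma measurable_designMatrix_mulVec {n p : ℕ} (v : Fin p → ℝ) :
    Measurable fun X : Design n p => designMatrix X *ᵥ v := by
  refine measurable_pi_lambda _ fun k => ?_
  simp only [mulVec, dotProduct, designMatrix, Matrix.of_apply]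
  fun_prop

lemma measurable_normSq {n p : ℕ} (v : Fin p → ℝ) :
    Measurable fun X : Design n p => normSq X v := by
  have h := measurable_designMatrix_mulVec (n := n) v
  unfold normSq dotProduct
  exact Finset.measurable_sum _ fun k _ =>
    ((measurable_pi_apply k).comp h).mul ((measurable_pi_apply k).comp h)

/-- Score of the noise, `X'ε`. -/
def noiseScore {n p : ℕ} (X : Design n p) (e : Fin n → ℝ) : Fin p → ℝ := (designMatrix X)ᵀ *ᵥ e

lemma dotProduct_noiseScore {n p : ℕ} (X : Design n p) (e : Fin n → ℝ) (v : Fin p → ℝ) :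
    v ⬝ᵥ noiseScore X e = (designMatrix X *ᵥ v) ⬝ᵥ e := by
  rw [noiseScore, dotProduct_mulVec, vecMul_transpose]

lemma measurable_dotProduct_noiseScore {n p : ℕ} (v : Fin p → ℝ) :
    Measurable fun ω : Design n p × (Fin n → ℝ) => v ⬝ᵥ noiseScore ω.1 ω.2 := by
  simp only [dotProduct_noiseScore]
  have h := (measurable_designMatrix_mulVec (n := n) v).comp
    (measurable_fst : Measurable (Prod.fst : Design n p × (Fin n → ℝ) → Design n p))
  unfold dotProduct
  exact Finset.measurable_sum _ fun k _ =>
    ((measurable_pi_apply k).comp h).mul ((measurable_pi_apply k).comp measurable_snd)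

lemma measurableSet_noise_event {n p : ℕ} (v : Fin p → ℝ) (s x : ℝ) :
    MeasurableSet {ω : Design n p × (Fin n → ℝ) |
      normSq ω.1 v ≤ s ∧ x ≤ v ⬝ᵥ noiseScore ω.1 ω.2} :=
  (measurableSet_le ((measurable_normSq v).comp measurable_fst) measurable_const).inter
    (measurableSet_le measurable_const (measurable_dotProduct_noiseScore v))

/-- Law of the noise. -/
abbrev noiseLaw (n : ℕ) : Measure (Fin n → ℝ) := Measure.pi fun _ => gaussianReal 0 1

/-- Law of the coefficient vector. -/
abbrev coefPi (ϑ : ℝ) (p : ℕ) (h₁ : Measure ℝ) : Measure (Fin p → ℝ) :=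
  Measure.pi fun _ => coefLaw ϑ p h₁

/-- Gaussian tail of `v'X'ε` on the event that `|X v|²` is bounded. -/
lemma noise_event {n p : ℕ} (μ : Measure (Design n p)) [IsProbabilityMeasure μ] (v : Fin p → ℝ)
    {s x : ℝ} (hs : 0 < s) (hx : 0 ≤ x) :
    (μ.prod (noiseLaw n)).real {ω | normSq ω.1 v ≤ s ∧ x ≤ v ⬝ᵥ noiseScore ω.1 ω.2} ≤
      Real.exp (-(x ^ 2 / (2 * s))) := by
  refine prod_real_le_of_section _ _ (measurableSet_noise_event v s x) (Real.exp_pos _).le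
    fun X => ?_
  simp only [Set.mem_ofPred_eq]
  by_cases h : normSq X v ≤ s
  · refine (measureReal_mono ?_).trans (noise_tail (designMatrix X *ᵥ v) hs h hx)
    intro e he
    rw [Set.mem_ofPred_eq] at he ⊢
    rw [← dotProduct_noiseScore]
    exact he.2
  · simp only [h, false_and]
    simpa using (Real.exp_pos _).le

section model

variable {n p : ℕ} {ϑ : ℝ} (Ω : Matrix (Fin p) (Fin p) ℝ)
  (h₁ : Measure ℝ) [IsProbabilityMeasure h₁]

lemma isProbabilityMeasure_modelLaw (hϑ : 0 < ϑ) (hp : 0 < p) :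
    IsProbabilityMeasure (modelLaw n ϑ Ω h₁) := by
  have := isProbabilityMeasure_coefLaw hϑ hp h₁
  unfold modelLaw; infer_instance

/-- An event on the coefficients together with a deviation of a linear form of `X'ε`. -/
lemma model_noise_event (hϑ : 0 < ϑ) (hp : 0 < p) {S : Set (Fin p → ℝ)} (hS : MeasurableSet S)
    (v : Fin p → ℝ) {s x : ℝ} (hs : 0 < s) (hx : 0 ≤ x) :
    (modelLaw n ϑ Ω h₁).real
        {ω | ω.2.1 ∈ S ∧ normSq ω.1 v ≤ s ∧ x ≤ v ⬝ᵥ noiseScore ω.1 ω.2.2} ≤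
      (coefPi ϑ p h₁).real S * Real.exp (-(x ^ 2 / (2 * s))) := by
  have := isProbabilityMeasure_coefLaw hϑ hp h₁
  have h := prod_prod_real_inter (designLaw n Ω) (coefPi ϑ p h₁) (noiseLaw n) hS
    (measurableSet_noise_event (n := n) v s x)
  unfold modelLaw
  simp only [Set.mem_ofPred_eq] at h
  rw [h]
  exact mul_le_mul_of_nonneg_left (noise_event _ v hs hx) measureReal_nonneg

lemma model_coef_event (hϑ : 0 < ϑ) (hp : 0 < p) {S : Set (Fin p → ℝ)} (hS : MeasurableSet S) :
    (modelLaw n ϑ Ω h₁).real {ω | ω.2.1 ∈ S} = (coefPi ϑ p h₁).real S := by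
  have := isProbabilityMeasure_coefLaw hϑ hp h₁
  have h := prod_prod_real_inter (designLaw n Ω) (coefPi ϑ p h₁) (noiseLaw n) hS
    MeasurableSet.univ
  unfold modelLaw
  simpa using h

lemma measurableSet_all_ne_zero (T : Finset (Fin p)) :
    MeasurableSet {b : Fin p → ℝ | ∀ j ∈ T, b j ≠ 0} := by
  have : {b : Fin p → ℝ | ∀ j ∈ T, b j ≠ 0} = ⋂ j ∈ T, {b : Fin p → ℝ | b j ≠ 0} := by
    ext; simp
  rw [this]
  exact T.measurableSet_biInter fun j _ =>
    (measurableSet_eq_fun (measurable_pi_apply j) measurable_const).compl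

lemma measurable_ind : Measurable ind := by
  unfold ind
  exact Measurable.ite (measurableSet_singleton (0 : ℝ)).compl measurable_const measurable_const

/-- On an event of overwhelming probability, the Gram matrix is entrywise within `d` of `Ω`, and
`X'Xβ` is within `d` of `Ωβ`, although the number of signals grows polynomially: only the sparsity
`p^{1-ϑ} ≪ n` matters. -/
lemma model_gram_event (hϑ : 0 < ϑ) (hp : 0 < p) (hn : 0 < n) (hΩ : Ω.PosSemidef)
    (hop : ∀ v, v ⬝ᵥ Ω *ᵥ v ≤ 2 * (v ⬝ᵥ v)) {τ τ' : ℝ} (hτ : 0 < τ) (hτ' : τ' ≤ 2 * τ)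
    (hsupp : h₁ (Set.Icc τ τ')ᶜ = 0) {δ d R : ℝ} (hδ : 0 < δ) (hδ1 : δ ≤ 1) (hR : 0 < R)
    (hRs : 3 * (p * dens ϑ p) * (4 * τ ^ 2) ≤ R ^ 2) (hd1 : 4 * δ ≤ d) (hd2 : 4 * δ * R ≤ d) :
    (modelLaw n ϑ Ω h₁).real {ω | ¬ ((∀ i j, |gramMatrix ω.1 i j - Ω i j| ≤ d) ∧
        (∀ i, |(gramMatrix ω.1 *ᵥ ω.2.1) i - (Ω *ᵥ ω.2.1) i| ≤ d) ∧
        ∀ j, ω.2.1 j = 0 ∨ (τ ≤ ω.2.1 j ∧ ω.2.1 j ≤ τ'))} ≤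
      Real.exp (-(p * dens ϑ p)) + (p ^ 2 + p) * (4 * Real.exp (-(n * δ ^ 2 / 8))) := by
  have := isProbabilityMeasure_coefLaw hϑ hp h₁
  have := isProbabilityMeasure_modelLaw (n := n) Ω h₁ hϑ hp
  have h0 : h₁ {0} = 0 := measure_mono_null (by simpa using fun h => absurd h hτ.not_ge) hsupp
  set c := 4 * Real.exp (-(n * δ ^ 2 / 8)) with hc
  have hc0 : 0 ≤ c := by positivity
  -- few signals
  have e1 : (modelLaw n ϑ Ω h₁).real {ω | 3 * (p * dens ϑ p) ≤ ∑ j, ind (ω.2.1 j)} ≤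
      Real.exp (-(p * dens ϑ p)) := by
    have hm : MeasurableSet {b : Fin p → ℝ | 3 * (p * dens ϑ p) ≤ ∑ j, ind (b j)} :=
      measurableSet_le measurable_const
        (Finset.measurable_sum _ fun j _ => measurable_ind.comp (measurable_pi_apply j))
    exact (model_coef_event Ω h₁ hϑ hp hm).trans_le (coef_pi_many_signals hϑ hp h₁ h0)
  have e2 : (modelLaw n ϑ Ω h₁).real {ω | ¬ ∀ j, ω.2.1 j ∈ {0} ∪ Set.Icc τ τ'} = 0 := by
    have hm : MeasurableSet {b : Fin p → ℝ | ¬ ∀ j, b j ∈ {0} ∪ Set.Icc τ τ'} := by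
      refine MeasurableSet.compl (s := {b : Fin p → ℝ | ∀ j, b j ∈ {0} ∪ Set.Icc τ τ'}) ?_
      exact MeasurableSet.univ_pi' fun _ => (measurableSet_singleton _).union measurableSet_Icc
    refine (model_coef_event Ω h₁ hϑ hp hm).trans ?_
    rw [measureReal_def, coef_pi_support hϑ hp h₁ hsupp measurableSet_Icc]
    rfl
  have hconc : ∀ (i : Fin p) (w : Fin p → ℝ) (R' : ℝ), 0 < R' → w ⬝ᵥ w ≤ R' ^ 2 → 4 * δ * R' ≤ d →
      (designLaw n Ω).real {X | d < |(gramMatrix X *ᵥ w) i - (Ω *ᵥ w) i|} ≤ c := by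
    intro i w R' hR' hw hd
    refine (measureReal_mono ?_).trans
      (gram_conc hn hΩ hop (Pi.single i 1) w (by simp) hR' hw hδ hδ1)
    intro X hX
    simp only [Set.mem_ofPred_eq, single_one_dotProduct] at hX ⊢
    linarith
  have e3 : ∀ i j, (modelLaw n ϑ Ω h₁).real {ω | d < |gramMatrix ω.1 i j - Ω i j|} ≤ c := by
    intro i j
    have hG := hconc i (Pi.single j 1) 1 one_pos (by simp) (by linarith)
    simp only [mulVec_single_one, col_apply] at hG
    refine le_trans (le_of_eq ?_) hG
    unfold modelLaw
    have := measureReal_prod_prod (μ := designLaw n Ω)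
      (ν := (coefPi ϑ p h₁).prod (noiseLaw n)) {X | d < |gramMatrix X i j - Ω i j|} Set.univ
    rw [probReal_univ, mul_one] at this
    rw [← this]
    congr 1
    ext ω; simp
  have e4 : ∀ i, (modelLaw n ϑ Ω h₁).real {ω | ω.2.1 ⬝ᵥ ω.2.1 ≤ R ^ 2 ∧
      d < |(gramMatrix ω.1 *ᵥ ω.2.1) i - (Ω *ᵥ ω.2.1) i|} ≤ c := by
    intro i
    have hcont : Measurable fun q : Design n p × (Fin p → ℝ) =>
        (gramMatrix q.1 *ᵥ q.2) i - (Ω *ᵥ q.2) i := by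
      simp only [mulVec, dotProduct, gramMatrix, designMatrix, Matrix.mul_apply,
        Matrix.transpose_apply, Matrix.of_apply]
      fun_prop
    have hm : MeasurableSet {q : Design n p × (Fin p → ℝ) | q.2 ⬝ᵥ q.2 ≤ R ^ 2 ∧
        d < |(gramMatrix q.1 *ᵥ q.2) i - (Ω *ᵥ q.2) i|} := by
      have hsq : Measurable fun q : Design n p × (Fin p → ℝ) => q.2 ⬝ᵥ q.2 := by
        unfold dotProduct
        fun_prop
      exact (measurableSet_le hsq measurable_const).inter
        (measurableSet_lt measurable_const hcont.abs)
    have h := prod_prod_real_left (designLaw n Ω) (coefPi ϑ p h₁) (noiseLaw n) hm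
    refine h.trans_le (prod_real_le_of_section' _ _ hm hc0 fun b => ?_)
    simp only [Set.mem_ofPred_eq]
    by_cases hb : b ⬝ᵥ b ≤ R ^ 2
    · simp only [hb, true_and]
      exact hconc i b R hR hb hd2
    · simp [hb, hc0]
  have hsub : {ω : Design n p × (Fin p → ℝ) × (Fin n → ℝ) |
        ¬ ((∀ i j, |gramMatrix ω.1 i j - Ω i j| ≤ d) ∧
        (∀ i, |(gramMatrix ω.1 *ᵥ ω.2.1) i - (Ω *ᵥ ω.2.1) i| ≤ d) ∧
        ∀ j, ω.2.1 j = 0 ∨ (τ ≤ ω.2.1 j ∧ ω.2.1 j ≤ τ'))} ⊆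
      (({ω | 3 * (p * dens ϑ p) ≤ ∑ j, ind (ω.2.1 j)} ∪
        {ω | ¬ ∀ j, ω.2.1 j ∈ {0} ∪ Set.Icc τ τ'}) ∪
        ⋃ ij : Fin p × Fin p, {ω | d < |gramMatrix ω.1 ij.1 ij.2 - Ω ij.1 ij.2|}) ∪
        ⋃ i : Fin p, {ω | ω.2.1 ⬝ᵥ ω.2.1 ≤ R ^ 2 ∧
          d < |(gramMatrix ω.1 *ᵥ ω.2.1) i - (Ω *ᵥ ω.2.1) i|} := by
    intro ω hω
    by_contra hcon
    simp only [Set.mem_union, Set.mem_iUnion, Set.mem_ofPred_eq, not_or, not_exists, not_le,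
      not_not, not_and, not_lt, Set.mem_singleton_iff, Set.mem_Icc] at hcon hω
    obtain ⟨⟨⟨h1, h2⟩, h3⟩, h4⟩ := hcon
    have hnorm : ω.2.1 ⬝ᵥ ω.2.1 ≤ R ^ 2 := by
      refine le_trans ?_ hRs
      calc ω.2.1 ⬝ᵥ ω.2.1 ≤ ∑ j, ind (ω.2.1 j) * (4 * τ ^ 2) := by
            refine Finset.sum_le_sum fun j _ => ?_
            rcases h2 j with h | h
            · simp [h, ind]
            · have : ω.2.1 j ≠ 0 := by linarith
              simp only [ind, ne_eq, this, not_false_eq_true, if_true]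
              nlinarith
        _ ≤ _ := by
            rw [← Finset.sum_mul]
            gcongr
    exact hω (fun i j => h3 (i, j)) (fun i => h4 i hnorm) h2
  refine (measureReal_mono hsub).trans ((measureReal_union_le _ _).trans ?_)
  refine (add_le_add ((measureReal_union_le _ _).trans (add_le_add
    ((measureReal_union_le _ _).trans (add_le_add e1 e2.le))
    ((measureReal_iUnion_fintype_le _).trans (Finset.sum_le_sum fun ij _ => e3 ij.1 ij.2))))
    ((measureReal_iUnion_fintype_le _).trans (Finset.sum_le_sum fun i _ => e4 i))).trans
    (le_of_eq ?_)
  simp only [Finset.sum_const, Finset.card_univ, Fintype.card_prod, Fintype.card_fin,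
    nsmul_eq_mul, Nat.cast_mul]
  ring

end model

/-! ### Quadratic forms and sparsity in the correlation class -/

namespace CorrelationClass

variable {γ A ω₀ : ℝ} {p : ℕ} {Ω : Matrix (Fin p) (Fin p) ℝ}

lemma symm (h : CorrelationClass γ A ω₀ Ω) (i j : Fin p) : Ω i j = Ω j i := by
  have := h.posSemidef.1.apply i j
  simpa using this.symm

lemma col_sum_le (h : CorrelationClass γ A ω₀ Ω) (j : Fin p) : ∑ i, |upperPart Ω i j| ≤ ω₀ :=
  (le_ciSup (f := fun j => ∑ i, |upperPart Ω i j|) (Set.finite_range _).bddAbove j).trans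
    ((le_max_left _ _).trans h.upperNorm_le)

lemma row_sum_le' (h : CorrelationClass γ A ω₀ Ω) (i : Fin p) : ∑ j, |upperPart Ω i j| ≤ ω₀ :=
  (le_ciSup (f := fun i => ∑ j, |upperPart Ω i j|) (Set.finite_range _).bddAbove i).trans
    ((le_max_right _ _).trans h.upperNorm_le)

lemma abs_le_upper (h : CorrelationClass γ A ω₀ Ω) (a b : Fin p) :
    |Ω a b - if a = b then 1 else 0| ≤ |upperPart Ω a b| + |upperPart Ω b a| := by
  rcases lt_trichotomy a b with hab | hab | hab
  · simp [upperPart, hab, hab.ne]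
  · subst hab
    simp [h.diag_eq_one]
  · simp [upperPart, hab, hab.ne', h.symm a b]

lemma offdiag_row_le (h : CorrelationClass γ A ω₀ Ω) (i : Fin p) :
    ∑ j, |Ω j i - if j = i then 1 else 0| ≤ 2 * ω₀ := by
  calc _ ≤ ∑ j, (|upperPart Ω j i| + |upperPart Ω i j|) :=
        Finset.sum_le_sum fun j _ => h.abs_le_upper j i
    _ ≤ 2 * ω₀ := by
        rw [Finset.sum_add_distrib]
        linarith [h.col_sum_le i, h.row_sum_le' i]

lemma abs_sum_offdiag_le (h : CorrelationClass γ A ω₀ Ω) {S : Finset (Fin p)} {i : Fin p}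
    (hi : i ∉ S) : |∑ a ∈ S, Ω a i| ≤ 2 * ω₀ := by
  refine (Finset.abs_sum_le_sum_abs _ _).trans ((Finset.sum_le_sum fun a ha => ?_).trans
    ((Finset.sum_le_sum_of_subset_of_nonneg (Finset.subset_univ S)
      fun a _ _ => abs_nonneg (Ω a i - if a = i then 1 else 0)).trans (h.offdiag_row_le i)))
  have : a ≠ i := fun e => hi (e ▸ ha)
  simp [this]

lemma abs_sum_row_le (h : CorrelationClass γ A ω₀ Ω) (i : Fin p) :
    ∑ j, |Ω j i| ≤ 1 + 2 * ω₀ := by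
  have h1 : ∀ j, |Ω j i| ≤ (if j = i then 1 else 0) + |Ω j i - if j = i then 1 else 0| := by
    intro j
    split_ifs <;> [skip; simp]
    linarith [abs_sub_abs_le_abs_sub (Ω j i) 1, abs_one (α := ℝ)]
  refine (Finset.sum_le_sum fun j _ => h1 j).trans ?_
  rw [Finset.sum_add_distrib]
  simp only [Finset.sum_ite_eq', Finset.mem_univ, if_true]
  linarith [h.offdiag_row_le i]

/-- The quadratic form of `Ω` differs from the Euclidean one by at most twice the form of the upper
part taken in absolute values. -/
lemma abs_quad_sub_le (h : CorrelationClass γ A ω₀ Ω) (v : Fin p → ℝ) :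
    |v ⬝ᵥ Ω *ᵥ v - v ⬝ᵥ v| ≤ 2 * ∑ b, ∑ a, |upperPart Ω a b| * (|v a| * |v b|) := by
  have e : v ⬝ᵥ Ω *ᵥ v - v ⬝ᵥ v =
      ∑ a, ∑ b, (Ω a b - if a = b then 1 else 0) * (v a * v b) := by
    simp only [dotProduct, mulVec, sub_mul, Finset.sum_sub_distrib, ite_mul, one_mul, zero_mul,
      Finset.sum_ite_eq, Finset.mem_univ, if_true, Finset.mul_sum]
    congr 1
    exact Finset.sum_congr rfl fun a _ => Finset.sum_congr rfl fun b _ => by ring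
  rw [e]
  calc _ ≤ ∑ a, ∑ b, (|upperPart Ω a b| + |upperPart Ω b a|) * (|v a| * |v b|) := by
        refine (Finset.abs_sum_le_sum_abs _ _).trans (Finset.sum_le_sum fun a _ =>
          (Finset.abs_sum_le_sum_abs _ _).trans (Finset.sum_le_sum fun b _ => ?_))
        rw [abs_mul, abs_mul]
        exact mul_le_mul_of_nonneg_right (h.abs_le_upper a b) (by positivity)
    _ = _ := by
        simp only [add_mul, Finset.sum_add_distrib]
        rw [Finset.sum_comm (f := fun a b => |upperPart Ω a b| * (|v a| * |v b|)), two_mul]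
        congr 1
        exact Finset.sum_congr rfl fun a _ => Finset.sum_congr rfl fun b _ => by ring

lemma abs_quad_sub_le_mul (h : CorrelationClass γ A ω₀ Ω) (v : Fin p → ℝ) :
    |v ⬝ᵥ Ω *ᵥ v - v ⬝ᵥ v| ≤ 2 * ω₀ * (v ⬝ᵥ v) := by
  refine (h.abs_quad_sub_le v).trans ?_
  have h1 : ∑ b, ∑ a, |upperPart Ω a b| * (|v a| * |v b|) ≤
      ∑ b, ∑ a, (|upperPart Ω a b| * (v a * v a) / 2 + |upperPart Ω a b| * (v b * v b) / 2) := by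
    refine Finset.sum_le_sum fun b _ => Finset.sum_le_sum fun a _ => ?_
    have : |v a| * |v b| ≤ (v a * v a) / 2 + (v b * v b) / 2 := by
      nlinarith [sq_nonneg (|v a| - |v b|), abs_mul_abs_self (v a), abs_mul_abs_self (v b)]
    nlinarith [mul_le_mul_of_nonneg_left this (abs_nonneg (upperPart Ω a b))]
  have h2 : ∑ b, ∑ a, (|upperPart Ω a b| * (v a * v a) / 2 + |upperPart Ω a b| * (v b * v b) / 2)
      ≤ ω₀ * (v ⬝ᵥ v) := by
    simp only [Finset.sum_add_distrib]
    rw [Finset.sum_comm]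
    simp only [← Finset.sum_div, ← Finset.sum_mul]
    have a1 : ∑ a, (∑ b, |upperPart Ω a b|) * (v a * v a) ≤ ∑ a, ω₀ * (v a * v a) :=
      Finset.sum_le_sum fun a _ => mul_le_mul_of_nonneg_right (h.row_sum_le' a)
        (mul_self_nonneg _)
    have a2 : ∑ b, (∑ a, |upperPart Ω a b|) * (v b * v b) ≤ ∑ b, ω₀ * (v b * v b) :=
      Finset.sum_le_sum fun b _ => mul_le_mul_of_nonneg_right (h.col_sum_le b)
        (mul_self_nonneg _)
    rw [← Finset.mul_sum] at a1 a2
    simp only [dotProduct]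
    linarith
  linarith

lemma quad_le (h : CorrelationClass γ A ω₀ Ω) (hω : ω₀ < 1 / 2) (v : Fin p → ℝ) :
    v ⬝ᵥ Ω *ᵥ v ≤ 2 * (v ⬝ᵥ v) := by
  have h1 := abs_le.1 (h.abs_quad_sub_le_mul v)
  have h2 : 0 ≤ v ⬝ᵥ v := Finset.sum_nonneg fun i _ => mul_self_nonneg _
  nlinarith [h1.2]

lemma le_quad (h : CorrelationClass γ A ω₀ Ω) (v : Fin p → ℝ) :
    (1 - 2 * ω₀) * (v ⬝ᵥ v) ≤ v ⬝ᵥ Ω *ᵥ v := by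
  have h1 := abs_le.1 (h.abs_quad_sub_le_mul v)
  linarith [h1.1]

/-- For a sign vector supported on a set of `s ≥ 1` elements, `|v'Ωv - s| ≤ 2 ω₀ (s - 1)`: the first
element of the set has no predecessor, which saves one column sum. -/
lemma abs_quad_sign_sub_le (h : CorrelationClass γ A ω₀ Ω) {S : Finset (Fin p)}
    (hS : S.Nonempty) {v : Fin p → ℝ} (hv : ∀ a ∈ S, |v a| = 1) (hv0 : ∀ a ∉ S, v a = 0) :
    |v ⬝ᵥ Ω *ᵥ v - S.card| ≤ 2 * ω₀ * (S.card - 1) := by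
  have e : v ⬝ᵥ v = S.card := by
    have : ∀ a, v a * v a = if a ∈ S then 1 else 0 := by
      intro a
      split_ifs with ha
      · rw [← abs_mul_abs_self, hv a ha, one_mul]
      · rw [hv0 a ha, zero_mul]
    simp [dotProduct, this]
  rw [← e]
  refine (h.abs_quad_sub_le v).trans ?_
  rw [e]
  have hle : ∀ b, ∑ a, |upperPart Ω a b| * (|v a| * |v b|) ≤
      if b ∈ S.erase (S.min' hS) then ω₀ else 0 := by
    intro b
    have hle1 : ∀ a, |v a| ≤ 1 := fun a => by
      by_cases ha : a ∈ S
      · exact (hv a ha).le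
      · simp [hv0 a ha]
    split_ifs with hb
    · refine (Finset.sum_le_sum fun a _ => ?_).trans (h.col_sum_le b)
      have : |v a| * |v b| ≤ 1 := mul_le_one₀ (hle1 a) (abs_nonneg _) (hle1 b)
      exact mul_le_of_le_one_right (abs_nonneg _) this
    · refine (Finset.sum_nonpos fun a _ => le_of_eq ?_)
      by_cases hbS : b ∈ S
      · have hbm : b = S.min' hS := by
          by_contra hne; exact hb (Finset.mem_erase.2 ⟨hne, hbS⟩)
        by_cases haS : a ∈ S
        · have : ¬ a < b := by rw [hbm, not_lt]; exact S.min'_le a haS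
          simp [upperPart, this]
        · simp [hv0 a haS]
      · simp [hv0 b hbS]
  have h2 := Finset.sum_le_sum fun b (_ : b ∈ Finset.univ) => hle b
  rw [Finset.sum_ite_mem, Finset.univ_inter, Finset.sum_const, nsmul_eq_mul,
    Finset.card_erase_of_mem (S.min'_mem hS), Nat.cast_pred hS.card_pos] at h2
  linarith

/-- The indices whose correlation with `i` exceeds `t` in absolute value. -/
def _root_.UPT.nbhd {p : ℕ} (Ω : Matrix (Fin p) (Fin p) ℝ) (t : ℝ) (i : Fin p) : Finset (Fin p) :=
  Finset.univ.filter fun j => t < |Ω i j|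

lemma card_nbhd_le (h : CorrelationClass γ A ω₀ Ω) (hγ0 : 0 < γ) (hγ1 : γ < 1) {t : ℝ}
    (ht0 : 0 < t) (ht1 : t ≤ 1) (i : Fin p) : ((nbhd Ω t i).card : ℝ) ≤ A / t := by
  have h1 : ∑ j ∈ nbhd Ω t i, t ≤ ∑ j ∈ nbhd Ω t i, |Ω i j| ^ γ := by
    refine Finset.sum_le_sum fun j hj => ?_
    have hj' : t < |Ω i j| := by simpa [nbhd] using hj
    calc t = t ^ (1 : ℝ) := (Real.rpow_one t).symm
      _ ≤ t ^ γ := Real.rpow_le_rpow_of_exponent_ge ht0 ht1 hγ1.le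
      _ ≤ _ := Real.rpow_le_rpow ht0.le hj'.le hγ0.le
  have h2 := Finset.sum_le_sum_of_subset_of_nonneg (Finset.subset_univ (nbhd Ω t i))
    fun j _ _ => Real.rpow_nonneg (abs_nonneg (Ω i j)) γ
  rw [Finset.sum_const, nsmul_eq_mul] at h1
  rw [le_div_iff₀ ht0]
  exact h1.trans (h2.trans (h.row_sum_le i))

lemma tail_row_le (h : CorrelationClass γ A ω₀ Ω) (hγ1 : γ < 1) {t : ℝ}
    (ht0 : 0 < t) (i : Fin p) {T : Finset (Fin p)} (hT : Disjoint T (nbhd Ω t i)) :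
    ∑ j ∈ T, |Ω i j| ≤ t ^ (1 - γ) * A := by
  calc ∑ j ∈ T, |Ω i j| ≤ ∑ j ∈ T, t ^ (1 - γ) * |Ω i j| ^ γ := by
        refine Finset.sum_le_sum fun j hj => ?_
        have hj' : |Ω i j| ≤ t := by
          have := Finset.disjoint_left.1 hT hj
          simpa [nbhd] using this
        rcases (abs_nonneg (Ω i j)).eq_or_lt with h0 | h0
        · rw [← h0]
          positivity
        · calc |Ω i j| = |Ω i j| ^ (1 - γ) * |Ω i j| ^ γ := by
                rw [← Real.rpow_add h0]; simp
            _ ≤ _ := by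
                gcongr
    _ ≤ t ^ (1 - γ) * ∑ j, |Ω i j| ^ γ := by
        rw [← Finset.mul_sum]
        gcongr
        exact Finset.subset_univ T
    _ ≤ _ := by gcongr; exact h.row_sum_le i

end CorrelationClass

/-- The ball of radius `k` about `i` in the graph that joins indices with correlation above `t`. -/
def corrBall {p : ℕ} (Ω : Matrix (Fin p) (Fin p) ℝ) (t : ℝ) (i : Fin p) : ℕ → Finset (Fin p)
  | 0 => {i}
  | k + 1 => (corrBall Ω t i k).biUnion (nbhd Ω t)

lemma mem_corrBall_succ {p : ℕ} {Ω : Matrix (Fin p) (Fin p) ℝ} {t : ℝ} {i a b : Fin p} {k : ℕ}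
    (ha : a ∈ corrBall Ω t i k) (hab : t < |Ω a b|) : b ∈ corrBall Ω t i (k + 1) :=
  Finset.mem_biUnion.2 ⟨a, ha, by simp [nbhd, hab]⟩

lemma corrBall_card_le {γ A ω₀ : ℝ} {p : ℕ} {Ω : Matrix (Fin p) (Fin p) ℝ}
    (h : CorrelationClass γ A ω₀ Ω) (hγ0 : 0 < γ) (hγ1 : γ < 1) {t : ℝ}
    (ht0 : 0 < t) (ht1 : t ≤ 1) (i : Fin p) (k : ℕ) :
    ((corrBall Ω t i k).card : ℝ) ≤ (A / t) ^ k := by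
  induction k with
  | zero => simp [corrBall]
  | succ k ih =>
    have h1 : ((corrBall Ω t i (k + 1)).card : ℝ) ≤
        ∑ a ∈ corrBall Ω t i k, ((nbhd Ω t a).card : ℝ) := by
      exact_mod_cast Finset.card_biUnion_le
    refine h1.trans ((Finset.sum_le_sum fun a _ => h.card_nbhd_le hγ0 hγ1 ht0 ht1 a).trans ?_)
    rw [Finset.sum_const, nsmul_eq_mul, pow_succ]
    have : 0 ≤ A / t := le_trans (Nat.cast_nonneg _) (h.card_nbhd_le hγ0 hγ1 ht0 ht1 i)
    gcongr

lemma corrBall_subset_succ {γ A ω₀ : ℝ} {p : ℕ} {Ω : Matrix (Fin p) (Fin p) ℝ}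
    (h : CorrelationClass γ A ω₀ Ω) {t : ℝ} (ht1 : t < 1) (i : Fin p) (k : ℕ) :
    corrBall Ω t i k ⊆ corrBall Ω t i (k + 1) := fun a ha =>
  mem_corrBall_succ ha (by simp [h.diag_eq_one, ht1])

lemma self_mem_corrBall {γ A ω₀ : ℝ} {p : ℕ} {Ω : Matrix (Fin p) (Fin p) ℝ}
    (h : CorrelationClass γ A ω₀ Ω) {t : ℝ} (ht1 : t < 1) (i : Fin p) (k : ℕ) :
    i ∈ corrBall Ω t i k := by
  induction k with
  | zero => simp [corrBall]
  | succ k ih => exact corrBall_subset_succ h ht1 i k ih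

/-! ### Components of the survivors and the penalized criterion -/

lemma gramGraph_adj {n p : ℕ} (X : Design n p) (a b : Fin p) :
    (gramGraph X).Adj a b ↔ a ≠ b ∧ (Real.log p ^ 2)⁻¹ < |gramMatrix X a b| := by
  have hs : gramMatrix X b a = gramMatrix X a b := by
    have : (gramMatrix X)ᵀ = gramMatrix X := by simp [gramMatrix, transpose_mul]
    exact congrFun (congrFun this a) b
  have hne : ∀ x : ℝ, (Real.log p ^ 2)⁻¹ < |x| → x ≠ 0 := fun x hx h0 => by
    rw [h0, abs_zero] at hx
    exact absurd hx (not_lt.2 (by positivity))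
  simp only [gramGraph, SimpleGraph.fromRel_adj, regGram, Matrix.of_apply, hs, or_self]
  refine and_congr_right fun _ => ?_
  split_ifs with h
  · exact ⟨fun _ => h, fun _ => hne _ h⟩
  · simp [h]

/-- The component of a survivor: it is closed under adjacency among the survivors, and is the
smallest such set that contains the given survivor. -/
lemma exists_component {n p : ℕ} {t₁ : ℝ} {X : Design n p} {Y : Fin n → ℝ} {i : Fin p}
    (hi : i ∈ survivors t₁ X Y) :
    ∃ I : Finset (Fin p), IsComponent t₁ X Y I ∧ i ∈ I ∧ (∀ b ∈ I, b ∈ survivors t₁ X Y) ∧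
      (∀ b ∈ I, ∀ j ∈ survivors t₁ X Y, (gramGraph X).Adj b j → j ∈ I) ∧
      ∀ J : Finset (Fin p), i ∈ J →
        (∀ b ∈ J, b ∈ I → ∀ j ∈ survivors t₁ X Y, (gramGraph X).Adj b j → j ∈ J) → I ⊆ J := by
  classical
  set H := (gramGraph X).induce (survivors t₁ X Y)
  set C := H.connectedComponentMk ⟨i, hi⟩ with hC
  have hmem : ∀ b, b ∈ (Subtype.val '' C.supp : Set (Fin p)).toFinset ↔
      ∃ hb : b ∈ survivors t₁ X Y, H.Reachable ⟨i, hi⟩ ⟨b, hb⟩ := by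
    intro b
    simp only [Set.mem_toFinset, Set.mem_image, SimpleGraph.ConnectedComponent.mem_supp_iff, hC,
      SimpleGraph.ConnectedComponent.eq]
    constructor
    · rintro ⟨⟨x, hx⟩, h, rfl⟩
      exact ⟨hx, h.symm⟩
    · rintro ⟨hb, h⟩
      exact ⟨⟨b, hb⟩, h.symm, rfl⟩
  refine ⟨(Subtype.val '' C.supp : Set (Fin p)).toFinset, ⟨C, by simp⟩, (hmem i).2 ⟨hi, .rfl⟩,
    fun b hb => ((hmem b).1 hb).1, fun b hb j hj hadj => ?_, fun J hiJ hJ j hj => ?_⟩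
  · obtain ⟨hb', hr⟩ := (hmem b).1 hb
    refine (hmem j).2 ⟨hj, hr.trans (SimpleGraph.Adj.reachable ?_)⟩
    exact hadj
  · obtain ⟨hj', hr⟩ := (hmem j).1 hj
    rw [SimpleGraph.reachable_iff_reflTransGen] at hr
    have key : ∀ x : survivors t₁ X Y, Relation.ReflTransGen H.Adj ⟨i, hi⟩ x → (x : Fin p) ∈ J := by
      intro x hx
      induction hx with
      | refl => exact hiJ
      | tail hab hadj ih =>
        exact hJ _ ih ((hmem _).2 ⟨Subtype.prop _,
          (SimpleGraph.reachable_iff_reflTransGen _ _).2 hab⟩) _ (Subtype.prop _) hadj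
    exact key _ hr

/-- If at most `m` survivors lie within `m` correlation steps of `i`, the component of `i` stays
within `m` steps: otherwise each step would add a new survivor. -/
lemma component_subset_corrBall {n p : ℕ} {t₁ t : ℝ} {X : Design n p} {Y : Fin n → ℝ} {i : Fin p}
    {Ω : Matrix (Fin p) (Fin p) ℝ} {I : Finset (Fin p)} {m : ℕ}
    (hball : ∀ k, corrBall Ω t i k ⊆ corrBall Ω t i (k + 1))
    (hadj : ∀ a b, (gramGraph X).Adj a b → t < |Ω a b|)
    (hiI : i ∈ I) (hI : ∀ b ∈ I, b ∈ survivors t₁ X Y)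
    (hclosed : ∀ b ∈ I, ∀ j ∈ survivors t₁ X Y, (gramGraph X).Adj b j → j ∈ I)
    (hmin : ∀ J : Finset (Fin p), i ∈ J →
        (∀ b ∈ J, b ∈ I → ∀ j ∈ survivors t₁ X Y, (gramGraph X).Adj b j → j ∈ J) → I ⊆ J)
    (hcard : ∀ J ⊆ corrBall Ω t i m, (∀ b ∈ J, b ∈ survivors t₁ X Y) → J.card ≤ m) :
    I ⊆ corrBall Ω t i m ∧ I.card ≤ m := by
  classical
  have hmono : Monotone (corrBall Ω t i) := monotone_nat_of_le_succ hball
  set J : ℕ → Finset (Fin p) := fun k => I ∩ corrBall Ω t i k with hJ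
  have hi0 : ∀ k, i ∈ J k := fun k => Finset.mem_inter.2
    ⟨hiI, hmono (Nat.zero_le k) (by simp [corrBall])⟩
  have hsub : I ⊆ corrBall Ω t i m := by
    by_contra hcon
    have hgrow : ∀ k, k ≤ m → k + 1 ≤ (J k).card := by
      intro k
      induction k with
      | zero => exact fun _ => Finset.card_pos.2 ⟨i, hi0 0⟩
      | succ k ih =>
        intro hk
        have hlt : J k ⊂ J (k + 1) := by
          refine (Finset.inter_subset_inter_left (hball k)).ssubset_of_ne fun heq => hcon ?_
          refine (hmin (J k) (hi0 k) fun b hb hbI j hj hbj => ?_).trans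
            (Finset.inter_subset_right.trans (hmono (by omega)))
          have hj1 : j ∈ J (k + 1) := Finset.mem_inter.2 ⟨hclosed b hbI j hj hbj,
            mem_corrBall_succ (Finset.mem_inter.1 hb).2 (hadj b j hbj)⟩
          change J k = J (k + 1) at heq
          rwa [heq]
        have := Finset.card_lt_card hlt
        have := ih (by omega)
        omega
    have h1 := hgrow m le_rfl
    have h2 := hcard (J m) Finset.inter_subset_right
      fun b hb => hI b (Finset.mem_inter.1 hb).1
    omega
  exact ⟨hsub, hcard I hsub hI⟩

lemma abs_quad_sub_quad_le {p : ℕ} {G Ω : Matrix (Fin p) (Fin p) ℝ} {d : ℝ}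
    (hG : ∀ i j, |G i j - Ω i j| ≤ d) (v : Fin p → ℝ) :
    |v ⬝ᵥ G *ᵥ v - v ⬝ᵥ Ω *ᵥ v| ≤ d * (∑ a, |v a|) ^ 2 := by
  have e : v ⬝ᵥ G *ᵥ v - v ⬝ᵥ Ω *ᵥ v = ∑ a, ∑ b, (G a b - Ω a b) * (v a * v b) := by
    simp only [dotProduct, mulVec, sub_mul, Finset.sum_sub_distrib, Finset.mul_sum]
    congr 1 <;>
    exact Finset.sum_congr rfl fun a _ => Finset.sum_congr rfl fun b _ => by ring
  rw [e, sq, Finset.sum_mul_sum, Finset.mul_sum]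
  refine (Finset.abs_sum_le_sum_abs _ _).trans (Finset.sum_le_sum fun a _ =>
    (Finset.abs_sum_le_sum_abs _ _).trans ?_)
  rw [Finset.mul_sum]
  refine Finset.sum_le_sum fun b _ => ?_
  rw [abs_mul, abs_mul]
  exact mul_le_mul_of_nonneg_right (hG a b) (by positivity)

/-- The indicator vector of a set of indices. -/
def indVec {p : ℕ} (S : Finset (Fin p)) : Fin p → ℝ := fun a => if a ∈ S then 1 else 0

lemma indVec_dotProduct {p : ℕ} (S : Finset (Fin p)) (w : Fin p → ℝ) :
    indVec S ⬝ᵥ w = ∑ a ∈ S, w a := by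
  simp [indVec, dotProduct]

lemma sum_abs_indVec {p : ℕ} (S : Finset (Fin p)) : ∑ a, |indVec S a| = S.card := by
  have : ∀ a, |indVec S a| = if a ∈ S then 1 else 0 := fun a => by
    unfold indVec; split_ifs <;> simp
  simp [this]

/-- The part of the penalized criterion at `t₃ 1_S` that depends on `S`. -/
def excess {p : ℕ} (t₂ t₃ : ℝ) (G : Matrix (Fin p) (Fin p) ℝ) (W : Fin p → ℝ)
    (S : Finset (Fin p)) : ℝ :=
  1 / 2 * t₃ ^ 2 * (indVec S ⬝ᵥ G *ᵥ indVec S) - t₃ * (∑ a ∈ S, W a) + 1 / 2 * t₂ ^ 2 * S.card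

lemma excess_empty {p : ℕ} (t₂ t₃ : ℝ) (G : Matrix (Fin p) (Fin p) ℝ) (W : Fin p → ℝ) :
    excess t₂ t₃ G W ∅ = 0 := by
  simp [excess, indVec, dotProduct]

lemma excess_singleton {p : ℕ} (t₂ t₃ : ℝ) (G : Matrix (Fin p) (Fin p) ℝ) (W : Fin p → ℝ)
    (j : Fin p) :
    excess t₂ t₃ G W {j} = 1 / 2 * t₃ ^ 2 * G j j - t₃ * W j + 1 / 2 * t₂ ^ 2 := by
  simp [excess, mulVec, dotProduct, indVec]

lemma quad_inverse_expand {ι : Type*} [Fintype ι] [DecidableEq ι] (G : Matrix ι ι ℝ)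
    (hG : G.det ≠ 0) (hs : Gᵀ = G) (w μ : ι → ℝ) :
    (w - G *ᵥ μ) ⬝ᵥ (G⁻¹ *ᵥ (w - G *ᵥ μ)) = w ⬝ᵥ (G⁻¹ *ᵥ w) - 2 * (μ ⬝ᵥ w) + μ ⬝ᵥ G *ᵥ μ := by
  have hu : IsUnit G.det := isUnit_iff_ne_zero.2 hG
  have h1 : G⁻¹ *ᵥ (G *ᵥ μ) = μ := by
    rw [mulVec_mulVec, Matrix.nonsing_inv_mul _ hu, one_mulVec]
  have h2 : (G *ᵥ μ) ⬝ᵥ (G⁻¹ *ᵥ w) = μ ⬝ᵥ w := by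
    rw [dotProduct_comm, dotProduct_mulVec, ← mulVec_transpose, hs, mulVec_mulVec,
      Matrix.mul_nonsing_inv _ hu, one_mulVec, dotProduct_comm]
  rw [mulVec_sub, h1, dotProduct_sub, sub_dotProduct, sub_dotProduct, h2, dotProduct_comm w μ,
    dotProduct_comm (G *ᵥ μ) μ]
  ring

/-- The criterion at `t₃ 1_S` is a constant plus `excess`, when the Gram matrix of the component is
invertible. -/
lemma criterion_eq {n p : ℕ} {t₂ t₃ : ℝ} (ht₃ : t₃ ≠ 0) (X : Design n p) (Y : Fin n → ℝ)
    (I : Finset (Fin p))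
    (hdet : ((gramMatrix X).submatrix (Subtype.val : I → Fin p) Subtype.val).det ≠ 0)
    {S : Finset (Fin p)} (hS : S ⊆ I) :
    criterion t₂ X Y I (fun a => if (a : Fin p) ∈ S then t₃ else 0) =
      1 / 2 * ((fun a : I => marginal X Y a) ⬝ᵥ
        (((gramMatrix X).submatrix (Subtype.val : I → Fin p) Subtype.val)⁻¹ *ᵥ
          fun a : I => marginal X Y a)) + excess t₂ t₃ (gramMatrix X) (marginal X Y) S := by
  classical
  have hs : ((gramMatrix X).submatrix (Subtype.val : I → Fin p) (Subtype.val : I → Fin p))ᵀ =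
      (gramMatrix X).submatrix Subtype.val Subtype.val := by
    rw [transpose_submatrix]; congr 1; simp [gramMatrix, transpose_mul]
  have hsum : ∀ f : Fin p → ℝ, ∑ a : I, (if (a : Fin p) ∈ S then f a else 0) = ∑ a ∈ S, f a := by
    intro f
    rw [Finset.sum_coe_sort I (fun a => if a ∈ S then f a else 0), Finset.sum_ite_mem,
      Finset.inter_eq_right.2 hS]
  have hq := quad_inverse_expand _ hdet hs (fun a : I => marginal X Y a)
    (fun a : I => if (a : Fin p) ∈ S then t₃ else 0)
  have e1 : (fun a : I => if (a : Fin p) ∈ S then t₃ else 0) ⬝ᵥ (fun a : I => marginal X Y a) =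
      t₃ * ∑ a ∈ S, marginal X Y a := by
    simp only [dotProduct, ite_mul, zero_mul]
    rw [hsum (fun a => t₃ * marginal X Y a), Finset.mul_sum]
  have e2 : (fun a : I => if (a : Fin p) ∈ S then t₃ else 0) ⬝ᵥ
      ((gramMatrix X).submatrix (Subtype.val : I → Fin p) Subtype.val) *ᵥ
        (fun a : I => if (a : Fin p) ∈ S then t₃ else 0) =
      t₃ ^ 2 * (indVec S ⬝ᵥ gramMatrix X *ᵥ indVec S) := by
    rw [indVec_dotProduct]
    simp only [dotProduct, mulVec, submatrix_apply, ite_mul, zero_mul, mul_ite, mul_zero, indVec,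
      mul_one]
    have hrow : ∀ a : Fin p, ∑ b : I, (if (b : Fin p) ∈ S then gramMatrix X a b * t₃ else 0) =
        ∑ b ∈ S, gramMatrix X a b * t₃ := fun a => hsum fun b => gramMatrix X a b * t₃
    simp only [hrow]
    rw [hsum (fun a => t₃ * ∑ b ∈ S, gramMatrix X a b * t₃), Finset.mul_sum]
    refine Finset.sum_congr rfl fun a _ => ?_
    rw [Finset.sum_ite_mem, Finset.univ_inter, ← Finset.sum_mul]
    ring
  have e3 : (Finset.univ.filter fun a : I => (if (a : Fin p) ∈ S then t₃ else 0) ≠ 0).card =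
      S.card := by
    have : (Finset.univ.filter fun a : I => (if (a : Fin p) ∈ S then t₃ else 0) ≠ 0) =
        Finset.univ.filter fun a : I => (a : Fin p) ∈ S := by
      refine Finset.filter_congr fun a _ => ?_
      by_cases h : (a : Fin p) ∈ S <;> simp [h, ht₃]
    rw [this, ← Finset.card_map (Function.Embedding.subtype _)]
    congr 1
    ext a
    simp only [Finset.mem_map, Finset.mem_filter, Finset.mem_univ, true_and,
      Function.Embedding.coe_subtype, Subtype.exists, exists_and_right, exists_eq_right]
    exact ⟨fun h => h.2, fun h => ⟨hS h, h⟩⟩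
  rw [e1, e2] at hq
  have e4 : criterion t₂ X Y I (fun a => if (a : Fin p) ∈ S then t₃ else 0) =
      1 / 2 * (((fun a : I => marginal X Y a) -
        (gramMatrix X).submatrix (Subtype.val : I → Fin p) Subtype.val *ᵥ
          fun a : I => if (a : Fin p) ∈ S then t₃ else 0) ⬝ᵥ
        (((gramMatrix X).submatrix (Subtype.val : I → Fin p) Subtype.val)⁻¹ *ᵥ
        ((fun a : I => marginal X Y a) -
        (gramMatrix X).submatrix (Subtype.val : I → Fin p) Subtype.val *ᵥ
          fun a : I => if (a : Fin p) ∈ S then t₃ else 0))) +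
      1 / 2 * t₂ ^ 2 * ((Finset.univ.filter
        fun a : I => (if (a : Fin p) ∈ S then t₃ else 0) ≠ 0).card : ℝ) := by
    unfold criterion
    congr!
  rw [e4, hq, e3]
  unfold excess
  ring

/-- Principal submatrices of a matrix entrywise close to `Ω` are invertible when they are small. -/
lemma det_submatrix_ne_zero {γ A ω₀ : ℝ} {p : ℕ} {G Ω : Matrix (Fin p) (Fin p) ℝ} {d : ℝ}
    (h : CorrelationClass γ A ω₀ Ω) (hG : ∀ i j, |G i j - Ω i j| ≤ d) (I : Finset (Fin p))
    (hd : d * I.card < 1 - 2 * ω₀) :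
    (G.submatrix (Subtype.val : I → Fin p) Subtype.val).det ≠ 0 := by
  classical
  intro hdet
  obtain ⟨x, hx0, hx⟩ := Matrix.exists_mulVec_eq_zero_iff.2 hdet
  set v : Fin p → ℝ := fun a => if ha : a ∈ I then x ⟨a, ha⟩ else 0 with hv
  have hsum : ∀ f : Fin p → ℝ, (∀ a ∉ I, f a = 0) → ∑ a, f a = ∑ a : I, f a := by
    intro f hf
    rw [Finset.sum_coe_sort I f]
    exact (Finset.sum_subset (Finset.subset_univ I) fun a _ ha => hf a ha).symm
  have hv0 : ∀ a ∉ I, v a = 0 := fun a ha => by simp [hv, ha]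
  have hvI : ∀ a : I, v a = x a := fun a => by simp [hv]
  have e0 : v ⬝ᵥ G *ᵥ v = 0 := by
    have : ∀ a : I, (G *ᵥ v) a = 0 := by
      intro a
      have := congrFun hx a
      simp only [mulVec, dotProduct, submatrix_apply, Pi.zero_apply] at this ⊢
      rw [hsum _ fun b hb => by rw [hv0 b hb, mul_zero]]
      simpa [hvI] using this
    rw [dotProduct, hsum _ fun b hb => by rw [hv0 b hb, zero_mul]]
    simp [this]
  have hpos : 0 < v ⬝ᵥ v := by
    obtain ⟨a, ha⟩ := Function.ne_iff.1 hx0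
    have : 0 < v a * v a := by rw [hvI a]; exact mul_self_pos.2 ha
    exact this.trans_le (Finset.single_le_sum (f := fun a => v a * v a)
      (fun b _ => mul_self_nonneg _) (Finset.mem_univ (a : Fin p)))
  have h1 := h.le_quad v
  have h2 := abs_le.1 (abs_quad_sub_quad_le hG v)
  have h3 : (∑ a, |v a|) ^ 2 ≤ I.card * (v ⬝ᵥ v) := by
    have e : ∑ a, |v a| = ∑ a ∈ I, |v a| :=
      (Finset.sum_subset (Finset.subset_univ I) fun a _ ha => by rw [hv0 a ha, abs_zero]).symm
    rw [e]
    refine sq_sum_le_card_mul_sum_sq.trans ?_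
    gcongr
    simp only [sq_abs]
    simp only [sq, dotProduct]
    exact Finset.sum_le_sum_of_subset_of_nonneg (f := fun a => v a * v a) (Finset.subset_univ I)
      fun b _ _ => mul_self_nonneg (v b)
  have hd0 : 0 ≤ d := by
    obtain ⟨a, -⟩ := Function.ne_iff.1 hx0
    exact (abs_nonneg _).trans (hG a a)
  have h4 := mul_le_mul_of_nonneg_left h3 hd0
  have h5 := mul_lt_mul_of_pos_right hd hpos
  nlinarith [h2.1]

/-- What the minimality of the estimate says about the component of a survivor. -/
lemma IsEstimate.excess_le {n p : ℕ} {t₁ t₂ t₃ : ℝ} {X : Design n p} {Y : Fin n → ℝ}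
    {b : Fin p → ℝ} (hb : IsEstimate t₁ t₂ t₃ X Y b) (ht₃ : t₃ ≠ 0) {I : Finset (Fin p)}
    (hI : IsComponent t₁ X Y I)
    (hdet : ((gramMatrix X).submatrix (Subtype.val : I → Fin p) Subtype.val).det ≠ 0)
    {T : Finset (Fin p)} (hT : T ⊆ I) :
    excess t₂ t₃ (gramMatrix X) (marginal X Y) (I.filter fun a => b a ≠ 0) ≤
      excess t₂ t₃ (gramMatrix X) (marginal X Y) T := by
  have h := hb.minimizes I hI (fun a => if (a : Fin p) ∈ T then t₃ else 0)
    (fun a => by by_cases ha : (a : Fin p) ∈ T <;> simp [ha])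
  have e : (fun a : I => b a) =
      fun a : I => if (a : Fin p) ∈ I.filter (fun a => b a ≠ 0) then t₃ else 0 := by
    ext a
    rcases hb.mem_pair a with h0 | h0
    · simp [h0]
    · simp [h0, ht₃]
  rw [e, criterion_eq ht₃ X Y I hdet (Finset.filter_subset _ I),
    criterion_eq ht₃ X Y I hdet hT] at h
  linarith

/-! ### The estimate near a single index -/

/-- The data `ω = (X, β, ε)` are regular near `i`: the Gram matrix is entrywise within `d` of `Ω`;
on the ball `corrBall Ω t i m` the mean of `X'Y` is, up to `e`, the contribution of the signals in
`corrBall Ω t i (m + 1)`; signals lie in `[τ, τ']`; there are at most `k₀`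
signals in the larger ball; fewer than `m'` noise scores in the smaller ball exceed `t₁ / 4`. -/
structure GoodAt {n p : ℕ} (Ω : Matrix (Fin p) (Fin p) ℝ) (t d e τ τ' t₁ : ℝ) (m m' k₀ : ℕ)
    (i : Fin p) (ω : Design n p × (Fin p → ℝ) × (Fin n → ℝ)) : Prop where
  gram : ∀ a b, |gramMatrix ω.1 a b - Ω a b| ≤ d
  mean : ∀ b ∈ corrBall Ω t i m, |marginal ω.1 (response ω) b - noiseScore ω.1 ω.2.2 b -
    ∑ j ∈ corrBall Ω t i (m + 1), Ω b j * ω.2.1 j| ≤ e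
  supp : ∀ j, ω.2.1 j = 0 ∨ (τ ≤ ω.2.1 j ∧ ω.2.1 j ≤ τ')
  card_signals : ((corrBall Ω t i (m + 1)).filter fun j => ω.2.1 j ≠ 0).card ≤ k₀
  card_noise : ∀ J ⊆ corrBall Ω t i m, (∀ b ∈ J, t₁ / 4 < |noiseScore ω.1 ω.2.2 b|) → J.card < m'

lemma quad_add_single {p : ℕ} {M : Matrix (Fin p) (Fin p) ℝ} (hM : ∀ a b, M a b = M b a)
    (u : Fin p → ℝ) (c : ℝ) (j : Fin p) :
    (u + c • Pi.single j 1) ⬝ᵥ M *ᵥ (u + c • Pi.single j 1) =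
      u ⬝ᵥ M *ᵥ u + 2 * c * (∑ b, u b * M b j) + c ^ 2 * M j j := by
  have h1 : u ⬝ᵥ M *ᵥ Pi.single j 1 = ∑ b, u b * M b j := by
    simp [dotProduct]
  have h2 : Pi.single j 1 ⬝ᵥ M *ᵥ u = ∑ b, u b * M b j := by
    rw [single_one_dotProduct]
    simp only [mulVec, dotProduct]
    exact Finset.sum_congr rfl fun b _ => by rw [hM j b, mul_comm]
  have h3 : (Pi.single j 1 : Fin p → ℝ) ⬝ᵥ M *ᵥ Pi.single j 1 = M j j := by
    simp
  simp only [mulVec_add, mulVec_smul, add_dotProduct, dotProduct_add, smul_dotProduct,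
    dotProduct_smul, smul_eq_mul, h1, h2, h3]
  ring

lemma indVec_insert {p : ℕ} {S : Finset (Fin p)} {j : Fin p} (hj : j ∉ S) :
    indVec (insert j S) = indVec S + (1 : ℝ) • Pi.single j 1 := by
  ext a
  by_cases ha : a = j
  · subst ha; simp [indVec, hj]
  · simp [indVec, ha]

/-- The contrast between a set and an index outside it. -/
def contrast {p : ℕ} (S : Finset (Fin p)) (i : Fin p) : Fin p → ℝ :=
  indVec S + (-1 : ℝ) • Pi.single i 1

lemma contrast_dotProduct {p : ℕ} (S : Finset (Fin p)) (i : Fin p) (w : Fin p → ℝ) :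
    contrast S i ⬝ᵥ w = ∑ a ∈ S, w a - w i := by
  simp [contrast, add_dotProduct, indVec_dotProduct, sub_eq_add_neg]

lemma abs_contrast {p : ℕ} {S : Finset (Fin p)} {i : Fin p} (hi : i ∉ S) :
    (∀ a ∈ insert i S, |contrast S i a| = 1) ∧ ∀ a ∉ insert i S, contrast S i a = 0 := by
  constructor
  · intro a ha
    by_cases h : a = i
    · subst h; simp [contrast, indVec, hi]
    · have : a ∈ S := (Finset.mem_insert.1 ha).resolve_left h
      simp [contrast, indVec, this, h]
  · intro a ha
    rw [Finset.mem_insert, not_or] at ha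
    simp [contrast, indVec, ha.1, ha.2]

lemma sum_abs_contrast {p : ℕ} {S : Finset (Fin p)} {i : Fin p} (hi : i ∉ S) :
    ∑ a, |contrast S i a| = S.card + 1 := by
  obtain ⟨h1, h0⟩ := abs_contrast hi
  have : ∀ a, |contrast S i a| = if a ∈ insert i S then 1 else 0 := by
    intro a
    split_ifs with ha
    · exact h1 a ha
    · rw [h0 a ha, abs_zero]
  simp only [this, Finset.sum_ite_mem, Finset.univ_inter, Finset.sum_const, nsmul_eq_mul, mul_one,
    Finset.card_insert_of_notMem hi, Nat.cast_add, Nat.cast_one]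

lemma CorrelationClass.quad_contrast {γ A ω₀ : ℝ} {p : ℕ} {Ω : Matrix (Fin p) (Fin p) ℝ}
    (h : CorrelationClass γ A ω₀ Ω) (S : Finset (Fin p)) (i : Fin p) :
    contrast S i ⬝ᵥ Ω *ᵥ contrast S i =
      indVec S ⬝ᵥ Ω *ᵥ indVec S - 2 * (∑ b ∈ S, Ω b i) + 1 := by
  rw [contrast, quad_add_single h.symm, h.diag_eq_one]
  have : ∑ b, indVec S b * Ω b i = ∑ b ∈ S, Ω b i := indVec_dotProduct S fun b => Ω b i
  rw [this]
  ring

lemma CorrelationClass.quad_insert {γ A ω₀ : ℝ} {p : ℕ} {Ω : Matrix (Fin p) (Fin p) ℝ}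
    (h : CorrelationClass γ A ω₀ Ω) {S : Finset (Fin p)} {i : Fin p} (hi : i ∉ S) :
    indVec (insert i S) ⬝ᵥ Ω *ᵥ indVec (insert i S) =
      indVec S ⬝ᵥ Ω *ᵥ indVec S + 2 * (∑ b ∈ S, Ω b i) + 1 := by
  rw [indVec_insert hi, quad_add_single h.symm, h.diag_eq_one]
  have : ∑ b, indVec S b * Ω b i = ∑ b ∈ S, Ω b i := indVec_dotProduct S fun b => Ω b i
  rw [this]
  ring

lemma CorrelationClass.abs_quad_indVec_sub_le {γ A ω₀ : ℝ} {p : ℕ}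
    {Ω : Matrix (Fin p) (Fin p) ℝ} (h : CorrelationClass γ A ω₀ Ω) {S : Finset (Fin p)}
    (hS : S.Nonempty) : |indVec S ⬝ᵥ Ω *ᵥ indVec S - S.card| ≤ 2 * ω₀ * (S.card - 1) :=
  h.abs_quad_sign_sub_le hS (fun a ha => by simp [indVec, ha]) (fun a ha => by simp [indVec, ha])

lemma CorrelationClass.one_le_quad_indVec {γ A ω₀ : ℝ} {p : ℕ}
    {Ω : Matrix (Fin p) (Fin p) ℝ} (h : CorrelationClass γ A ω₀ Ω) (hω : ω₀ < 1 / 2)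
    {S : Finset (Fin p)} (hS : S.Nonempty) : 1 ≤ indVec S ⬝ᵥ Ω *ᵥ indVec S := by
  have h1 := (abs_le.1 (h.abs_quad_indVec_sub_le hS)).1
  have h2 : (1 : ℝ) ≤ S.card := by exact_mod_cast hS.card_pos
  nlinarith

lemma CorrelationClass.abs_quad_contrast_sub_le {γ A ω₀ : ℝ} {p : ℕ}
    {Ω : Matrix (Fin p) (Fin p) ℝ} (h : CorrelationClass γ A ω₀ Ω) {S : Finset (Fin p)}
    {i : Fin p} (hi : i ∉ S) :
    |contrast S i ⬝ᵥ Ω *ᵥ contrast S i - (S.card + 1)| ≤ 2 * ω₀ * S.card := by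
  have := h.abs_quad_sign_sub_le (Finset.insert_nonempty i S) (abs_contrast hi).1
    (abs_contrast hi).2
  rw [Finset.card_insert_of_notMem hi] at this
  push_cast at this
  simpa using this

section

variable {γ A ω₀ : ℝ} {n p : ℕ} {Ω : Matrix (Fin p) (Fin p) ℝ} {t d e τ τ' t₁ : ℝ}
  {m m' k₀ : ℕ} {i : Fin p} {ω : Design n p × (Fin p → ℝ) × (Fin n → ℝ)}

/-- Near `i` there are few survivors: a survivor has a large noise score or a large mean, and the
latter is rare since the columns of `Ω` are summable and there are few signals. -/
lemma GoodAt.card_survivors_le (hg : GoodAt Ω t d e τ τ' t₁ m m' k₀ i ω)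
    (h : CorrelationClass γ A ω₀ Ω) (hω : ω₀ < 1 / 2) (ht₁ : 0 < t₁) (hτ : 0 < τ)
    (hτ' : τ' ≤ 2 * τ) (he : e ≤ t₁ / 4) (hm : m' + k₀ * (8 * τ / t₁) ≤ m)
    {J : Finset (Fin p)} (hJ : J ⊆ corrBall Ω t i m)
    (hs : ∀ b ∈ J, b ∈ survivors t₁ ω.1 (response ω)) : J.card ≤ m := by
  classical
  set J₁ := J.filter fun b => t₁ / 4 < |noiseScore ω.1 ω.2.2 b|
  set J₂ := J.filter fun b => ¬ t₁ / 4 < |noiseScore ω.1 ω.2.2 b|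
  set sig := (corrBall Ω t i (m + 1)).filter fun j => ω.2.1 j ≠ 0 with hsig
  have hcard : J₁.card + J₂.card = J.card := Finset.card_filter_add_card_filter_not _
  have h1 : J₁.card < m' := hg.card_noise J₁ ((Finset.filter_subset _ _).trans hJ)
    fun b hb => (Finset.mem_filter.1 hb).2
  have h2 : ∀ b ∈ J₂, t₁ / 2 ≤ ∑ j ∈ sig, |Ω b j| * (2 * τ) := by
    intro b hb
    obtain ⟨hbJ, hbn⟩ := Finset.mem_filter.1 hb
    have hsurv : t₁ < |marginal ω.1 (response ω) b| := hs b hbJ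
    have hmean := hg.mean b (hJ hbJ)
    have e1 : ∑ j ∈ corrBall Ω t i (m + 1), Ω b j * ω.2.1 j = ∑ j ∈ sig, Ω b j * ω.2.1 j := by
      rw [hsig, Finset.sum_filter]
      exact Finset.sum_congr rfl fun j _ => by by_cases hj : ω.2.1 j = 0 <;> simp [hj]
    have e2 : |∑ j ∈ sig, Ω b j * ω.2.1 j| ≤ ∑ j ∈ sig, |Ω b j| * (2 * τ) := by
      refine (Finset.abs_sum_le_sum_abs _ _).trans (Finset.sum_le_sum fun j hj => ?_)
      have hj0 : ω.2.1 j ≠ 0 := (Finset.mem_filter.1 hj).2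
      obtain ⟨hl, hu⟩ := (hg.supp j).resolve_left hj0
      rw [abs_mul, abs_of_pos (hτ.trans_le hl)]
      gcongr
      linarith
    rw [e1] at hmean
    have a1 := abs_sub_abs_le_abs_sub (marginal ω.1 (response ω) b - noiseScore ω.1 ω.2.2 b)
      (∑ j ∈ sig, Ω b j * ω.2.1 j)
    have a2 := abs_sub_abs_le_abs_sub (marginal ω.1 (response ω) b) (noiseScore ω.1 ω.2.2 b)
    linarith
  have h3 : (J₂.card : ℝ) * (t₁ / 2) ≤ k₀ * (4 * τ) := by
    calc (J₂.card : ℝ) * (t₁ / 2) = ∑ b ∈ J₂, t₁ / 2 := by simp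
      _ ≤ ∑ b ∈ J₂, ∑ j ∈ sig, |Ω b j| * (2 * τ) := Finset.sum_le_sum h2
      _ = ∑ j ∈ sig, (∑ b ∈ J₂, |Ω b j|) * (2 * τ) := by
          rw [Finset.sum_comm]; simp only [Finset.sum_mul]
      _ ≤ ∑ j ∈ sig, 2 * (2 * τ) := by
          refine Finset.sum_le_sum fun j _ => ?_
          have := (Finset.sum_le_sum_of_subset_of_nonneg (Finset.subset_univ J₂)
            fun b _ _ => abs_nonneg (Ω b j)).trans (h.abs_sum_row_le j)
          gcongr
          linarith
      _ = sig.card * (4 * τ) := by rw [Finset.sum_const, nsmul_eq_mul]; ring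
      _ ≤ k₀ * (4 * τ) := by
          gcongr
          exact hg.card_signals
  have h4 : (J₂.card : ℝ) ≤ k₀ * (8 * τ / t₁) := by
    rw [show (k₀ : ℝ) * (8 * τ / t₁) = k₀ * (4 * τ) / (t₁ / 2) by field_simp; ring,
      le_div_iff₀ (by positivity)]
    exact h3
  have h5 : (J.card : ℝ) ≤ m := by
    rw [← hcard]
    push_cast
    have : (J₁.card : ℝ) ≤ m' := by exact_mod_cast h1.le
    linarith
  exact_mod_cast h5

/-- Localization: the component of a survivor is small, stays near it, and has an invertible Gram
matrix, so the estimate minimizes `excess` over its subsets. -/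
lemma GoodAt.exists_component (hg : GoodAt Ω t d e τ τ' t₁ m m' k₀ i ω)
    (h : CorrelationClass γ A ω₀ Ω) (hω : ω₀ < 1 / 2) (ht₁ : 0 < t₁) (hτ : 0 < τ)
    (hτ' : τ' ≤ 2 * τ) (he : e ≤ t₁ / 4) (hm : m' + k₀ * (8 * τ / t₁) ≤ m)
    (ht : t < 1) (htd : t + d ≤ (Real.log p ^ 2)⁻¹) (hd : d * m < 1 - 2 * ω₀) {t₂ : ℝ}
    {b : Fin p → ℝ} (hb : IsEstimate t₁ t₂ τ ω.1 (response ω) b)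
    (hi : i ∈ survivors t₁ ω.1 (response ω)) :
    ∃ I : Finset (Fin p), i ∈ I ∧ I ⊆ corrBall Ω t i m ∧ I.card ≤ m ∧
      (∀ j ∈ survivors t₁ ω.1 (response ω), i ≠ j →
        (Real.log p ^ 2)⁻¹ < |gramMatrix ω.1 i j| → j ∈ I) ∧
      ∀ T ⊆ I, excess t₂ τ (gramMatrix ω.1) (marginal ω.1 (response ω))
        (I.filter fun a => b a ≠ 0) ≤
          excess t₂ τ (gramMatrix ω.1) (marginal ω.1 (response ω)) T := by
  obtain ⟨I, hcomp, hiI, hsurv, hclosed, hmin⟩ := UPT.exists_component hi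
  obtain ⟨hsub, hcard⟩ := component_subset_corrBall (m := m) (t := t) (Ω := Ω)
    (corrBall_subset_succ h ht i)
    (fun x y hxy => by
      have h1 := ((gramGraph_adj ω.1 x y).1 hxy).2
      have h2 := hg.gram x y
      have h3 := abs_sub_abs_le_abs_sub (gramMatrix ω.1 x y) (Ω x y)
      linarith)
    hiI hsurv hclosed hmin
    (fun J hJ hJs => hg.card_survivors_le h hω ht₁ hτ hτ' he hm hJ hJs)
  refine ⟨I, hiI, hsub, hcard, fun j hj hij hG => ?_, fun T hT => ?_⟩
  · exact hclosed i hiI j hj ((gramGraph_adj _ _ _).2 ⟨hij, hG⟩)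
  · refine hb.excess_le hτ.ne' hcomp (det_submatrix_ne_zero h hg.gram I ?_) hT
    have hd0 : 0 ≤ d := (abs_nonneg _).trans (hg.gram i i)
    have : (I.card : ℝ) ≤ m := by exact_mod_cast hcard
    nlinarith [mul_le_mul_of_nonneg_left this hd0]

lemma GoodAt.normSq_le (hg : GoodAt Ω t d e τ τ' t₁ m m' k₀ i ω) (v : Fin p → ℝ) {s : ℝ}
    (hv : ∑ a, |v a| ≤ s) : normSq ω.1 v ≤ v ⬝ᵥ Ω *ᵥ v + d * s ^ 2 := by
  rw [normSq_eq_gram]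
  have h1 := (abs_le.1 (abs_quad_sub_quad_le hg.gram v)).2
  have hd0 : 0 ≤ d := (abs_nonneg _).trans (hg.gram i i)
  have h2 : (∑ a, |v a|) ^ 2 ≤ s ^ 2 :=
    pow_le_pow_left₀ (Finset.sum_nonneg fun a _ => abs_nonneg _) hv 2
  nlinarith [mul_le_mul_of_nonneg_left h2 hd0]

/-- The total error of the comparisons of subsets of size at most `m`. -/
def cmpErr (τ d e : ℝ) (m : ℕ) : ℝ := 1 / 2 * τ * (d * (m ^ 2 + 1)) + (m + 1) * e

lemma GoodAt.quad_ge (hg : GoodAt Ω t d e τ τ' t₁ m m' k₀ i ω) {S : Finset (Fin p)}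
    (hS : S.card ≤ m) :
    indVec S ⬝ᵥ Ω *ᵥ indVec S - d * m ^ 2 ≤ indVec S ⬝ᵥ gramMatrix ω.1 *ᵥ indVec S := by
  have h1 := (abs_le.1 (abs_quad_sub_quad_le hg.gram (indVec S))).1
  have hd0 : 0 ≤ d := (abs_nonneg _).trans (hg.gram i i)
  rw [sum_abs_indVec] at h1
  have h2 : (S.card : ℝ) ^ 2 ≤ (m : ℝ) ^ 2 := by
    have : (S.card : ℝ) ≤ m := by exact_mod_cast hS
    gcongr
  nlinarith [mul_le_mul_of_nonneg_left h2 hd0]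

/-- A null index without signals nearby is rejected only if the noise beats the threshold on some
set containing it. -/
lemma GoodAt.false_positive_no_signal (hg : GoodAt Ω t d e τ τ' t₁ m m' k₀ i ω)
    (h : CorrelationClass γ A ω₀ Ω) (hω : ω₀ < 1 / 2) (ht₁ : 0 < t₁) (hτ : 0 < τ)
    (hτ' : τ' ≤ 2 * τ) (he : e ≤ t₁ / 4) (hm : m' + k₀ * (8 * τ / t₁) ≤ m)
    (ht : t < 1) (htd : t + d ≤ (Real.log p ^ 2)⁻¹) (hd : d * m < 1 - 2 * ω₀) {t₂ : ℝ}
    {b : Fin p → ℝ} (hb : IsEstimate t₁ t₂ τ ω.1 (response ω) b) (he0 : 0 ≤ e)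
    (hbi : b i ≠ 0) (hβ : ∀ j ∈ corrBall Ω t i (m + 1), ω.2.1 j = 0) :
    ∃ S ⊆ corrBall Ω t i m, i ∈ S ∧ S.card ≤ m ∧
      normSq ω.1 (indVec S) ≤ indVec S ⬝ᵥ Ω *ᵥ indVec S + d * (m + 1) ^ 2 ∧
      1 / 2 * τ * (indVec S ⬝ᵥ Ω *ᵥ indVec S) + 1 / 2 * (t₂ ^ 2 / τ) * S.card - cmpErr τ d e m ≤
        indVec S ⬝ᵥ noiseScore ω.1 ω.2.2 := by
  have hi : i ∈ survivors t₁ ω.1 (response ω) := by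
    by_contra hcon; exact hbi (hb.eq_zero i hcon)
  obtain ⟨I, hiI, hsub, hcard, -, hmin⟩ :=
    hg.exists_component h hω ht₁ hτ hτ' he hm ht htd hd hb hi
  set S := I.filter fun a => b a ≠ 0 with hSdef
  have hSI : S ⊆ I := Finset.filter_subset _ _
  have hSm : S.card ≤ m := (Finset.card_le_card hSI).trans hcard
  have hSm' : (S.card : ℝ) ≤ m := by exact_mod_cast hSm
  refine ⟨S, hSI.trans hsub, Finset.mem_filter.2 ⟨hiI, hbi⟩, hSm, hg.normSq_le _ ?_, ?_⟩
  · rw [sum_abs_indVec]; linarith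
  -- the estimated support is preferred to the empty set
  have h1 := hmin ∅ (Finset.empty_subset _)
  rw [excess_empty, excess] at h1
  have hd0 : 0 ≤ d := (abs_nonneg _).trans (hg.gram i i)
  have h2 : ∑ a ∈ S, marginal ω.1 (response ω) a ≤ indVec S ⬝ᵥ noiseScore ω.1 ω.2.2 + m * e := by
    rw [indVec_dotProduct]
    have : ∀ a ∈ S, marginal ω.1 (response ω) a ≤ noiseScore ω.1 ω.2.2 a + e := by
      intro a ha
      have hme := hg.mean a (hsub (hSI ha))
      have hz : ∑ j ∈ corrBall Ω t i (m + 1), Ω a j * ω.2.1 j = 0 :=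
        Finset.sum_eq_zero fun j hj => by rw [hβ j hj, mul_zero]
      rw [hz, sub_zero] at hme
      linarith [(abs_le.1 hme).2]
    refine (Finset.sum_le_sum this).trans ?_
    rw [Finset.sum_add_distrib, Finset.sum_const, nsmul_eq_mul]
    nlinarith
  have h3 := hg.quad_ge hSm
  have h4 : 1 / 2 * τ * (indVec S ⬝ᵥ gramMatrix ω.1 *ᵥ indVec S) +
      1 / 2 * (t₂ ^ 2 / τ) * S.card ≤ ∑ a ∈ S, marginal ω.1 (response ω) a := by
    have : τ * (1 / 2 * τ * (indVec S ⬝ᵥ gramMatrix ω.1 *ᵥ indVec S) +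
      1 / 2 * (t₂ ^ 2 / τ) * S.card) ≤ τ * ∑ a ∈ S, marginal ω.1 (response ω) a := by
      have e1 : τ * (1 / 2 * τ * (indVec S ⬝ᵥ gramMatrix ω.1 *ᵥ indVec S) +
        1 / 2 * (t₂ ^ 2 / τ) * S.card) =
        1 / 2 * τ ^ 2 * (indVec S ⬝ᵥ gramMatrix ω.1 *ᵥ indVec S) + 1 / 2 * t₂ ^ 2 * S.card := by
        field_simp
      rw [e1]; linarith
    exact le_of_mul_le_mul_left this hτ
  have h5 := mul_le_mul_of_nonneg_left h3 (by positivity : 0 ≤ 1 / 2 * τ)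
  unfold cmpErr
  nlinarith [mul_nonneg hτ.le hd0]

/-- A signal without other signals nearby is missed only if it is screened out, or if the noise
favours some other set over it. -/
lemma GoodAt.false_negative (hg : GoodAt Ω t d e τ τ' t₁ m m' k₀ i ω)
    (h : CorrelationClass γ A ω₀ Ω) (hω : ω₀ < 1 / 2) (ht₁ : 0 < t₁) (hτ : 0 < τ)
    (hτ' : τ' ≤ 2 * τ) (he : e ≤ t₁ / 4) (hm : m' + k₀ * (8 * τ / t₁) ≤ m)
    (ht : t < 1) (htd : t + d ≤ (Real.log p ^ 2)⁻¹) (hd : d * m < 1 - 2 * ω₀) {t₂ : ℝ}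
    {b : Fin p → ℝ} (hb : IsEstimate t₁ t₂ τ ω.1 (response ω) b) (he0 : 0 ≤ e)
    (hbi : b i = 0) (hβi : ω.2.1 i ≠ 0)
    (hβ : ∀ j ∈ corrBall Ω t i (m + 1), j ≠ i → ω.2.1 j = 0) :
    (normSq ω.1 (contrast ∅ i) ≤ 1 + d * (m + 1) ^ 2 ∧
      τ - t₁ - cmpErr τ d e m ≤ contrast ∅ i ⬝ᵥ noiseScore ω.1 ω.2.2) ∨
    ∃ S ⊆ corrBall Ω t i m, i ∉ S ∧ S.card ≤ m ∧
      normSq ω.1 (contrast S i) ≤ contrast S i ⬝ᵥ Ω *ᵥ contrast S i + d * (m + 1) ^ 2 ∧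
      1 / 2 * τ * (contrast S i ⬝ᵥ Ω *ᵥ contrast S i) + 1 / 2 * (t₂ ^ 2 / τ) * (S.card - 1) -
        cmpErr τ d e m ≤ contrast S i ⬝ᵥ noiseScore ω.1 ω.2.2 := by
  classical
  have hd0 : 0 ≤ d := (abs_nonneg _).trans (hg.gram i i)
  have hm0 : (0 : ℝ) ≤ m := Nat.cast_nonneg m
  obtain ⟨hβl, -⟩ := (hg.supp i).resolve_left hβi
  have hmean : ∀ a ∈ corrBall Ω t i m, |marginal ω.1 (response ω) a - noiseScore ω.1 ω.2.2 a -
      Ω a i * ω.2.1 i| ≤ e := by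
    intro a ha
    have hme := hg.mean a ha
    rwa [Finset.sum_eq_single_of_mem i (self_mem_corrBall h ht i (m + 1))
      (fun j hj hji => by rw [hβ j hj hji, mul_zero])] at hme
  have hmi := hmean i (self_mem_corrBall h ht i m)
  rw [h.diag_eq_one, one_mul] at hmi
  have hmi' := (abs_le.1 hmi).1
  by_cases hi : i ∈ survivors t₁ ω.1 (response ω)
  · right
    obtain ⟨I, hiI, hsub, hcard, -, hmin⟩ :=
      hg.exists_component h hω ht₁ hτ hτ' he hm ht htd hd hb hi
    set S := I.filter fun a => b a ≠ 0 with hSdef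
    have hSI : S ⊆ I := Finset.filter_subset _ _
    have hSm : S.card ≤ m := (Finset.card_le_card hSI).trans hcard
    have hSm' : (S.card : ℝ) ≤ m := by exact_mod_cast hSm
    have hiS : i ∉ S := fun hc => (Finset.mem_filter.1 hc).2 hbi
    refine ⟨S, hSI.trans hsub, hiS, hSm, hg.normSq_le _ ?_, ?_⟩
    · rw [sum_abs_contrast hiS]; linarith
    -- the estimated support is preferred to `{i}`
    have h1 := hmin {i} (Finset.singleton_subset_iff.2 hiI)
    rw [excess_singleton, excess] at h1
    set W := marginal ω.1 (response ω)
    set Z := noiseScore ω.1 ω.2.2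
    set a := ∑ b ∈ S, Ω b i with ha
    have h2 : ∑ a ∈ S, W a ≤ ∑ a ∈ S, Z a + a * ω.2.1 i + m * e := by
      have : ∀ x ∈ S, W x ≤ Z x + Ω x i * ω.2.1 i + e := fun x hx => by
        linarith [(abs_le.1 (hmean x (hsub (hSI hx)))).2]
      refine (Finset.sum_le_sum this).trans ?_
      rw [Finset.sum_add_distrib, Finset.sum_add_distrib, Finset.sum_const, nsmul_eq_mul,
        ← Finset.sum_mul]
      nlinarith
    have h3 := hg.quad_ge hSm
    have h3' := (abs_le.1 (hg.gram i i)).2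
    rw [h.diag_eq_one] at h3'
    have ha1 : a ≤ 2 * ω₀ := (le_abs_self _).trans (h.abs_sum_offdiag_le hiS)
    rw [h.quad_contrast, contrast_dotProduct]
    set V := indVec S ⬝ᵥ Ω *ᵥ indVec S
    set VG := indVec S ⬝ᵥ gramMatrix ω.1 *ᵥ indVec S
    have h4 : 1 / 2 * τ * (VG - gramMatrix ω.1 i i) + 1 / 2 * (t₂ ^ 2 / τ) * (S.card - 1) ≤
        ∑ a ∈ S, W a - W i := by
      have : τ * (1 / 2 * τ * (VG - gramMatrix ω.1 i i) +
          1 / 2 * (t₂ ^ 2 / τ) * (S.card - 1)) ≤ τ * (∑ a ∈ S, W a - W i) := by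
        have e1 : τ * (1 / 2 * τ * (VG - gramMatrix ω.1 i i) +
          1 / 2 * (t₂ ^ 2 / τ) * (S.card - 1)) =
          1 / 2 * τ ^ 2 * VG - 1 / 2 * τ ^ 2 * gramMatrix ω.1 i i +
            1 / 2 * t₂ ^ 2 * S.card - 1 / 2 * t₂ ^ 2 := by
          field_simp; ring
        rw [e1]; linarith
      exact le_of_mul_le_mul_left this hτ
    -- the signal contributes `-β_i (1 - a)` to the contrast, and `a ≤ 2 ω₀ < 1`
    have h5 : τ * (1 - a) ≤ ω.2.1 i * (1 - a) :=
      mul_le_mul_of_nonneg_right hβl (by linarith)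
    have h6 : 1 / 2 * τ * (V - d * m ^ 2 - (1 + d)) ≤ 1 / 2 * τ * (VG - gramMatrix ω.1 i i) :=
      mul_le_mul_of_nonneg_left (by linarith) (by positivity)
    unfold cmpErr
    linarith
  · left
    have hW : marginal ω.1 (response ω) i ≤ t₁ := by
      have : ¬ t₁ < |marginal ω.1 (response ω) i| := hi
      exact (le_abs_self _).trans (not_lt.1 this)
    constructor
    · have h1 := hg.normSq_le (contrast ∅ i) (s := m + 1) (by
        rw [sum_abs_contrast (Finset.notMem_empty i)]; simp)
      rw [h.quad_contrast] at h1
      have : indVec (∅ : Finset (Fin p)) ⬝ᵥ Ω *ᵥ indVec ∅ = 0 := by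
        rw [indVec_dotProduct]; simp
      rw [this] at h1
      simpa using h1
    · rw [contrast_dotProduct]
      simp only [Finset.sum_empty, zero_sub]
      unfold cmpErr
      nlinarith [mul_nonneg hτ.le hd0, mul_nonneg (mul_nonneg hτ.le hd0) (sq_nonneg (m : ℝ)),
        mul_nonneg hm0 he0]

/-- A null index with exactly one signal nearby is not rejected unless some noise score is of the
order of the signals: the singleton of the signal beats every set that contains the null index. -/
lemma GoodAt.false_positive_one_signal (hg : GoodAt Ω t d e τ τ' t₁ m m' k₀ i ω)
    (h : CorrelationClass γ A ω₀ Ω) (hω : ω₀ < 1 / 2) (ht₁ : 0 < t₁) (hτ : 0 < τ)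
    (hτ' : τ' ≤ 3 / 2 * τ) (he : e ≤ t₁ / 4) (hm : m' + k₀ * (8 * τ / t₁) ≤ m)
    (ht : t < 1) (htd : t + d ≤ (Real.log p ^ 2)⁻¹) (hd : d * m < 1 - 2 * ω₀)
    {t₂ : ℝ} {b : Fin p → ℝ} (hb : IsEstimate t₁ t₂ τ ω.1 (response ω) b) (he0 : 0 ≤ e) {ε : ℝ}
    (hm1 : 1 ≤ m) (hlow : 2 * ((Real.log p ^ 2)⁻¹ + d) * τ + e + ε * τ ≤ t₁)
    (hsurv : t₁ < τ - e - ε * τ)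
    (hgap : cmpErr τ d (e + ε * τ) m < (1 / 2 - ω₀) * τ)
    (hbi : b i ≠ 0) {j : Fin p} (hij : i ≠ j) (hjN : j ∈ corrBall Ω t i (m + 1))
    (hβj : ω.2.1 j ≠ 0) (hβ : ∀ a ∈ corrBall Ω t i (m + 1), a ≠ j → ω.2.1 a = 0)
    (hnoise : ∀ a ∈ corrBall Ω t i m, |noiseScore ω.1 ω.2.2 a| ≤ ε * τ) : False := by
  classical
  have hd0 : 0 ≤ d := (abs_nonneg _).trans (hg.gram i i)
  have hm0 : (0 : ℝ) ≤ m := Nat.cast_nonneg m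
  have hlog : 0 ≤ (Real.log p ^ 2)⁻¹ := by positivity
  have hετ : 0 ≤ ε * τ := (abs_nonneg _).trans (hnoise i (self_mem_corrBall h ht i m))
  obtain ⟨hβl, hβu⟩ := (hg.supp j).resolve_left hβj
  set W := marginal ω.1 (response ω)
  have hmean : ∀ a ∈ corrBall Ω t i m, |W a - Ω a j * ω.2.1 j| ≤ e + ε * τ := by
    intro a ha
    have hme := hg.mean a ha
    rw [Finset.sum_eq_single_of_mem j hjN (fun x hx hxj => by rw [hβ x hx hxj, mul_zero])] at hme
    have hn := hnoise a ha
    rw [abs_le] at hme hn ⊢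
    constructor <;> linarith [hme.1, hme.2, hn.1, hn.2]
  have hi : i ∈ survivors t₁ ω.1 (response ω) := by
    by_contra hcon; exact hbi (hb.eq_zero i hcon)
  -- the null index survives only because of its correlation with the signal
  have hΩij : (Real.log p ^ 2)⁻¹ + d < |Ω i j| := by
    by_contra hcon
    rw [not_lt] at hcon
    have h1 := hmean i (self_mem_corrBall h ht i m)
    have h2 : |W i| ≤ |Ω i j| * ω.2.1 j + (e + ε * τ) := by
      have := abs_sub_abs_le_abs_sub (W i) (Ω i j * ω.2.1 j)
      rw [abs_mul, abs_of_pos (hτ.trans_le hβl)] at this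
      linarith
    have h3 : |Ω i j| * ω.2.1 j ≤ ((Real.log p ^ 2)⁻¹ + d) * (2 * τ) :=
      mul_le_mul hcon (by linarith) (by linarith) (by positivity)
    have h4 : t₁ < |W i| := hi
    linarith
  obtain ⟨I, hiI, hsub, hcard, hclosed, hmin⟩ :=
    hg.exists_component h hω ht₁ hτ (by linarith) he hm ht htd hd hb hi
  have hjB : j ∈ corrBall Ω t i m := by
    have h1 : j ∈ corrBall Ω t i 1 :=
      mem_corrBall_succ (k := 0) (a := i) (by simp [corrBall]) (by linarith)
    have hmono : Monotone (corrBall Ω t i) := monotone_nat_of_le_succ (corrBall_subset_succ h ht i)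
    exact hmono hm1 h1
  have hWj := hmean j hjB
  rw [h.diag_eq_one, one_mul] at hWj
  have hWj' := (abs_le.1 hWj).1
  have hjI : j ∈ I := by
    refine hclosed j ?_ hij ?_
    · have : t₁ < W j := by linarith
      exact this.trans_le (le_abs_self _)
    · have h1 := hg.gram i j
      have h2 := abs_sub_abs_le_abs_sub (Ω i j) (gramMatrix ω.1 i j)
      rw [abs_sub_comm] at h2
      linarith
  set S := I.filter fun a => b a ≠ 0 with hSdef
  have hSI : S ⊆ I := Finset.filter_subset _ _
  have hSm : S.card ≤ m := (Finset.card_le_card hSI).trans hcard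
  have hiS : i ∈ S := Finset.mem_filter.2 ⟨hiI, hbi⟩
  have h1 := hmin {j} (Finset.singleton_subset_iff.2 hjI)
  rw [excess_singleton, excess] at h1
  have h3 := hg.quad_ge hSm
  have h3' := (abs_le.1 (hg.gram j j)).2
  rw [h.diag_eq_one] at h3'
  set V := indVec S ⬝ᵥ Ω *ᵥ indVec S with hV
  set VG := indVec S ⬝ᵥ gramMatrix ω.1 *ᵥ indVec S
  -- both sides divided by `τ`, dropping the penalty
  have h4 : 1 / 2 * τ * (VG - gramMatrix ω.1 j j) ≤ ∑ a ∈ S, W a - W j := by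
    have hc1 : (1 : ℝ) ≤ S.card := by exact_mod_cast Finset.card_pos.2 ⟨i, hiS⟩
    have h0 : 0 ≤ 1 / 2 * t₂ ^ 2 * (S.card - 1) := mul_nonneg (by positivity) (by linarith)
    have : τ * (1 / 2 * τ * (VG - gramMatrix ω.1 j j)) ≤ τ * (∑ a ∈ S, W a - W j) := by
      have e1 : τ * (1 / 2 * τ * (VG - gramMatrix ω.1 j j)) =
          1 / 2 * τ ^ 2 * VG - 1 / 2 * τ ^ 2 * gramMatrix ω.1 j j := by ring
      rw [e1]; linarith
    exact le_of_mul_le_mul_left this hτ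
  have h6 : 1 / 2 * τ * (V - d * m ^ 2 - (1 + d)) ≤ 1 / 2 * τ * (VG - gramMatrix ω.1 j j) :=
    mul_le_mul_of_nonneg_left (by linarith) (by positivity)
  have hsum : ∀ R ⊆ S, ∑ a ∈ R, W a ≤ (∑ a ∈ R, Ω a j) * ω.2.1 j + m * (e + ε * τ) := by
    intro R hR
    have : ∀ x ∈ R, W x ≤ Ω x j * ω.2.1 j + (e + ε * τ) := fun x hx => by
      linarith [(abs_le.1 (hmean x (hsub (hSI (hR hx))))).2]
    refine (Finset.sum_le_sum this).trans ?_
    rw [Finset.sum_add_distrib, Finset.sum_const, nsmul_eq_mul, ← Finset.sum_mul]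
    have : (R.card : ℝ) ≤ m := by exact_mod_cast (Finset.card_le_card hR).trans hSm
    have := mul_le_mul_of_nonneg_right this (add_nonneg he0 hετ)
    linarith
  unfold cmpErr at hgap
  by_cases hjS : j ∈ S
  · -- The set `R = S \ {j}` costs at least `½ τ²`, by its own quadratic form; its correlation
    -- with `j` is compensated up to the excess `β_j - τ ≤ ½ τ`, times `2 ω₀ < 1`.
    set R := S.erase j with hR
    have hjR : j ∉ R := Finset.notMem_erase j S
    have hRS : insert j R = S := Finset.insert_erase hjS
    have hiR : i ∈ R := Finset.mem_erase.2 ⟨hij, hiS⟩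
    have hVR := h.quad_insert hjR
    rw [hRS, ← hV] at hVR
    have hVR1 := h.one_le_quad_indVec hω ⟨i, hiR⟩
    have hs := hsum R (Finset.erase_subset _ _)
    have hsplit : ∑ a ∈ S, W a = W j + ∑ a ∈ R, W a := by
      rw [← hRS, Finset.sum_insert hjR]
    set a := ∑ x ∈ R, Ω x j
    have ha := h.abs_sum_offdiag_le hjR
    have h7 : a * (ω.2.1 j - τ) ≤ 2 * ω₀ * (1 / 2 * τ) := by
      calc a * (ω.2.1 j - τ) ≤ |a| * (ω.2.1 j - τ) :=
            mul_le_mul_of_nonneg_right (le_abs_self _) (by linarith)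
        _ ≤ 2 * ω₀ * (1 / 2 * τ) := mul_le_mul ha (by linarith) (by linarith)
            ((abs_nonneg _).trans ha)
    have h8 := mul_le_mul_of_nonneg_left hVR1 (by positivity : 0 ≤ 1 / 2 * τ)
    rw [hVR] at h6
    linarith
  · -- Giving up `j` loses `β_j (1 - a)` with `a ≤ 2 ω₀`, and the quadratic form of `S` is no
    -- smaller than that of `{j}`.
    have hVS1 := h.one_le_quad_indVec hω ⟨i, hiS⟩
    rw [← hV] at hVS1
    have hs := hsum S subset_rfl
    set a := ∑ x ∈ S, Ω x j
    have ha := (le_abs_self _).trans (h.abs_sum_offdiag_le hjS)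
    have h5 : τ * (1 - 2 * ω₀) ≤ ω.2.1 j * (1 - a) :=
      mul_le_mul hβl (by linarith) (by linarith) (by linarith)
    have h8 := mul_le_mul_of_nonneg_left hVS1 (by positivity : 0 ≤ 1 / 2 * τ)
    have h9 : 0 < (1 / 2 - ω₀) * τ := mul_pos (by linarith) hτ
    linarith

end

/-! ### Probability bounds at fixed dimension -/

/-- Numerical side conditions at a fixed dimension: `t` is the correlation threshold, `δ` the
relative accuracy of the Gram matrix, `R` a bound for the length of `β`, `d` and `e` the resulting
errors, `B` a bound for the number of indices in a ball, and `m`, `m'`, `k₀` the combinatorial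
constants of `GoodAt`. -/
structure Regime (γ A ω₀ ϑ : ℝ) (n p : ℕ) (t δ R d e τ τ' t₁ B : ℝ) (m m' k₀ : ℕ) : Prop where
  ϑ_pos : 0 < ϑ
  p_pos : 0 < p
  n_pos : 0 < n
  γ_pos : 0 < γ
  γ_lt : γ < 1
  ω₀_lt : ω₀ < 1 / 2
  t_pos : 0 < t
  t_lt : t < 1
  τ_pos : 0 < τ
  τ'_le : τ' ≤ 3 / 2 * τ
  t₁_pos : 0 < t₁
  δ_pos : 0 < δ
  δ_le : δ ≤ 1
  R_pos : 0 < R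
  R_sq : 3 * (p * dens ϑ p) * (4 * τ ^ 2) ≤ R ^ 2
  d_ge : 4 * δ ≤ d
  d_ge' : 4 * δ * R ≤ d
  e_ge : d + t ^ (1 - γ) * A * (2 * τ) ≤ e
  e_le : e ≤ t₁ / 4
  m_ge : m' + k₀ * (8 * τ / t₁) ≤ m
  td_le : t + d ≤ (Real.log p ^ 2)⁻¹
  dm_lt : d * m < 1 - 2 * ω₀
  one_le_B : 1 ≤ B
  ball_le : (A / t) ^ m ≤ B
  ball_le' : (A / t) ^ (m + 1) ≤ B
  m'_pos : 0 < m'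
  m_pos : 1 ≤ m
  dm'_le : d * m' ≤ 1

/-- A bound for the probability that the data are not regular near a given index; the terms stem
from the number of signals, the concentration of the Gram matrix, the signals in a ball and the large
noise scores in a ball. -/
def badProb (ϑ : ℝ) (n p : ℕ) (δ t₁ B : ℝ) (m' k₀ : ℕ) : ℝ :=
  Real.exp (-(p * dens ϑ p)) + (p ^ 2 + p) * (4 * Real.exp (-(n * δ ^ 2 / 8))) +
    (B * dens ϑ p) ^ (k₀ + 1) + (2 * B) ^ m' * Real.exp (-(m' * t₁ ^ 2 / 96))

lemma real_biUnion_le_card_mul {α ι : Type*} [MeasurableSpace α] (μ : Measure α)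
    (F : Finset ι) (E : ι → Set α) {c : ℝ} (h : ∀ a ∈ F, μ.real (E a) ≤ c) :
    μ.real (⋃ a ∈ F, E a) ≤ F.card * c := by
  refine (measureReal_biUnion_finset_le F E).trans ((Finset.sum_le_sum h).trans ?_)
  simp

section

variable {γ A ω₀ ϑ : ℝ} {n p : ℕ} {t δ R d e τ τ' t₁ B : ℝ} {m m' k₀ : ℕ}

lemma Regime.card_ball_le (hr : Regime γ A ω₀ ϑ n p t δ R d e τ τ' t₁ B m m' k₀)
    {Ω : Matrix (Fin p) (Fin p) ℝ} (h : CorrelationClass γ A ω₀ Ω) (i : Fin p) :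
    ((corrBall Ω t i m).card : ℝ) ≤ B ∧ ((corrBall Ω t i (m + 1)).card : ℝ) ≤ B :=
  ⟨(corrBall_card_le h hr.γ_pos hr.γ_lt hr.t_pos hr.t_lt.le i m).trans hr.ball_le,
    (corrBall_card_le h hr.γ_pos hr.γ_lt hr.t_pos hr.t_lt.le i (m + 1)).trans hr.ball_le'⟩

lemma Regime.d_pos (hr : Regime γ A ω₀ ϑ n p t δ R d e τ τ' t₁ B m m' k₀) : 0 < d :=
  lt_of_lt_of_le (by linarith [hr.δ_pos]) hr.d_ge

lemma marginal_eq (ω : Design n p × (Fin p → ℝ) × (Fin n → ℝ)) :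
    marginal ω.1 (response ω) = gramMatrix ω.1 *ᵥ ω.2.1 + noiseScore ω.1 ω.2.2 := by
  rw [marginal, response, mulVec_add, mulVec_mulVec]
  rfl

/-- Once the Gram matrix is controlled, the mean of `X'Y` on the ball only sees the signals in the
ball of one more step: all other correlations are below `t`, and hence summably small. -/
lemma Regime.mean_error (hr : Regime γ A ω₀ ϑ n p t δ R d e τ τ' t₁ B m m' k₀)
    {Ω : Matrix (Fin p) (Fin p) ℝ} (h : CorrelationClass γ A ω₀ Ω) {i : Fin p}
    {ω : Design n p × (Fin p → ℝ) × (Fin n → ℝ)}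
    (hG : ∀ b, |(gramMatrix ω.1 *ᵥ ω.2.1) b - (Ω *ᵥ ω.2.1) b| ≤ d)
    (hs : ∀ j, ω.2.1 j = 0 ∨ (τ ≤ ω.2.1 j ∧ ω.2.1 j ≤ τ')) {b : Fin p}
    (hb : b ∈ corrBall Ω t i m) :
    |marginal ω.1 (response ω) b - noiseScore ω.1 ω.2.2 b -
      ∑ j ∈ corrBall Ω t i (m + 1), Ω b j * ω.2.1 j| ≤ e := by
  classical
  rw [marginal_eq, Pi.add_apply, add_sub_cancel_right]
  have hsplit : (Ω *ᵥ ω.2.1) b = ∑ j ∈ corrBall Ω t i (m + 1), Ω b j * ω.2.1 j +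
      ∑ j ∈ (corrBall Ω t i (m + 1))ᶜ, Ω b j * ω.2.1 j :=
    (Finset.sum_add_sum_compl (corrBall Ω t i (m + 1)) fun j => Ω b j * ω.2.1 j).symm
  have hdisj : Disjoint (corrBall Ω t i (m + 1))ᶜ (nbhd Ω t b) := by
    rw [Finset.disjoint_left]
    intro j hj hj'
    exact Finset.mem_compl.1 hj (mem_corrBall_succ hb (by simpa [nbhd] using hj'))
  have htail : |∑ j ∈ (corrBall Ω t i (m + 1))ᶜ, Ω b j * ω.2.1 j| ≤
      t ^ (1 - γ) * A * (2 * τ) := by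
    calc _ ≤ ∑ j ∈ (corrBall Ω t i (m + 1))ᶜ, |Ω b j| * (2 * τ) := by
          refine (Finset.abs_sum_le_sum_abs _ _).trans (Finset.sum_le_sum fun j _ => ?_)
          rw [abs_mul]
          have : |ω.2.1 j| ≤ 2 * τ := by
            have := hr.τ_pos
            have := hr.τ'_le
            rcases hs j with h0 | ⟨h1, h2⟩
            · rw [h0, abs_zero]; positivity
            · rw [abs_of_pos (by linarith)]; linarith
          gcongr
      _ ≤ _ := by
          rw [← Finset.sum_mul]
          have := h.tail_row_le hr.γ_lt hr.t_pos b hdisj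
          have := hr.τ_pos
          gcongr
  have h1 := hG b
  rw [hsplit] at h1
  have h2 := hr.e_ge
  rw [abs_le] at h1 htail ⊢
  constructor <;> linarith [h1.1, h1.2, htail.1, htail.2]

variable (Ω : Matrix (Fin p) (Fin p) ℝ) (h₁ : Measure ℝ) [IsProbabilityMeasure h₁]

/-- The event that all members of `T` are signals. -/
lemma model_signals_event (hϑ : 0 < ϑ) (hp : 0 < p) (h0 : h₁ {0} = 0) (T : Finset (Fin p)) :
    (modelLaw n ϑ Ω h₁).real {ω | ∀ j ∈ T, ω.2.1 j ≠ 0} = dens ϑ p ^ T.card :=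
  (model_coef_event Ω h₁ hϑ hp (measurableSet_all_ne_zero T)).trans
    (coef_pi_all_ne_zero hϑ hp h₁ h0 T)

/-- Signals on `T` together with a deviation of the noise. -/
lemma model_signals_noise_event (hϑ : 0 < ϑ) (hp : 0 < p) (h0 : h₁ {0} = 0)
    (T : Finset (Fin p)) (v : Fin p → ℝ) {s x : ℝ} (hs : 0 < s) (hx : 0 ≤ x) :
    (modelLaw n ϑ Ω h₁).real {ω | (∀ j ∈ T, ω.2.1 j ≠ 0) ∧ normSq ω.1 v ≤ s ∧
      x ≤ v ⬝ᵥ noiseScore ω.1 ω.2.2} ≤ dens ϑ p ^ T.card * Real.exp (-(x ^ 2 / (2 * s))) := by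
  have := model_noise_event (n := n) Ω h₁ hϑ hp (measurableSet_all_ne_zero T) v hs hx
  rwa [coef_pi_all_ne_zero hϑ hp h₁ h0 T] at this

lemma support_zero {τ τ' : ℝ} {h₁ : Measure ℝ} (hτ : 0 < τ) (hsupp : h₁ (Set.Icc τ τ')ᶜ = 0) :
    h₁ {0} = 0 :=
  measure_mono_null (by simpa using fun h => absurd h hτ.not_ge) hsupp

variable {Ω h₁}

/-- The data are regular near every index with overwhelming probability. -/
lemma Regime.not_goodAt (hr : Regime γ A ω₀ ϑ n p t δ R d e τ τ' t₁ B m m' k₀)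
    (h : CorrelationClass γ A ω₀ Ω) (hsupp : h₁ (Set.Icc τ τ')ᶜ = 0) (i : Fin p) :
    (modelLaw n ϑ Ω h₁).real {ω | ¬ GoodAt Ω t d e τ τ' t₁ m m' k₀ i ω} ≤
      badProb ϑ n p δ t₁ B m' k₀ := by
  classical
  have hϑ := hr.ϑ_pos
  have hp := hr.p_pos
  have := isProbabilityMeasure_modelLaw (n := n) Ω h₁ hϑ hp
  have h0 := support_zero hr.τ_pos hsupp
  have hd := hr.d_pos
  have ht₁ := hr.t₁_pos
  obtain ⟨hB, hB'⟩ := hr.card_ball_le h i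
  have g1 := model_gram_event (n := n) Ω h₁ hϑ hp hr.n_pos h.posSemidef (h.quad_le hr.ω₀_lt)
    hr.τ_pos (by linarith [hr.τ'_le, hr.τ_pos]) hsupp hr.δ_pos hr.δ_le hr.R_pos hr.R_sq hr.d_ge
    hr.d_ge'
  have g2 := real_biUnion_le_card_mul (modelLaw n ϑ Ω h₁)
    ((corrBall Ω t i (m + 1)).powersetCard (k₀ + 1)) (fun T => {ω | ∀ j ∈ T, ω.2.1 j ≠ 0})
    (c := dens ϑ p ^ (k₀ + 1)) (fun T hT => by
      rw [model_signals_event Ω h₁ hϑ hp h0, (Finset.mem_powersetCard.1 hT).2])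
  -- If the noise scores on `J` exceed `t₁ / 4` in absolute value, then the linear form with the
  -- corresponding signs exceeds `|J| t₁ / 4`; a pair `⟨J, P⟩` encodes the signs, positive on `P`.
  set F := ((corrBall Ω t i m).powersetCard m').sigma fun J => J.powerset with hF
  set vv : (Σ _ : Finset (Fin p), Finset (Fin p)) → Fin p → ℝ :=
    fun q => indVec q.2 - indVec (q.1 \ q.2) with hvv
  have hm' : (0 : ℝ) < m' := by exact_mod_cast hr.m'_pos
  have g3 := real_biUnion_le_card_mul (modelLaw n ϑ Ω h₁) F
    (fun q => {ω | (∀ j ∈ (∅ : Finset (Fin p)), ω.2.1 j ≠ 0) ∧ normSq ω.1 (vv q) ≤ 3 * m' ∧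
      m' * (t₁ / 4) ≤ vv q ⬝ᵥ noiseScore ω.1 ω.2.2})
    (c := Real.exp (-(m' * t₁ ^ 2 / 96))) (fun q _ => by
      refine (model_signals_noise_event Ω h₁ hϑ hp h0 ∅ (vv q) (s := 3 * m') (by positivity)
        (by positivity)).trans (le_of_eq ?_)
      rw [Finset.card_empty, pow_zero, one_mul]
      congr 2
      field_simp
      norm_num)
  have hsub : {ω : Design n p × (Fin p → ℝ) × (Fin n → ℝ) |
      ¬ GoodAt Ω t d e τ τ' t₁ m m' k₀ i ω} ⊆
      ({ω | ¬ ((∀ i j, |gramMatrix ω.1 i j - Ω i j| ≤ d) ∧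
        (∀ i, |(gramMatrix ω.1 *ᵥ ω.2.1) i - (Ω *ᵥ ω.2.1) i| ≤ d) ∧
        ∀ j, ω.2.1 j = 0 ∨ (τ ≤ ω.2.1 j ∧ ω.2.1 j ≤ τ'))} ∪
        ⋃ T ∈ (corrBall Ω t i (m + 1)).powersetCard (k₀ + 1), {ω | ∀ j ∈ T, ω.2.1 j ≠ 0}) ∪
        ⋃ q ∈ F, {ω | (∀ j ∈ (∅ : Finset (Fin p)), ω.2.1 j ≠ 0) ∧ normSq ω.1 (vv q) ≤ 3 * m' ∧
          m' * (t₁ / 4) ≤ vv q ⬝ᵥ noiseScore ω.1 ω.2.2} := by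
    intro ω hω
    by_contra hcon
    rw [Set.mem_union, Set.mem_union, not_or, not_or] at hcon
    obtain ⟨⟨c1, c2⟩, c3⟩ := hcon
    rw [Set.mem_ofPred_eq, not_not] at c1
    obtain ⟨hG, hGβ, hs⟩ := c1
    simp only [Set.mem_iUnion, Set.mem_ofPred_eq, not_exists] at c2 c3
    refine hω ⟨hG, fun b hb => hr.mean_error h hGβ hs hb, hs, ?_, ?_⟩
    · by_contra hc
      obtain ⟨T, hT, hTc⟩ := Finset.exists_subset_card_eq (Nat.succ_le_of_lt (not_le.1 hc))
      exact c2 T (Finset.mem_powersetCard.2 ⟨hT.trans (Finset.filter_subset _ _), hTc⟩)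
        fun j hj => (Finset.mem_filter.1 (hT hj)).2
    · intro J₀ hJ₀ hJn
      by_contra hc
      obtain ⟨J, hJ, hJc⟩ := Finset.exists_subset_card_eq (not_lt.1 hc)
      set P := J.filter fun b => 0 < noiseScore ω.1 ω.2.2 b with hP
      have hPJ : P ⊆ J := Finset.filter_subset _ _
      refine c3 ⟨J, P⟩ (Finset.mem_sigma.2 ⟨Finset.mem_powersetCard.2 ⟨hJ.trans hJ₀, hJc⟩,
        Finset.mem_powerset.2 hPJ⟩) ⟨by simp, ?_, ?_⟩
      · have hva : ∀ a, |vv ⟨J, P⟩ a| = if a ∈ J then 1 else 0 := by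
          intro a
          simp only [hvv, Pi.sub_apply, indVec, Finset.mem_sdiff]
          by_cases h1 : a ∈ J <;> by_cases h2 : a ∈ P <;> simp [h1, h2]
          exact absurd (hPJ h2) h1
        have hsum : ∑ a, |vv ⟨J, P⟩ a| = m' := by
          simp [hva, hJc]
        have hsq : vv ⟨J, P⟩ ⬝ᵥ vv ⟨J, P⟩ = m' := by
          rw [← hsum, dotProduct]
          refine Finset.sum_congr rfl fun a _ => ?_
          rw [← abs_mul_abs_self, hva]
          split_ifs <;> simp
        have h2 := h.quad_le hr.ω₀_lt (vv ⟨J, P⟩)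
        have h3 := (abs_le.1 (abs_quad_sub_quad_le hG (vv ⟨J, P⟩))).2
        rw [← normSq_eq_gram, hsum] at h3
        rw [hsq] at h2
        have := mul_le_mul_of_nonneg_right hr.dm'_le hm'.le
        nlinarith
      · have e1 : vv ⟨J, P⟩ ⬝ᵥ noiseScore ω.1 ω.2.2 = ∑ b ∈ J, |noiseScore ω.1 ω.2.2 b| := by
          rw [hvv, sub_dotProduct, indVec_dotProduct, indVec_dotProduct,
            ← Finset.sum_sdiff hPJ, add_comm, sub_eq_add_neg, ← Finset.sum_neg_distrib]
          congr 1
          · exact Finset.sum_congr rfl fun b hb => (abs_of_pos (Finset.mem_filter.1 hb).2).symm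
          · refine Finset.sum_congr rfl fun b hb => (abs_of_nonpos ?_).symm
            obtain ⟨hb1, hb2⟩ := Finset.mem_sdiff.1 hb
            by_contra hc
            exact hb2 (Finset.mem_filter.2 ⟨hb1, not_le.1 hc⟩)
        rw [e1, ← hJc, ← nsmul_eq_mul, ← Finset.sum_const]
        exact Finset.sum_le_sum fun b hb => (hJn b (hJ hb)).le
  have c2 : (((corrBall Ω t i (m + 1)).powersetCard (k₀ + 1)).card : ℝ) * dens ϑ p ^ (k₀ + 1) ≤
      (B * dens ϑ p) ^ (k₀ + 1) := by
    rw [Finset.card_powersetCard, mul_pow]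
    have hπ := dens_nonneg ϑ p
    gcongr
    calc (((corrBall Ω t i (m + 1)).card.choose (k₀ + 1) : ℕ) : ℝ) ≤
          ((corrBall Ω t i (m + 1)).card : ℝ) ^ (k₀ + 1) := by
            exact_mod_cast Nat.choose_le_pow _ _
      _ ≤ _ := by gcongr
  have c3 : (F.card : ℝ) ≤ (2 * B) ^ m' := by
    rw [hF, Finset.card_sigma, Finset.sum_congr rfl fun J hJ => by
      rw [Finset.card_powerset, (Finset.mem_powersetCard.1 hJ).2], Finset.sum_const,
      Finset.card_powersetCard, smul_eq_mul, mul_comm 2 B, mul_pow]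
    push_cast
    gcongr
    calc (((corrBall Ω t i m).card.choose m' : ℕ) : ℝ) ≤ ((corrBall Ω t i m).card : ℝ) ^ m' := by
            exact_mod_cast Nat.choose_le_pow _ _
      _ ≤ _ := by gcongr
  refine (measureReal_mono hsub).trans ((measureReal_union_le _ _).trans ?_)
  refine (add_le_add ((measureReal_union_le _ _).trans (add_le_add g1 (g2.trans c2))) (g3.trans
    (mul_le_mul_of_nonneg_right c3 (Real.exp_pos _).le))).trans (le_of_eq ?_)
  unfold badProb
  rfl

/-- The number of subsets of size at most `m` of a set with at most `B` elements. -/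
lemma card_small_subsets_le (hB1 : 1 ≤ B) (C : Finset (Fin p)) (hC : (C.card : ℝ) ≤ B) :
    ((C.powerset.filter fun S => S.card ≤ m).card : ℝ) ≤ (m + 1) * B ^ m := by
  classical
  have hsub : (C.powerset.filter fun S => S.card ≤ m) ⊆
      (Finset.range (m + 1)).biUnion fun k => C.powersetCard k := by
    intro S hS
    obtain ⟨h1, h2⟩ := Finset.mem_filter.1 hS
    exact Finset.mem_biUnion.2 ⟨S.card, Finset.mem_range.2 (by omega),
      Finset.mem_powersetCard.2 ⟨Finset.mem_powerset.1 h1, rfl⟩⟩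
  have h1 : ((C.powerset.filter fun S => S.card ≤ m).card : ℝ) ≤
      ∑ k ∈ Finset.range (m + 1), ((C.powersetCard k).card : ℝ) := by
    exact_mod_cast (Finset.card_le_card hsub).trans Finset.card_biUnion_le
  refine h1.trans ?_
  have h2 : ∀ k ∈ Finset.range (m + 1), ((C.powersetCard k).card : ℝ) ≤ B ^ m := by
    intro k hk
    rw [Finset.card_powersetCard]
    calc ((C.card.choose k : ℕ) : ℝ) ≤ (C.card : ℝ) ^ k := by
          exact_mod_cast Nat.choose_le_pow _ _
      _ ≤ B ^ k := by gcongr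
      _ ≤ B ^ m := pow_le_pow_right₀ hB1 (by have := Finset.mem_range.1 hk; omega)
  refine (Finset.sum_le_sum h2).trans (le_of_eq ?_)
  simp

/-- Probability of missing a signal, in terms of a bound `E` for the Gaussian tails at the critical
levels. -/
lemma Regime.false_negative_le (hr : Regime γ A ω₀ ϑ n p t δ R d e τ τ' t₁ B m m' k₀)
    (h : CorrelationClass γ A ω₀ Ω) (hsupp : h₁ (Set.Icc τ τ')ᶜ = 0) {t₂ : ℝ}
    {est : Design n p × (Fin n → ℝ) → Fin p → ℝ} (hest : IsProcedure t₁ t₂ τ est) (i : Fin p)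
    {E : ℝ} (hx0 : 0 ≤ τ - t₁ - cmpErr τ d e m)
    (hE0 : Real.exp (-((τ - t₁ - cmpErr τ d e m) ^ 2 / (2 * (1 + d * (m + 1) ^ 2)))) ≤ E)
    (hES : ∀ s : ℕ, s ≤ m → ∀ D : ℝ, |D - (s + 1)| ≤ 2 * ω₀ * s →
      0 ≤ 1 / 2 * τ * D + 1 / 2 * (t₂ ^ 2 / τ) * (s - 1) - cmpErr τ d e m ∧
      Real.exp (-((1 / 2 * τ * D + 1 / 2 * (t₂ ^ 2 / τ) * (s - 1) - cmpErr τ d e m) ^ 2 /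
        (2 * (D + d * (m + 1) ^ 2)))) ≤ E) :
    (modelLaw n ϑ Ω h₁).real {ω | ω.2.1 i ≠ 0 ∧ est (ω.1, response ω) i = 0} ≤
      badProb ϑ n p δ t₁ B m' k₀ + B * dens ϑ p ^ 2 +
        dens ϑ p * ((1 + (m + 1) * B ^ m) * E) := by
  classical
  have hϑ := hr.ϑ_pos
  have hp := hr.p_pos
  have := isProbabilityMeasure_modelLaw (n := n) Ω h₁ hϑ hp
  have h0 := support_zero hr.τ_pos hsupp
  have hd := hr.d_pos
  have hπ := dens_nonneg ϑ p
  obtain ⟨hB, hB'⟩ := hr.card_ball_le h i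
  have hE : 0 ≤ E := (Real.exp_pos _).le.trans hE0
  have g1 := hr.not_goodAt h hsupp i
  -- another signal in the ball
  have g2 := real_biUnion_le_card_mul (modelLaw n ϑ Ω h₁)
    ((corrBall Ω t i (m + 1)).erase i) (fun j => {ω | ∀ a ∈ ({i, j} : Finset (Fin p)), ω.2.1 a ≠ 0})
    (c := dens ϑ p ^ 2) (fun j hj => by
      rw [model_signals_event Ω h₁ hϑ hp h0,
        Finset.card_pair (Finset.ne_of_mem_erase hj).symm])
  -- the signal is screened out
  have g3 : (modelLaw n ϑ Ω h₁).real {ω | (∀ j ∈ ({i} : Finset (Fin p)), ω.2.1 j ≠ 0) ∧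
      normSq ω.1 (contrast ∅ i) ≤ 1 + d * (m + 1) ^ 2 ∧
      τ - t₁ - cmpErr τ d e m ≤ contrast ∅ i ⬝ᵥ noiseScore ω.1 ω.2.2} ≤ dens ϑ p * E := by
    refine (model_signals_noise_event Ω h₁ hϑ hp h0 {i} _ (by positivity) hx0).trans ?_
    rw [Finset.card_singleton, pow_one]
    gcongr
  -- a support without `i` is preferred
  set F := ((corrBall Ω t i m).powerset.filter fun S => S.card ≤ m).filter fun S => i ∉ S with hF
  have g4 := real_biUnion_le_card_mul (modelLaw n ϑ Ω h₁) F
    (fun S => {ω | (∀ j ∈ ({i} : Finset (Fin p)), ω.2.1 j ≠ 0) ∧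
      normSq ω.1 (contrast S i) ≤ contrast S i ⬝ᵥ Ω *ᵥ contrast S i + d * (m + 1) ^ 2 ∧
      1 / 2 * τ * (contrast S i ⬝ᵥ Ω *ᵥ contrast S i) + 1 / 2 * (t₂ ^ 2 / τ) * (S.card - 1) -
        cmpErr τ d e m ≤ contrast S i ⬝ᵥ noiseScore ω.1 ω.2.2})
    (c := dens ϑ p * E) (fun S hS => by
      obtain ⟨hS1, hiS⟩ := Finset.mem_filter.1 hS
      have hD := h.abs_quad_contrast_sub_le hiS
      obtain ⟨hx, hexp⟩ := hES S.card (Finset.mem_filter.1 hS1).2 _ hD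
      have hDpos : 0 < contrast S i ⬝ᵥ Ω *ᵥ contrast S i := by
        have h1 := (abs_le.1 hD).1
        have h2 : (0 : ℝ) ≤ S.card := Nat.cast_nonneg _
        nlinarith [hr.ω₀_lt]
      refine (model_signals_noise_event Ω h₁ hϑ hp h0 {i} _ (by positivity) hx).trans ?_
      rw [Finset.card_singleton, pow_one]
      gcongr)
  have hsub : {ω : Design n p × (Fin p → ℝ) × (Fin n → ℝ) |
      ω.2.1 i ≠ 0 ∧ est (ω.1, response ω) i = 0} ⊆
      (({ω | ¬ GoodAt Ω t d e τ τ' t₁ m m' k₀ i ω} ∪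
        ⋃ j ∈ (corrBall Ω t i (m + 1)).erase i,
          {ω | ∀ a ∈ ({i, j} : Finset (Fin p)), ω.2.1 a ≠ 0}) ∪
        {ω | (∀ j ∈ ({i} : Finset (Fin p)), ω.2.1 j ≠ 0) ∧
          normSq ω.1 (contrast ∅ i) ≤ 1 + d * (m + 1) ^ 2 ∧
          τ - t₁ - cmpErr τ d e m ≤ contrast ∅ i ⬝ᵥ noiseScore ω.1 ω.2.2}) ∪
        ⋃ S ∈ F, {ω | (∀ j ∈ ({i} : Finset (Fin p)), ω.2.1 j ≠ 0) ∧
          normSq ω.1 (contrast S i) ≤ contrast S i ⬝ᵥ Ω *ᵥ contrast S i + d * (m + 1) ^ 2 ∧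
          1 / 2 * τ * (contrast S i ⬝ᵥ Ω *ᵥ contrast S i) +
            1 / 2 * (t₂ ^ 2 / τ) * (S.card - 1) -
            cmpErr τ d e m ≤ contrast S i ⬝ᵥ noiseScore ω.1 ω.2.2} := by
    rintro ω ⟨hβi, hbi⟩
    by_contra hcon
    rw [Set.mem_union, Set.mem_union, Set.mem_union, not_or, not_or, not_or] at hcon
    obtain ⟨⟨⟨c1, c2⟩, c3⟩, c4⟩ := hcon
    rw [Set.mem_ofPred_eq, not_not] at c1
    simp only [Set.mem_iUnion, Set.mem_ofPred_eq, not_exists] at c2 c3 c4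
    have hβ : ∀ j ∈ corrBall Ω t i (m + 1), j ≠ i → ω.2.1 j = 0 := by
      intro j hj hji
      by_contra hc
      refine c2 j (Finset.mem_erase.2 ⟨hji, hj⟩) fun a ha => ?_
      rcases Finset.mem_insert.1 ha with rfl | ha
      · exact hβi
      · rwa [Finset.mem_singleton.1 ha]
    have he0 : 0 ≤ e := (abs_nonneg _).trans (c1.mean i (self_mem_corrBall h hr.t_lt i m))
    have hi1 : ∀ j ∈ ({i} : Finset (Fin p)), ω.2.1 j ≠ 0 := fun j hj => by
      rwa [Finset.mem_singleton.1 hj]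
    rcases c1.false_negative h hr.ω₀_lt hr.t₁_pos hr.τ_pos (by linarith [hr.τ'_le, hr.τ_pos])
      hr.e_le hr.m_ge hr.t_lt hr.td_le hr.dm_lt (hest.isEstimate ω.1 (response ω)) he0 hbi hβi hβ
      with hA | ⟨S, hS, hiS, hSm, hA⟩
    · exact c3 ⟨hi1, hA⟩
    · exact c4 S (Finset.mem_filter.2 ⟨Finset.mem_filter.2
        ⟨Finset.mem_powerset.2 hS, hSm⟩, hiS⟩) ⟨hi1, hA⟩
  have k2 : (((corrBall Ω t i (m + 1)).erase i).card : ℝ) * dens ϑ p ^ 2 ≤ B * dens ϑ p ^ 2 := by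
    gcongr
    refine le_trans ?_ hB'
    exact_mod_cast Finset.card_erase_le
  have k4 : (F.card : ℝ) * (dens ϑ p * E) ≤ (m + 1) * B ^ m * (dens ϑ p * E) := by
    gcongr
    refine le_trans ?_ (card_small_subsets_le hr.one_le_B _ hB)
    exact_mod_cast Finset.card_filter_le _ _
  refine (measureReal_mono hsub).trans ((measureReal_union_le _ _).trans ?_)
  refine (add_le_add ((measureReal_union_le _ _).trans (add_le_add ((measureReal_union_le _ _).trans
    (add_le_add g1 (g2.trans k2))) g3)) (g4.trans k4)).trans (le_of_eq ?_)
  ring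

/-- Probability of a false rejection, in terms of a bound `E₁` for the Gaussian tail at the level of
an isolated index, a bound `E₂` at the levels of larger sets, and a bound `E₃` for a noise score of
the order of the signals. -/
lemma Regime.false_positive_le (hr : Regime γ A ω₀ ϑ n p t δ R d e τ τ' t₁ B m m' k₀)
    (h : CorrelationClass γ A ω₀ Ω) (hsupp : h₁ (Set.Icc τ τ')ᶜ = 0) {t₂ : ℝ}
    {est : Design n p × (Fin n → ℝ) → Fin p → ℝ} (hest : IsProcedure t₁ t₂ τ est) (i : Fin p)
    {ε E₁ E₂ E₃ : ℝ} (hε : 0 ≤ ε)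
    (hlow : 2 * ((Real.log p ^ 2)⁻¹ + d) * τ + e + ε * τ ≤ t₁)
    (hsurv : t₁ < τ - e - ε * τ)
    (hgap : cmpErr τ d (e + ε * τ) m < (1 / 2 - ω₀) * τ)
    (hx1 : 0 ≤ 1 / 2 * τ + 1 / 2 * (t₂ ^ 2 / τ) - cmpErr τ d e m)
    (hE1 : Real.exp (-((1 / 2 * τ + 1 / 2 * (t₂ ^ 2 / τ) - cmpErr τ d e m) ^ 2 /
      (2 * (1 + d * (m + 1) ^ 2)))) ≤ E₁)
    (hES : ∀ s : ℕ, s ≤ m → 2 ≤ s → ∀ V : ℝ, |V - s| ≤ 2 * ω₀ * (s - 1) →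
      0 ≤ 1 / 2 * τ * V + 1 / 2 * (t₂ ^ 2 / τ) * s - cmpErr τ d e m ∧
      Real.exp (-((1 / 2 * τ * V + 1 / 2 * (t₂ ^ 2 / τ) * s - cmpErr τ d e m) ^ 2 /
        (2 * (V + d * (m + 1) ^ 2)))) ≤ E₂)
    (hE20 : 0 ≤ E₂) (hE3 : Real.exp (-((ε * τ) ^ 2 / (2 * (1 + d)))) ≤ E₃) :
    (modelLaw n ϑ Ω h₁).real {ω | ω.2.1 i = 0 ∧ est (ω.1, response ω) i ≠ 0} ≤
      badProb ϑ n p δ t₁ B m' k₀ + B ^ 2 * dens ϑ p ^ 2 + B ^ 2 * (2 * (dens ϑ p * E₃)) +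
        E₁ + (m + 1) * B ^ m * E₂ := by
  classical
  have hϑ := hr.ϑ_pos
  have hp := hr.p_pos
  have := isProbabilityMeasure_modelLaw (n := n) Ω h₁ hϑ hp
  have h0 := support_zero hr.τ_pos hsupp
  have hd := hr.d_pos
  have hτ := hr.τ_pos
  have hπ := dens_nonneg ϑ p
  obtain ⟨hB, hB'⟩ := hr.card_ball_le h i
  have hB0 : 0 ≤ B := zero_le_one.trans hr.one_le_B
  have hE30 : 0 ≤ E₃ := (Real.exp_pos _).le.trans hE3
  have g1 := hr.not_goodAt h hsupp i
  -- two signals in the ball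
  have g2 := real_biUnion_le_card_mul (modelLaw n ϑ Ω h₁)
    ((corrBall Ω t i (m + 1) ×ˢ corrBall Ω t i (m + 1)).filter fun q => q.1 ≠ q.2)
    (fun q => {ω | ∀ a ∈ ({q.1, q.2} : Finset (Fin p)), ω.2.1 a ≠ 0})
    (c := dens ϑ p ^ 2) (fun q hq => by
      rw [model_signals_event Ω h₁ hϑ hp h0, Finset.card_pair (Finset.mem_filter.1 hq).2])
  -- one signal in the ball and a large noise score
  have hbig : ∀ (σ : ℝ) (q : Fin p × Fin p),
      (modelLaw n ϑ Ω h₁).real {ω | (∀ a ∈ ({q.1} : Finset (Fin p)), ω.2.1 a ≠ 0) ∧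
        normSq ω.1 (σ • Pi.single q.2 1) ≤ 1 + d ∧
        ε * τ ≤ (σ • Pi.single q.2 1) ⬝ᵥ noiseScore ω.1 ω.2.2} ≤ dens ϑ p * E₃ := by
    intro σ q
    refine (model_signals_noise_event Ω h₁ hϑ hp h0 {q.1} _ (by positivity)
      (by positivity)).trans ?_
    rw [Finset.card_singleton, pow_one]
    gcongr
  have g3 := real_biUnion_le_card_mul (modelLaw n ϑ Ω h₁)
    (corrBall Ω t i (m + 1) ×ˢ corrBall Ω t i m)
    (fun q => {ω | (∀ a ∈ ({q.1} : Finset (Fin p)), ω.2.1 a ≠ 0) ∧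
        normSq ω.1 ((1 : ℝ) • Pi.single q.2 1) ≤ 1 + d ∧
        ε * τ ≤ ((1 : ℝ) • Pi.single q.2 1) ⬝ᵥ noiseScore ω.1 ω.2.2} ∪
      {ω | (∀ a ∈ ({q.1} : Finset (Fin p)), ω.2.1 a ≠ 0) ∧
        normSq ω.1 ((-1 : ℝ) • Pi.single q.2 1) ≤ 1 + d ∧
        ε * τ ≤ ((-1 : ℝ) • Pi.single q.2 1) ⬝ᵥ noiseScore ω.1 ω.2.2})
    (c := 2 * (dens ϑ p * E₃)) (fun q _ => by
      refine (measureReal_union_le _ _).trans ?_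
      linarith [hbig 1 q, hbig (-1) q])
  -- no signal in the ball, and `{i}` is preferred to the empty set
  have g4 : (modelLaw n ϑ Ω h₁).real {ω | (∀ j ∈ (∅ : Finset (Fin p)), ω.2.1 j ≠ 0) ∧
      normSq ω.1 (indVec {i}) ≤ 1 + d * (m + 1) ^ 2 ∧
      1 / 2 * τ + 1 / 2 * (t₂ ^ 2 / τ) - cmpErr τ d e m ≤
        indVec {i} ⬝ᵥ noiseScore ω.1 ω.2.2} ≤ E₁ := by
    refine (model_signals_noise_event Ω h₁ hϑ hp h0 ∅ _ (by positivity) hx1).trans ?_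
    rw [Finset.card_empty, pow_zero, one_mul]
    exact hE1
  -- no signal in the ball, and a larger support is preferred to the empty set
  set F := ((corrBall Ω t i m).powerset.filter fun S => S.card ≤ m).filter fun S => 2 ≤ S.card
    with hF
  have g5 := real_biUnion_le_card_mul (modelLaw n ϑ Ω h₁) F
    (fun S => {ω | (∀ j ∈ (∅ : Finset (Fin p)), ω.2.1 j ≠ 0) ∧
      normSq ω.1 (indVec S) ≤ indVec S ⬝ᵥ Ω *ᵥ indVec S + d * (m + 1) ^ 2 ∧
      1 / 2 * τ * (indVec S ⬝ᵥ Ω *ᵥ indVec S) + 1 / 2 * (t₂ ^ 2 / τ) * S.card - cmpErr τ d e m ≤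
        indVec S ⬝ᵥ noiseScore ω.1 ω.2.2})
    (c := E₂) (fun S hS => by
      obtain ⟨hS1, hS2⟩ := Finset.mem_filter.1 hS
      have hne : S.Nonempty := Finset.card_pos.1 (by omega)
      obtain ⟨hx, hexp⟩ := hES S.card (Finset.mem_filter.1 hS1).2 hS2 _
        (h.abs_quad_indVec_sub_le hne)
      have hVpos := h.one_le_quad_indVec hr.ω₀_lt hne
      refine (model_signals_noise_event Ω h₁ hϑ hp h0 ∅ _ (by positivity) hx).trans ?_
      rw [Finset.card_empty, pow_zero, one_mul]
      exact hexp)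
  have hsub : {ω : Design n p × (Fin p → ℝ) × (Fin n → ℝ) |
      ω.2.1 i = 0 ∧ est (ω.1, response ω) i ≠ 0} ⊆
      ((({ω | ¬ GoodAt Ω t d e τ τ' t₁ m m' k₀ i ω} ∪
        ⋃ q ∈ (corrBall Ω t i (m + 1) ×ˢ corrBall Ω t i (m + 1)).filter fun q => q.1 ≠ q.2,
          {ω | ∀ a ∈ ({q.1, q.2} : Finset (Fin p)), ω.2.1 a ≠ 0}) ∪
        ⋃ q ∈ corrBall Ω t i (m + 1) ×ˢ corrBall Ω t i m,
          ({ω | (∀ a ∈ ({q.1} : Finset (Fin p)), ω.2.1 a ≠ 0) ∧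
            normSq ω.1 ((1 : ℝ) • Pi.single q.2 1) ≤ 1 + d ∧
            ε * τ ≤ ((1 : ℝ) • Pi.single q.2 1) ⬝ᵥ noiseScore ω.1 ω.2.2} ∪
          {ω | (∀ a ∈ ({q.1} : Finset (Fin p)), ω.2.1 a ≠ 0) ∧
            normSq ω.1 ((-1 : ℝ) • Pi.single q.2 1) ≤ 1 + d ∧
            ε * τ ≤ ((-1 : ℝ) • Pi.single q.2 1) ⬝ᵥ noiseScore ω.1 ω.2.2})) ∪
        {ω | (∀ j ∈ (∅ : Finset (Fin p)), ω.2.1 j ≠ 0) ∧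
          normSq ω.1 (indVec {i}) ≤ 1 + d * (m + 1) ^ 2 ∧
          1 / 2 * τ + 1 / 2 * (t₂ ^ 2 / τ) - cmpErr τ d e m ≤
            indVec {i} ⬝ᵥ noiseScore ω.1 ω.2.2}) ∪
        ⋃ S ∈ F, {ω | (∀ j ∈ (∅ : Finset (Fin p)), ω.2.1 j ≠ 0) ∧
          normSq ω.1 (indVec S) ≤ indVec S ⬝ᵥ Ω *ᵥ indVec S + d * (m + 1) ^ 2 ∧
          1 / 2 * τ * (indVec S ⬝ᵥ Ω *ᵥ indVec S) + 1 / 2 * (t₂ ^ 2 / τ) * S.card -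
            cmpErr τ d e m ≤ indVec S ⬝ᵥ noiseScore ω.1 ω.2.2} := by
    rintro ω ⟨hβi, hbi⟩
    by_contra hcon
    rw [Set.mem_union, Set.mem_union, Set.mem_union, Set.mem_union, not_or, not_or, not_or,
      not_or] at hcon
    obtain ⟨⟨⟨⟨c1, c2⟩, c3⟩, c4⟩, c5⟩ := hcon
    rw [Set.mem_ofPred_eq, not_not] at c1
    simp only [Set.mem_iUnion, Set.mem_ofPred_eq, not_exists] at c2 c4 c5
    have he0 : 0 ≤ e := (abs_nonneg _).trans (c1.mean i (self_mem_corrBall h hr.t_lt i m))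
    by_cases hex : ∃ j ∈ corrBall Ω t i (m + 1), ω.2.1 j ≠ 0
    · obtain ⟨j, hjN, hβj⟩ := hex
      have hij : i ≠ j := fun hc => hβj (hc ▸ hβi)
      refine c1.false_positive_one_signal h hr.ω₀_lt hr.t₁_pos hr.τ_pos hr.τ'_le hr.e_le hr.m_ge
        hr.t_lt hr.td_le hr.dm_lt (hest.isEstimate ω.1 (response ω)) he0 hr.m_pos hlow hsurv hgap
        hbi hij hjN hβj ?_ ?_
      · intro a ha haj
        by_contra hc
        refine c2 (a, j) (Finset.mem_filter.2 ⟨Finset.mem_product.2 ⟨ha, hjN⟩, haj⟩) fun x hx => ?_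
        rcases Finset.mem_insert.1 hx with rfl | hx
        · exact hc
        · rwa [Finset.mem_singleton.1 hx]
      · intro a ha
        by_contra hc
        rw [not_le] at hc
        have hN : ∀ σ : ℝ, |σ| = 1 → normSq ω.1 (σ • Pi.single a 1) ≤ 1 + d := by
          intro σ hσ
          have h1 := c1.normSq_le (σ • Pi.single a 1) (s := 1) (by
            refine le_of_eq ?_
            rw [Finset.sum_eq_single_of_mem a (Finset.mem_univ a)]
            · simp [hσ]
            · intro x _ hx
              simp [hx])
          have h2 : (σ • Pi.single a 1 : Fin p → ℝ) ⬝ᵥ Ω *ᵥ (σ • Pi.single a 1) = 1 := by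
            have h3 := quad_add_single h.symm 0 σ a
            rw [zero_add] at h3
            rw [h3, h.diag_eq_one]
            have : σ ^ 2 = 1 := by rw [← sq_abs, hσ, one_pow]
            simp [this]
          rw [h2] at h1
          linarith
        have hj1 : ∀ x ∈ ({j} : Finset (Fin p)), ω.2.1 x ≠ 0 := fun x hx => by
          rwa [Finset.mem_singleton.1 hx]
        refine c3 (Set.mem_biUnion (x := (j, a)) (Finset.mem_product.2 ⟨hjN, ha⟩) ?_)
        rcases lt_abs.1 hc with h1 | h1
        · refine Or.inl ⟨hj1, hN 1 (by simp), ?_⟩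
          rw [one_smul, single_one_dotProduct]
          exact h1.le
        · refine Or.inr ⟨hj1, hN (-1) (by simp), ?_⟩
          rw [smul_dotProduct, single_one_dotProduct, smul_eq_mul]
          linarith
    · push Not at hex
      obtain ⟨S, hS, hiS, hSm, hA1, hA2⟩ := c1.false_positive_no_signal h hr.ω₀_lt hr.t₁_pos
        hr.τ_pos (by linarith [hr.τ'_le, hr.τ_pos]) hr.e_le hr.m_ge hr.t_lt hr.td_le hr.dm_lt
        (hest.isEstimate ω.1 (response ω)) he0 hbi hex
      by_cases hS2 : 2 ≤ S.card
      · exact c5 S (Finset.mem_filter.2 ⟨Finset.mem_filter.2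
          ⟨Finset.mem_powerset.2 hS, hSm⟩, hS2⟩) ⟨by simp, hA1, hA2⟩
      · have hS1 : S = {i} := by
          refine (Finset.eq_of_subset_of_card_le (Finset.singleton_subset_iff.2 hiS) ?_).symm
          rw [Finset.card_singleton]; omega
        rw [hS1] at hA1 hA2
        have hV : indVec {i} ⬝ᵥ Ω *ᵥ indVec {i} = 1 := by
          have := h.abs_quad_indVec_sub_le (Finset.singleton_nonempty i)
          simp only [Finset.card_singleton, Nat.cast_one, sub_self, mul_zero] at this
          linarith [abs_nonpos_iff.1 this]
        rw [hV] at hA1 hA2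
        simp only [mul_one, Finset.card_singleton, Nat.cast_one] at hA2
        exact c4 ⟨by simp, hA1, hA2⟩
  have k2 : ((((corrBall Ω t i (m + 1) ×ˢ corrBall Ω t i (m + 1)).filter
      fun q => q.1 ≠ q.2).card : ℕ) : ℝ) * dens ϑ p ^ 2 ≤ B ^ 2 * dens ϑ p ^ 2 := by
    gcongr
    calc _ ≤ (((corrBall Ω t i (m + 1) ×ˢ corrBall Ω t i (m + 1)).card : ℕ) : ℝ) := by
          exact_mod_cast Finset.card_filter_le _ _
      _ ≤ B ^ 2 := by
          rw [Finset.card_product, sq]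
          push_cast
          gcongr
  have k3 : (((corrBall Ω t i (m + 1) ×ˢ corrBall Ω t i m).card : ℕ) : ℝ) *
      (2 * (dens ϑ p * E₃)) ≤ B ^ 2 * (2 * (dens ϑ p * E₃)) := by
    gcongr
    rw [Finset.card_product, sq]
    push_cast
    gcongr
  have k5 : (F.card : ℝ) * E₂ ≤ (m + 1) * B ^ m * E₂ := by
    gcongr
    refine le_trans ?_ (card_small_subsets_le hr.one_le_B _ hB)
    exact_mod_cast Finset.card_filter_le _ _
  refine (measureReal_mono hsub).trans ((measureReal_union_le _ _).trans ?_)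
  exact add_le_add ((measureReal_union_le _ _).trans (add_le_add ((measureReal_union_le _ _).trans
    (add_le_add ((measureReal_union_le _ _).trans (add_le_add g1 (g2.trans k2))) (g3.trans k3)))
    g4)) (g5.trans k5)

end

/-! ### Orders of magnitude -/

lemma tendsto_log_nat : Tendsto (fun p : ℕ => Real.log p) atTop atTop :=
  Real.tendsto_log_atTop.comp tendsto_natCast_atTop_atTop

lemma eventually_log_pow_le (C : ℝ) (k : ℕ) {a : ℝ} (ha : 0 < a) :
    ∀ᶠ p : ℕ in atTop, C * Real.log p ^ k ≤ (p : ℝ) ^ a := by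
  have h := (isLittleO_log_rpow_rpow_atTop (k : ℝ) ha).comp_tendsto tendsto_natCast_atTop_atTop
  have h2 := h.def (c := (|C| + 1)⁻¹) (by positivity)
  filter_upwards [h2, tendsto_log_nat.eventually_ge_atTop 0] with p hp hL
  simp only [Function.comp_apply, Real.rpow_natCast, Real.norm_eq_abs] at hp
  rw [abs_of_nonneg (pow_nonneg hL k),
    abs_of_nonneg (Real.rpow_nonneg (Nat.cast_nonneg p) a), inv_mul_eq_div,
    le_div_iff₀ (by positivity)] at hp
  have h3 : C ≤ |C| + 1 := (le_abs_self C).trans (by linarith)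
  calc C * Real.log p ^ k ≤ (|C| + 1) * Real.log p ^ k := by gcongr
    _ ≤ _ := by linarith

lemma eventually_const_le (C : ℝ) {a : ℝ} (ha : 0 < a) :
    ∀ᶠ p : ℕ in atTop, C ≤ (p : ℝ) ^ a := by
  simpa using eventually_log_pow_le C 0 ha

lemma eventually_mul_rpow_le (C : ℝ) {a b : ℝ} (hab : b < a) :
    ∀ᶠ p : ℕ in atTop, C * (p : ℝ) ^ b ≤ (p : ℝ) ^ a := by
  filter_upwards [eventually_const_le C (sub_pos.2 hab), eventually_gt_atTop 0] with p hp h0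
  have hp0 : (0 : ℝ) < p := by exact_mod_cast h0
  calc C * (p : ℝ) ^ b ≤ (p : ℝ) ^ (a - b) * (p : ℝ) ^ b := by gcongr
    _ = (p : ℝ) ^ a := by rw [← Real.rpow_add hp0]; ring_nf

lemma eventually_log_mul_rpow_le (C : ℝ) (k : ℕ) {a b : ℝ} (hab : b < a) :
    ∀ᶠ p : ℕ in atTop, C * Real.log p ^ k * (p : ℝ) ^ b ≤ (p : ℝ) ^ a := by
  filter_upwards [eventually_log_pow_le C k (sub_pos.2 hab), eventually_gt_atTop 0] with p hp h0
  have hp0 : (0 : ℝ) < p := by exact_mod_cast h0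
  calc C * Real.log p ^ k * (p : ℝ) ^ b ≤ (p : ℝ) ^ (a - b) * (p : ℝ) ^ b := by gcongr
    _ = (p : ℝ) ^ a := by rw [← Real.rpow_add hp0]; ring_nf

lemma eventually_mul_rpow_neg_le (C : ℝ) {a ε : ℝ} (ha : 0 < a) (hε : 0 < ε) :
    ∀ᶠ p : ℕ in atTop, C * (p : ℝ) ^ (-a) ≤ ε := by
  filter_upwards [eventually_mul_rpow_le (C / ε) (show -a < 0 by linarith)] with p hp
  rw [Real.rpow_zero, div_mul_eq_mul_div, div_le_one hε] at hp
  exact hp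

lemma eventually_log_mul_rpow_neg_le (C : ℝ) (k : ℕ) {a ε : ℝ} (ha : 0 < a) (hε : 0 < ε) :
    ∀ᶠ p : ℕ in atTop, C * Real.log p ^ k * (p : ℝ) ^ (-a) ≤ ε := by
  filter_upwards [eventually_log_mul_rpow_le (C / ε) k (show -a < 0 by linarith)] with p hp
  rw [Real.rpow_zero, div_mul_eq_mul_div, div_mul_eq_mul_div, div_le_one hε] at hp
  exact hp

lemma exp_neg_le_rpow_neg {p : ℕ} (hp : 0 < p) {a x : ℝ} (h : a * Real.log p ≤ x) :
    Real.exp (-x) ≤ (p : ℝ) ^ (-a) := by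
  rw [Real.rpow_def_of_pos (by exact_mod_cast hp)]
  exact Real.exp_le_exp.2 (by linarith)

/-- The scale `√(2 log p)` of the maximum of the noise. -/
def scale (p : ℕ) : ℝ := Real.sqrt (2 * Real.log p)

lemma scale_sq {p : ℕ} (hp : 0 < p) : scale p ^ 2 = 2 * Real.log p :=
  Real.sq_sqrt (by have := Real.log_nonneg (x := p) (by exact_mod_cast hp); linarith)

lemma tendsto_scale : Tendsto scale atTop atTop :=
  Real.tendsto_sqrt_atTop.comp (tendsto_log_nat.const_mul_atTop two_pos)

lemma sqrt_eq_scale {a : ℝ} (ha : 0 ≤ a) (p : ℕ) :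
    Real.sqrt (2 * a * Real.log p) = Real.sqrt a * scale p := by
  rw [scale, ← Real.sqrt_mul ha]; ring_nf

lemma dens_mul {ϑ : ℝ} {p : ℕ} (hp : 0 < p) : p * dens ϑ p = (p : ℝ) ^ (1 - ϑ) := by
  have hp0 : (0 : ℝ) < p := by exact_mod_cast hp
  rw [dens, sub_eq_add_neg, Real.rpow_add hp0, Real.rpow_one]

lemma eta_le_half {ϑ r ω₀ : ℝ} (hϑ0 : 0 < ϑ) (hϑ1 : ϑ < 1) (hr : ϑ < r) (hω : 0 < ω₀) :
    eta r ϑ ω₀ ≤ 1 / 2 := by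
  have hr0 : 0 < r := hϑ0.trans hr
  unfold eta
  set μ := min (2 * ϑ / r) (min (1 - ϑ / r) (Real.sqrt (2 * (1 - ω₀)) - 1 + ϑ / r))
  have h1 : μ ≤ 2 * ϑ / r := min_le_left _ _
  have h2 : μ ≤ 1 - ϑ / r := (min_le_right _ _).trans (min_le_left _ _)
  have hs : 1 ≤ Real.sqrt (1 + 2 * ω₀) := Real.one_le_sqrt.2 (by linarith)
  have hpre0 : 0 ≤ ϑ * r / ((ϑ + r) * Real.sqrt (1 + 2 * ω₀)) := by positivity
  have hpre : ϑ * r / ((ϑ + r) * Real.sqrt (1 + 2 * ω₀)) ≤ r / (ϑ + r) := by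
    rw [div_le_div_iff₀ (by positivity) (by positivity)]
    have : ϑ ≤ Real.sqrt (1 + 2 * ω₀) := by linarith
    nlinarith [mul_le_mul_of_nonneg_left this (by positivity : 0 ≤ r * (ϑ + r))]
  rcases le_or_gt μ 0 with hμ | hμ
  · have := mul_nonpos_of_nonneg_of_nonpos hpre0 hμ
    linarith
  · have h3 : μ ≤ 1 / 2 * (1 + ϑ / r) := by
      have : 2 * ϑ / r = 2 * (ϑ / r) := by ring
      rw [this] at h1
      linarith
    calc _ ≤ r / (ϑ + r) * (1 / 2 * (1 + ϑ / r)) := by gcongr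
      _ = 1 / 2 := by field_simp; ring

/-- The data are regular with probability `1 - p⁻²` or more, for large `p`. -/
lemma badProb_le {ϑ φ q ρ c : ℝ} {n p m' k₀ : ℕ} (hp1 : 1 < p) (hρϑ : ρ ≤ ϑ / 2)
    (hρq : ρ ≤ q / 96) (hk : 3 ≤ ϑ / 2 * (k₀ + 1)) (hm'q : 4 ≤ m' * (q / 96))
    {t₁ : ℝ} (ht₁sq : t₁ ^ 2 = 2 * q * Real.log p)
    (hn1 : (p : ℝ) ^ φ / 2 ≤ n) (hexp1 : 3 * Real.log p ≤ (p : ℝ) ^ (1 - ϑ))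
    (hexp2 : 16 * 6 * Real.log p ≤ (p : ℝ) ^ (2 * c)) (h11 : 11 ≤ (p : ℝ) ^ (1 : ℝ))
    (h2m : 2 ^ m' ≤ (p : ℝ) ^ (1 : ℝ)) :
    badProb ϑ n p ((p : ℝ) ^ (-(φ / 2) + c)) t₁ ((p : ℝ) ^ ρ) m' k₀ ≤ (p : ℝ) ^ (-2 : ℝ) := by
  have hp : 0 < p := by omega
  have hp0 : (0 : ℝ) < p := by exact_mod_cast hp
  have hp1' : (1 : ℝ) < p := by exact_mod_cast hp1
  unfold badProb
  rw [dens_mul hp]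
  have hb1 : Real.exp (-((p : ℝ) ^ (1 - ϑ))) ≤ (p : ℝ) ^ (-3 : ℝ) :=
    exp_neg_le_rpow_neg hp hexp1
  have hb2 : Real.exp (-(n * ((p : ℝ) ^ (-(φ / 2) + c)) ^ 2 / 8)) ≤ (p : ℝ) ^ (-6 : ℝ) := by
    refine exp_neg_le_rpow_neg hp ?_
    have e1 : (p : ℝ) ^ φ * ((p : ℝ) ^ (-(φ / 2) + c)) ^ 2 = (p : ℝ) ^ (2 * c) := by
      rw [← Real.rpow_natCast ((p : ℝ) ^ (-(φ / 2) + c)), ← Real.rpow_mul hp0.le,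
        ← Real.rpow_add hp0]
      congr 1; push_cast; ring
    have := mul_le_mul_of_nonneg_right hn1 (sq_nonneg ((p : ℝ) ^ (-(φ / 2) + c)))
    linarith
  have hb3 : ((p : ℝ) ^ ρ * dens ϑ p) ^ (k₀ + 1) ≤ (p : ℝ) ^ (-3 : ℝ) := by
    rw [dens, ← Real.rpow_add hp0, ← Real.rpow_natCast, ← Real.rpow_mul hp0.le]
    refine Real.rpow_le_rpow_of_exponent_le hp1'.le ?_
    push_cast
    nlinarith [mul_le_mul_of_nonneg_right hρϑ (by positivity : 0 ≤ (k₀ : ℝ) + 1)]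
  have hb4 : (2 * (p : ℝ) ^ ρ) ^ m' * Real.exp (-(m' * t₁ ^ 2 / 96)) ≤
      (p : ℝ) ^ (-3 : ℝ) := by
    rw [ht₁sq, mul_pow, ← Real.rpow_natCast ((p : ℝ) ^ ρ), ← Real.rpow_mul hp0.le]
    have h1 : Real.exp (-(m' * (2 * q * Real.log p) / 96)) ≤ (p : ℝ) ^ (-(m' * q / 48)) :=
      exp_neg_le_rpow_neg hp (le_of_eq (by ring))
    calc 2 ^ m' * (p : ℝ) ^ (ρ * m') * Real.exp (-(m' * (2 * q * Real.log p) / 96)) ≤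
          (p : ℝ) ^ (1 : ℝ) * (p : ℝ) ^ (ρ * m') * (p : ℝ) ^ (-(m' * q / 48)) := by gcongr
      _ = (p : ℝ) ^ (1 + ρ * m' + -(m' * q / 48)) := by
          rw [Real.rpow_add hp0, Real.rpow_add hp0]
      _ ≤ _ := by
          refine Real.rpow_le_rpow_of_exponent_le hp1'.le ?_
          nlinarith [mul_le_mul_of_nonneg_right hρq (Nat.cast_nonneg (α := ℝ) m')]
  have e6 : (p : ℝ) ^ (-6 : ℝ) = (p : ℝ) ^ (-3 : ℝ) * (p : ℝ) ^ (-3 : ℝ) := by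
    rw [← Real.rpow_add hp0]; norm_num
  have e2 : (p : ℝ) ^ (-2 : ℝ) = (p : ℝ) * (p : ℝ) ^ (-3 : ℝ) := by
    nth_rewrite 2 [← Real.rpow_one (p : ℝ)]
    rw [← Real.rpow_add hp0]; norm_num
  have e3 : (p : ℝ) ^ 3 * (p : ℝ) ^ (-3 : ℝ) = 1 := by
    rw [← Real.rpow_natCast, ← Real.rpow_add hp0]; norm_num
  have hx0 : 0 < (p : ℝ) ^ (-3 : ℝ) := by positivity
  have hb2' : ((p : ℝ) ^ 2 + p) * (4 * Real.exp (-(n * ((p : ℝ) ^ (-(φ / 2) + c)) ^ 2 / 8))) ≤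
      8 * (p : ℝ) ^ (-3 : ℝ) := by
    calc _ ≤ ((p : ℝ) ^ 3 + p ^ 3) * (4 * (p : ℝ) ^ (-6 : ℝ)) := by
          gcongr
          · exact hp1'.le
          · norm_num
          · exact le_self_pow₀ hp1'.le (by norm_num)
      _ = 8 * ((p : ℝ) ^ 3 * (p : ℝ) ^ (-3 : ℝ)) * (p : ℝ) ^ (-3 : ℝ) := by rw [e6]; ring
      _ = _ := by rw [e3]; ring
  rw [e2]
  rw [Real.rpow_one] at h11
  nlinarith [mul_le_mul_of_nonneg_right h11 hx0.le]

set_option maxHeartbeats 1000000 in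
/-- All side conditions hold for large `p`, with polynomially small errors, balls of at most `p^ρ`
indices for an exponent `ρ` as small as desired, and combinatorial constants that do not depend on
`ρ`. -/
lemma exists_regime {ϑ r φ γ A ω₀ q : ℝ}
    (hϑ₀ : 0 < ϑ) (hϑ₁ : ϑ < 1) (hr : ϑ < r) (hφ₀ : 1 - ϑ < φ)
    (hγ₀ : 0 < γ) (hγ₁ : γ < 1) (hA : 0 < A) (hω₀ : 0 < ω₀) (hω₁ : ω₀ < 1 / 2) (hq₀ : 0 < q) :
    ∃ (m m' k₀ : ℕ) (c ρ₀ : ℝ), 0 < c ∧ 0 < ρ₀ ∧ ∀ ρ : ℝ, 0 < ρ → ρ ≤ ρ₀ →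
      ∃ c₁ : ℝ, 0 < c₁ ∧
      ∀ᶠ p : ℕ in atTop, ∀ n : ℕ, |(n : ℝ) - (p : ℝ) ^ φ| < 1 → ∃ t δ R : ℝ,
        Regime γ A ω₀ ϑ n p t δ R ((p : ℝ) ^ (-c)) ((p : ℝ) ^ (-c₁)) (tau r p)
          ((1 + eta r ϑ ω₀) * tau r p) (tune₁ q p) ((p : ℝ) ^ ρ) m m' k₀ ∧
        badProb ϑ n p δ (tune₁ q p) ((p : ℝ) ^ ρ) m' k₀ ≤ (p : ℝ) ^ (-2 : ℝ) := by
  have hr0 : 0 < r := hϑ₀.trans hr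
  have hsr : 0 < Real.sqrt r := Real.sqrt_pos.2 hr0
  have hsq : 0 < Real.sqrt q := Real.sqrt_pos.2 hq₀
  -- With accuracy `δ = p^{-φ/2 + c}` of the Gram matrix and `|β| ≤ R = p^{(1-ϑ)/2 + c}`, this
  -- choice gives `δ R = p^{-2c}`.
  set c := (φ - (1 - ϑ)) / 8 with hc
  have hc0 : 0 < c := by rw [hc]; linarith
  -- more than `k₀` signals, or `m'` large noise scores, in a ball have probability at most `p^{-3}`
  obtain ⟨k₀, hk₀⟩ := exists_nat_ge (6 / ϑ)
  obtain ⟨m', hm'⟩ := exists_nat_ge (384 / q)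
  have hm'0 : 0 < m' := by
    have : (0 : ℝ) < m' := lt_of_lt_of_le (by positivity) hm'
    exact_mod_cast this
  set m := m' + ⌈(k₀ : ℝ) * (8 * Real.sqrt r / Real.sqrt q)⌉₊ with hm
  have hk : 3 ≤ ϑ / 2 * (k₀ + 1) := by
    rw [div_le_iff₀ hϑ₀] at hk₀
    nlinarith
  have hm'q : 4 ≤ m' * (q / 96) := by
    rw [div_le_iff₀ hq₀] at hm'
    linarith
  refine ⟨m, m', k₀, c, min (ϑ / 2) (q / 96), hc0, by positivity, fun ρ hρ0 hρ => ?_⟩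
  have hρϑ : ρ ≤ ϑ / 2 := hρ.trans (min_le_left _ _)
  have hρq : ρ ≤ q / 96 := hρ.trans (min_le_right _ _)
  -- the correlation threshold is `t = p^{-κ}`, so that balls have at most `(A / t)^{m+1} ≤ p^ρ`
  -- elements, and the correlations below it sum to `O(p^{-κ (1 - γ)})` in every row
  set κ := ρ / (2 * (m + 1)) with hκ
  have hκ0 : 0 < κ := by positivity
  have hκγ : 0 < κ * (1 - γ) := mul_pos hκ0 (by linarith)
  set c₁ := min c (κ * (1 - γ)) / 2 with hc₁
  have hc₁0 : 0 < c₁ := by positivity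
  have hc₁c : c₁ < c := by
    have := min_le_left c (κ * (1 - γ)); linarith
  have hc₁κ : c₁ < κ * (1 - γ) := by
    have := min_le_right c (κ * (1 - γ)); linarith
  refine ⟨c₁, hc₁0, ?_⟩
  filter_upwards [eventually_gt_atTop 1, tendsto_log_nat.eventually_ge_atTop 1,
    tendsto_scale.eventually_ge_atTop (4 / Real.sqrt q),
    eventually_log_pow_le (24 * r) 1 (show 0 < 2 * c by linarith),
    eventually_mul_rpow_le 4 (show -(2 * c) < -c by linarith),
    eventually_log_pow_le 2 2 hκ0, eventually_log_pow_le 2 2 hc0,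
    eventually_mul_rpow_neg_le m hc0 (show 0 < (1 - 2 * ω₀) / 2 by linarith),
    eventually_mul_rpow_neg_le m' hc0 one_pos,
    eventually_mul_rpow_le 2 (show -c < -c₁ by linarith),
    eventually_log_mul_rpow_le (4 * A * (1 + 2 * r)) 1 (show -(κ * (1 - γ)) < -c₁ by linarith),
    eventually_const_le A hκ0, eventually_log_pow_le 3 1 (show 0 < 1 - ϑ by linarith),
    eventually_const_le 2 (show 0 < φ by linarith),
    eventually_log_pow_le (16 * 6) 1 (show 0 < 2 * c by linarith),
    eventually_const_le 11 one_pos, eventually_const_le (2 ^ m') one_pos]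
    with p hp1 hL hs hR hδd hκL hcL hdm hdm' hcc hτe hAκ hexp1 hpφ hexp2 h11 h2m n hn
  have hp : 0 < p := by omega
  have hp0 : (0 : ℝ) < p := by exact_mod_cast hp
  have hp1' : (1 : ℝ) < p := by exact_mod_cast hp1
  have hs0 : 0 < scale p := lt_of_lt_of_le (by positivity) hs
  have hτ : tau r p = Real.sqrt r * scale p := sqrt_eq_scale hr0.le p
  have ht₁ : tune₁ q p = Real.sqrt q * scale p := sqrt_eq_scale hq₀.le p
  have hτ0 : 0 < tau r p := by rw [hτ]; positivity
  have hτsq : tau r p ^ 2 = 2 * r * Real.log p := by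
    rw [hτ, mul_pow, Real.sq_sqrt hr0.le, scale_sq hp]; ring
  have ht₁sq : tune₁ q p ^ 2 = 2 * q * Real.log p := by
    rw [ht₁, mul_pow, Real.sq_sqrt hq₀.le, scale_sq hp]; ring
  have ht₁4 : 4 ≤ tune₁ q p := by
    rw [ht₁]; rw [div_le_iff₀ hsq] at hs; linarith
  rw [pow_one] at hR hτe hexp1 hexp2
  have hn1 : (p : ℝ) ^ φ / 2 ≤ n := by
    have := (abs_lt.1 hn).1
    linarith
  have hn0 : 0 < n := by
    have : (0 : ℝ) < n := lt_of_lt_of_le (by positivity) hn1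
    exact_mod_cast this
  have hδ1 : (p : ℝ) ^ (-(φ / 2) + c) ≤ 1 :=
    Real.rpow_le_one_of_one_le_of_nonpos hp1'.le (by rw [hc]; linarith)
  have hR1 : 1 ≤ (p : ℝ) ^ ((1 - ϑ) / 2 + c) :=
    Real.one_le_rpow hp1'.le (by linarith)
  have hδR : (p : ℝ) ^ (-(φ / 2) + c) * (p : ℝ) ^ ((1 - ϑ) / 2 + c) = (p : ℝ) ^ (-(2 * c)) := by
    rw [← Real.rpow_add hp0]; congr 1; rw [hc]; ring
  have hδ0 : 0 < (p : ℝ) ^ (-(φ / 2) + c) := by positivity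
  have hAt : A / (p : ℝ) ^ (-κ) ≤ (p : ℝ) ^ (2 * κ) := by
    rw [div_le_iff₀ (by positivity), ← Real.rpow_add hp0]
    refine hAκ.trans (le_of_eq ?_)
    congr 1; ring
  have hAt0 : 0 ≤ A / (p : ℝ) ^ (-κ) := by positivity
  have hκm : 2 * κ * (m + 1) = ρ := by rw [hκ]; field_simp
  have hpow : ∀ k : ℕ, k ≤ m + 1 → (A / (p : ℝ) ^ (-κ)) ^ k ≤ (p : ℝ) ^ ρ := by
    intro k hk
    calc (A / (p : ℝ) ^ (-κ)) ^ k ≤ ((p : ℝ) ^ (2 * κ)) ^ k := by gcongr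
      _ = (p : ℝ) ^ (2 * κ * k) := by rw [← Real.rpow_natCast, ← Real.rpow_mul hp0.le]
      _ ≤ (p : ℝ) ^ ρ := by
          refine Real.rpow_le_rpow_of_exponent_le hp1'.le ?_
          rw [← hκm]
          have : (k : ℝ) ≤ m + 1 := by exact_mod_cast hk
          gcongr
  refine ⟨(p : ℝ) ^ (-κ), (p : ℝ) ^ (-(φ / 2) + c), (p : ℝ) ^ ((1 - ϑ) / 2 + c), ?_, ?_⟩
  · refine
      { ϑ_pos := hϑ₀, p_pos := hp, n_pos := hn0, γ_pos := hγ₀, γ_lt := hγ₁, ω₀_lt := hω₁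
        t_pos := by positivity
        t_lt := Real.rpow_lt_one_of_one_lt_of_neg hp1' (by linarith)
        τ_pos := hτ0
        τ'_le := ?_, t₁_pos := by linarith, δ_pos := hδ0, δ_le := hδ1, R_pos := by positivity
        R_sq := ?_, d_ge := ?_, d_ge' := ?_, e_ge := ?_, e_le := ?_, m_ge := ?_, td_le := ?_
        dm_lt := by linarith
        one_le_B := Real.one_le_rpow hp1'.le hρ0.le
        ball_le := hpow m (by omega), ball_le' := hpow (m + 1) le_rfl, m'_pos := hm'0
        m_pos := by omega, dm'_le := by linarith }
    · have := eta_le_half hϑ₀ hϑ₁ hr hω₀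
      gcongr
      linarith
    · rw [dens_mul hp, hτsq, ← Real.rpow_natCast ((p : ℝ) ^ ((1 - ϑ) / 2 + c)),
        ← Real.rpow_mul hp0.le]
      have : ((1 - ϑ) / 2 + c) * ((2 : ℕ) : ℝ) = (1 - ϑ) + 2 * c := by push_cast; ring
      rw [this, Real.rpow_add hp0]
      have := mul_le_mul_of_nonneg_left hR (by positivity : 0 ≤ (p : ℝ) ^ (1 - ϑ))
      linarith
    · calc 4 * (p : ℝ) ^ (-(φ / 2) + c) ≤
            4 * ((p : ℝ) ^ (-(φ / 2) + c) * (p : ℝ) ^ ((1 - ϑ) / 2 + c)) := by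
              have := le_mul_of_one_le_right hδ0.le hR1
              linarith
        _ ≤ _ := by rw [hδR]; exact hδd
    · rw [mul_assoc, hδR]; exact hδd
    · have h1 : ((p : ℝ) ^ (-κ)) ^ (1 - γ) = (p : ℝ) ^ (-(κ * (1 - γ))) := by
        rw [← Real.rpow_mul hp0.le]; congr 1; ring
      rw [h1]
      have h2 : tau r p ≤ (1 + 2 * r) * Real.log p := by
        nlinarith [sq_nonneg (tau r p - 1)]
      have h3 : (p : ℝ) ^ (-(κ * (1 - γ))) * A * (2 * tau r p) ≤
          (p : ℝ) ^ (-(κ * (1 - γ))) * A * (2 * ((1 + 2 * r) * Real.log p)) := by gcongr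
      linarith
    · have : (p : ℝ) ^ (-c₁) ≤ 1 :=
        Real.rpow_le_one_of_one_le_of_nonpos hp1'.le (by linarith)
      linarith
    · rw [hτ, ht₁]
      have h1 : 8 * (Real.sqrt r * scale p) / (Real.sqrt q * scale p) =
          8 * Real.sqrt r / Real.sqrt q := by field_simp
      rw [h1, hm]
      push_cast
      gcongr
      exact Nat.le_ceil _
    · have hL2 : 0 < Real.log p ^ 2 := by positivity
      have h1 : (p : ℝ) ^ (-κ) ≤ (Real.log p ^ 2)⁻¹ / 2 := by
        rw [Real.rpow_neg hp0.le, inv_le_comm₀ (by positivity) (by positivity)]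
        refine le_trans (le_of_eq ?_) hκL
        field_simp
      have h2 : (p : ℝ) ^ (-c) ≤ (Real.log p ^ 2)⁻¹ / 2 := by
        rw [Real.rpow_neg hp0.le, inv_le_comm₀ (by positivity) (by positivity)]
        refine le_trans (le_of_eq ?_) hcL
        field_simp
      linarith
  · exact badProb_le hp1 hρϑ hρq hk hm'q ht₁sq hn1 hexp1 hexp2 h11 h2m

/-! ### Calibration of the penalty -/

/-- The bracket `(K - 1/2) log log p - log M` in the penalty. -/
def slack (r ϑ α K : ℝ) (p : ℕ) : ℝ :=
  (K - 1 / 2) * Real.log (Real.log p) - Real.log (tuneM r ϑ α K)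

lemma tendsto_slack (r ϑ α : ℝ) {K : ℝ} (hK : 1 ≤ K) :
    Tendsto (slack r ϑ α K) atTop atTop := by
  have h := (Real.tendsto_log_atTop.comp tendsto_log_nat).const_mul_atTop
    (show 0 < K - 1 / 2 by linarith)
  exact tendsto_atTop_add_const_right _ (-Real.log (tuneM r ϑ α K)) h

lemma eventually_slack_le (r ϑ α K : ℝ) {ε : ℝ} (hε : 0 < ε) :
    ∀ᶠ p : ℕ in atTop, slack r ϑ α K p ≤ ε * scale p := by
  have h := (isLittleO_log_rpow_atTop (show (0 : ℝ) < 1 / 2 by norm_num)).comp_tendsto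
    tendsto_log_nat
  have h2 := h.def (c := ε / 2 * (|K - 1 / 2| + 1)⁻¹) (by positivity)
  filter_upwards [h2, tendsto_log_nat.eventually_ge_atTop 1,
    tendsto_scale.eventually_ge_atTop (|Real.log (tuneM r ϑ α K)| * (2 / ε))] with p hp hL hs
  simp only [Function.comp_apply, Real.norm_eq_abs] at hp
  rw [← Real.sqrt_eq_rpow, abs_of_nonneg (Real.log_nonneg hL),
    abs_of_nonneg (Real.sqrt_nonneg _)] at hp
  have h3 : Real.sqrt (Real.log p) ≤ scale p := Real.sqrt_le_sqrt (by linarith)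
  have h4 : (K - 1 / 2) * Real.log (Real.log p) ≤ ε / 2 * scale p := by
    calc (K - 1 / 2) * Real.log (Real.log p) ≤ (|K - 1 / 2| + 1) * Real.log (Real.log p) := by
          gcongr
          · exact Real.log_nonneg hL
          · linarith [le_abs_self (K - 1 / 2)]
      _ ≤ (|K - 1 / 2| + 1) * (ε / 2 * (|K - 1 / 2| + 1)⁻¹ * Real.sqrt (Real.log p)) := by gcongr
      _ = ε / 2 * Real.sqrt (Real.log p) := by field_simp
      _ ≤ _ := by gcongr
  have h5 : -Real.log (tuneM r ϑ α K) ≤ ε / 2 * scale p := by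
    refine (neg_le_abs _).trans ?_
    rw [← div_le_iff₀' (by positivity)]
    refine le_trans (le_of_eq ?_) hs
    field_simp
  unfold slack
  linarith

/-- `w = slack / (√ϑ √(2 log p))`: the amount by which the effective threshold of an isolated index
exceeds `√(2 ϑ log p)`. -/
def excessLevel (r ϑ α K : ℝ) (p : ℕ) : ℝ := slack r ϑ α K p / (Real.sqrt ϑ * scale p)

lemma q_le {r ϑ q : ℝ} (hϑ₀ : 0 < ϑ) (hr : ϑ < r)
    (hq : q ≤ (r + ϑ - zeta r ϑ) ^ 2 / (4 * r)) : q ≤ ϑ := by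
  have hr0 : 0 < r := hϑ₀.trans hr
  have h1 : r + ϑ - zeta r ϑ = 2 * (Real.sqrt r * Real.sqrt ϑ) := by
    unfold zeta
    nlinarith [Real.sq_sqrt hr0.le, Real.sq_sqrt hϑ₀.le]
  rw [h1, mul_pow, mul_pow, Real.sq_sqrt hr0.le, Real.sq_sqrt hϑ₀.le] at hq
  refine hq.trans (le_of_eq ?_)
  field_simp
  norm_num

/-- The calibration: since `r + ϑ - ζ = 2 √(rϑ)`, the threshold `½ (τ + t₂²/τ)` of an isolated index
equals `√(2 ϑ log p) + w`. -/
lemma eventually_tune₂ {r ϑ α K : ℝ} (hϑ₀ : 0 < ϑ) (hr : ϑ < r) (hζ : zeta r ϑ ≤ ϑ)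
    (hK : 1 ≤ K) :
    ∀ᶠ p : ℕ in atTop, 0 ≤ excessLevel r ϑ α K p ∧ excessLevel r ϑ α K p ≤ 1 / 4 ∧
      Real.sqrt ϑ * scale p * excessLevel r ϑ α K p = slack r ϑ α K p ∧
      tune₂ r ϑ α K p ^ 2 / tau r p =
        (2 * Real.sqrt ϑ - Real.sqrt r) * scale p + 2 * excessLevel r ϑ α K p := by
  have hr0 : 0 < r := hϑ₀.trans hr
  have ha : 0 < Real.sqrt r := Real.sqrt_pos.2 hr0
  have hb : 0 < Real.sqrt ϑ := Real.sqrt_pos.2 hϑ₀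
  filter_upwards [eventually_gt_atTop 0, tendsto_log_nat.eventually_ge_atTop 0,
    tendsto_scale.eventually_gt_atTop 0, (tendsto_slack r ϑ α hK).eventually_ge_atTop 0,
    eventually_slack_le r ϑ α K (show 0 < Real.sqrt ϑ / 4 by positivity)] with p hp hL hs h0 h1
  refine ⟨by unfold excessLevel; positivity, ?_, ?_, ?_⟩
  · unfold excessLevel
    rw [div_le_iff₀ (by positivity)]
    linarith
  · unfold excessLevel
    field_simp
  · have hτ : tau r p = Real.sqrt r * scale p := sqrt_eq_scale hr0.le p
    have e1 : r + ϑ - zeta r ϑ = 2 * (Real.sqrt r * Real.sqrt ϑ) := by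
      unfold zeta
      nlinarith [Real.sq_sqrt hr0.le, Real.sq_sqrt hϑ₀.le]
    have e2 : ϑ - zeta r ϑ = Real.sqrt r * (2 * Real.sqrt ϑ - Real.sqrt r) := by
      have := Real.mul_self_sqrt hr0.le
      linarith
    have h2 : tune₂ r ϑ α K p ^ 2 = 2 * (ϑ - zeta r ϑ) * Real.log p +
        4 * r / (r + ϑ - zeta r ϑ) * slack r ϑ α K p := by
      unfold tune₂
      refine Real.sq_sqrt ?_
      change 0 ≤ 2 * (ϑ - zeta r ϑ) * Real.log p + 4 * r / (r + ϑ - zeta r ϑ) * slack r ϑ α K p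
      have h3 : 0 ≤ ϑ - zeta r ϑ := by linarith
      rw [e1]
      positivity
    rw [h2, hτ, e1, e2]
    have hs2 := scale_sq hp
    have h4 : 2 * (Real.sqrt r * (2 * Real.sqrt ϑ - Real.sqrt r)) * Real.log p =
        Real.sqrt r * (2 * Real.sqrt ϑ - Real.sqrt r) * scale p ^ 2 := by rw [hs2]; ring
    rw [h4]
    unfold excessLevel
    have h5 : (4 : ℝ) * r = 4 * (Real.sqrt r * Real.sqrt r) := by rw [Real.mul_self_sqrt hr0.le]
    rw [h5]
    field_simp
    ring

/-- The Gaussian exponent at the level `y √(2 log p) - 1`, with a variance inflated by `h p → 0`, is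
`(y² - o(1)) log p`. -/
lemma eventually_tail_exponent {y ν : ℝ} (hy : 0 < y) (hν : 0 < ν) {h : ℕ → ℝ}
    (hh0 : ∀ p, 0 ≤ h p) (hh : ∀ ε : ℝ, 0 < ε → ∀ᶠ p in atTop, h p ≤ ε) :
    ∀ᶠ p : ℕ in atTop, 1 ≤ y * scale p ∧
      (y ^ 2 - ν) * Real.log p ≤ (y * scale p - 1) ^ 2 / (2 * (1 + h p)) := by
  filter_upwards [eventually_gt_atTop 0, tendsto_log_nat.eventually_ge_atTop 0,
    tendsto_scale.eventually_ge_atTop (4 * y / ν), tendsto_scale.eventually_ge_atTop (1 / y),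
    hh (ν / (2 * y ^ 2)) (by positivity)] with p hp hL hs hs' hhp
  have hs2 := scale_sq hp
  have h0 := hh0 p
  rw [div_le_iff₀ hν] at hs
  rw [div_le_iff₀ hy] at hs'
  rw [le_div_iff₀ (by positivity)] at hhp
  refine ⟨by linarith, ?_⟩
  rw [le_div_iff₀ (by positivity)]
  have hs0 : 0 ≤ scale p := Real.sqrt_nonneg _
  have h1 : 4 * y * scale p ≤ ν * (2 * Real.log p) := by rw [← hs2]; nlinarith
  have h2 : h p * (2 * y ^ 2) * Real.log p ≤ ν * Real.log p := by gcongr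
  have h3 : 0 ≤ h p * ν * Real.log p := by positivity
  have h4 : (y * scale p - 1) ^ 2 = y ^ 2 * (2 * Real.log p) - 2 * y * scale p + 1 := by
    rw [← hs2]; ring
  rw [h4]
  nlinarith

/-- Scaling of the Gaussian exponent by the standard deviation `a`. -/
lemma tail_exponent_le {u a x s h : ℝ} (hu : 0 ≤ u) (ha : 0 < a) (hh : 0 ≤ h) (hs : 0 < s)
    (hx : a * u ≤ x) (hs' : s ≤ a ^ 2 * (1 + h)) :
    u ^ 2 / (2 * (1 + h)) ≤ x ^ 2 / (2 * s) := by
  rw [div_le_div_iff₀ (by positivity) (by positivity)]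
  have h1 : (a * u) ^ 2 ≤ x ^ 2 := pow_le_pow_left₀ (by positivity) hx 2
  have h2 : u ^ 2 * (2 * s) ≤ u ^ 2 * (2 * (a ^ 2 * (1 + h))) := by gcongr
  nlinarith [mul_le_mul_of_nonneg_right h1 (by positivity : 0 ≤ 2 * (1 + h))]

lemma cmpErr_nonneg {τ d e : ℝ} (hτ : 0 ≤ τ) (hd : 0 ≤ d) (he : 0 ≤ e) (m : ℕ) :
    0 ≤ cmpErr τ d e m := by
  unfold cmpErr; positivity

/-- The comparison error is negligible even after multiplication by the noise level. -/
lemma eventually_cmpErr_le {r c c₁ : ℝ} (hr : 0 ≤ r) (hc : 0 < c) (hc₁ : 0 < c₁) (m : ℕ) {ε : ℝ}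
    (hε : 0 < ε) : ∀ᶠ p : ℕ in atTop, 1 ≤ scale p ∧
      cmpErr (tau r p) ((p : ℝ) ^ (-c)) ((p : ℝ) ^ (-c₁)) m * scale p ≤ ε := by
  filter_upwards [eventually_gt_atTop 0, tendsto_scale.eventually_ge_atTop 1,
    eventually_log_mul_rpow_neg_le (Real.sqrt r * (m ^ 2 + 1)) 1 hc (show 0 < ε / 2 by positivity),
    eventually_log_mul_rpow_neg_le (2 * (m + 1)) 1 hc₁ (show 0 < ε / 2 by positivity)]
    with p hp hs h1 h2
  refine ⟨hs, ?_⟩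
  have hs2 := scale_sq hp
  rw [pow_one] at h1 h2
  have hτ : tau r p = Real.sqrt r * scale p := sqrt_eq_scale hr p
  unfold cmpErr
  rw [hτ]
  have e1 : (1 / 2 * (Real.sqrt r * scale p) * ((p : ℝ) ^ (-c) * ((m : ℝ) ^ 2 + 1)) +
      (m + 1) * (p : ℝ) ^ (-c₁)) * scale p =
      1 / 2 * Real.sqrt r * scale p ^ 2 * ((p : ℝ) ^ (-c) * ((m : ℝ) ^ 2 + 1)) +
      (m + 1) * (p : ℝ) ^ (-c₁) * scale p := by ring
  have h3 : scale p ≤ 2 * Real.log p := by rw [← hs2]; nlinarith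
  have h4 : ((m : ℝ) + 1) * (p : ℝ) ^ (-c₁) * scale p ≤
      (m + 1) * (p : ℝ) ^ (-c₁) * (2 * Real.log p) := by gcongr
  rw [e1, hs2]
  linarith

/-! ### Missed signals -/

section

variable {ϑ r φ γ A ω₀ q : ℝ}

set_option maxHeartbeats 1000000 in
/-- A signal is missed with probability at most `p^{-(ϑ + ζ) + ν}`. -/
lemma eventually_false_negative
    (hϑ₀ : 0 < ϑ) (hϑ₁ : ϑ < 1) (hr : ϑ < r) (hζ : zeta r ϑ ≤ ϑ) (hφ₀ : 1 - ϑ < φ)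
    (hγ₀ : 0 < γ) (hγ₁ : γ < 1) (hA : 0 < A) (hω₀ : 0 < ω₀) (hω₁ : ω₀ < 1 / 2) (hq₀ : 0 < q)
    (hq : q ≤ (r + ϑ - zeta r ϑ) ^ 2 / (4 * r)) {K α : ℝ} (hK : 1 ≤ K) {ν : ℝ} (hν : 0 < ν) :
    ∀ᶠ p : ℕ in atTop, ∀ n : ℕ, |(n : ℝ) - (p : ℝ) ^ φ| < 1 →
      ∀ Ω : Matrix (Fin p) (Fin p) ℝ, CorrelationClass γ A ω₀ Ω →
      ∀ h₁ : Measure ℝ, IsProbabilityMeasure h₁ →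
        h₁ (Set.Icc (tau r p) ((1 + eta r ϑ ω₀) * tau r p))ᶜ = 0 →
      ∀ est : Design n p × (Fin n → ℝ) → Fin p → ℝ,
        IsProcedure (tune₁ q p) (tune₂ r ϑ α K p) (tau r p) est →
      ∀ i, (modelLaw n ϑ Ω h₁).real {ω | ω.2.1 i ≠ 0 ∧ est (ω.1, response ω) i = 0} ≤
        (p : ℝ) ^ (-(ϑ + zeta r ϑ) + ν) := by
  have hr0 : 0 < r := hϑ₀.trans hr
  have hqϑ := q_le hϑ₀ hr hq
  set y := Real.sqrt r - Real.sqrt ϑ with hy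
  have hy0 : 0 < y := by rw [hy, sub_pos]; exact Real.sqrt_lt_sqrt hϑ₀.le hr
  have hyζ : y ^ 2 = zeta r ϑ := rfl
  have hζ0 : 0 < zeta r ϑ := by rw [← hyζ]; positivity
  have hb : 0 < Real.sqrt ϑ := Real.sqrt_pos.2 hϑ₀
  -- `ζ ≤ ϑ` means `√r ≤ 2 √ϑ`
  have hab : Real.sqrt r ≤ 2 * Real.sqrt ϑ := by
    have : y ≤ Real.sqrt ϑ := Real.le_sqrt_of_sq_le (by rw [hyζ]; exact hζ)
    linarith
  obtain ⟨m, m', k₀, c, ρ₀, hc, hρ₀, H⟩ :=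
    exists_regime (φ := φ) hϑ₀ hϑ₁ hr hφ₀ hγ₀ hγ₁ hA hω₀ hω₁ hq₀
  set ρ := min ρ₀ (ν / (4 * (m + 1))) with hρ
  have hρ0 : 0 < ρ := by positivity
  have hρm : ρ * (m + 1) ≤ ν / 4 := by
    calc ρ * (m + 1) ≤ ν / (4 * (m + 1)) * (m + 1) := by gcongr; exact min_le_right _ _
      _ = ν / 4 := by field_simp
  have hρm0 : 0 ≤ ρ * m := by positivity
  have hρν : ρ ≤ ν / 4 := by linarith
  obtain ⟨c₁, hc₁, Hp⟩ := H ρ hρ0 (min_le_left _ _)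
  have hh0 : ∀ p : ℕ, 0 ≤ (p : ℝ) ^ (-c) * ((m : ℝ) + 1) ^ 2 := fun p => by positivity
  have hh : ∀ ε : ℝ, 0 < ε → ∀ᶠ p : ℕ in atTop, (p : ℝ) ^ (-c) * ((m : ℝ) + 1) ^ 2 ≤ ε := by
    intro ε hε
    filter_upwards [eventually_mul_rpow_neg_le (((m : ℝ) + 1) ^ 2) hc hε] with p hp
    linarith
  filter_upwards [Hp, eventually_gt_atTop 1, eventually_tune₂ (α := α) hϑ₀ hr hζ hK,
    eventually_tail_exponent hy0 (show 0 < ν / 2 by positivity) hh0 hh,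
    eventually_cmpErr_le hr0.le hc hc₁ m (show (0 : ℝ) < 1 / 2 by norm_num),
    eventually_mul_rpow_le 3 (show (-2 : ℝ) < -(ϑ + zeta r ϑ) + ν by linarith),
    eventually_mul_rpow_le 3 (show ρ + -ϑ * 2 < -(ϑ + zeta r ϑ) + ν by linarith),
    eventually_mul_rpow_le (3 * (m + 2))
      (show -ϑ + (ρ * m + -(zeta r ϑ - ν / 2)) < -(ϑ + zeta r ϑ) + ν by linarith)]
    with p hreg hp1 ht₂ htail hcmp f1 f2 f3 n hn Ω hΩ h₁ hh₁ hsupp est hest i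
  obtain ⟨t, δ, R, hR, hbad⟩ := hreg n hn
  obtain ⟨hw0, hw1, -, ht₂⟩ := ht₂
  obtain ⟨hys, htail⟩ := htail
  obtain ⟨hs1, hcmp⟩ := hcmp
  have hp : 0 < p := by omega
  have hp0 : (0 : ℝ) < p := by exact_mod_cast hp
  have hp1' : (1 : ℝ) < p := by exact_mod_cast hp1
  have hτ : tau r p = Real.sqrt r * scale p := sqrt_eq_scale hr0.le p
  have ht₁ : tune₁ q p = Real.sqrt q * scale p := sqrt_eq_scale hq₀.le p
  have hd := hR.d_pos
  have herr0 := cmpErr_nonneg (m := m) hR.τ_pos.le hd.le (by positivity : 0 ≤ (p : ℝ) ^ (-c₁))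
  set err := cmpErr (tau r p) ((p : ℝ) ^ (-c)) ((p : ℝ) ^ (-c₁)) m with herrdef
  have herr : err ≤ 1 / 2 := (le_mul_of_one_le_right herr0 hs1).trans hcmp
  have hs0 : 0 < scale p := by linarith
  have hexp : ∀ x a s : ℝ, 0 < a → 0 < s → a * (y * scale p - 1) ≤ x →
      s ≤ a ^ 2 * (1 + (p : ℝ) ^ (-c) * ((m : ℝ) + 1) ^ 2) →
      0 ≤ x ∧ Real.exp (-(x ^ 2 / (2 * s))) ≤ (p : ℝ) ^ (-(zeta r ϑ - ν / 2)) := by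
    intro x a s ha hs hx hs'
    refine ⟨le_trans (mul_nonneg ha.le (by linarith)) hx, exp_neg_le_rpow_neg hp ?_⟩
    rw [← hyζ]
    exact htail.trans (tail_exponent_le (by linarith) ha (hh0 p) hs hx hs')
  have hx0 := hexp (tau r p - tune₁ q p - err) 1
    (1 + (p : ℝ) ^ (-c) * ((m : ℝ) + 1) ^ 2) one_pos (by positivity) (by
      rw [hτ, ht₁]
      have := mul_le_mul_of_nonneg_right (Real.sqrt_le_sqrt hqϑ) hs0.le
      rw [hy]
      linarith) (by linarith)
  have key := hR.false_negative_le hΩ hsupp hest i hx0.1 hx0.2 (fun s _ D hD => by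
    rw [ht₂, ← herrdef]
    rcases Nat.eq_zero_or_pos s with rfl | hs
    · have hD1 : D = 1 := by
        simp only [Nat.cast_zero, mul_zero, zero_add] at hD
        linarith [abs_nonpos_iff.1 hD]
      refine hexp _ 1 _ one_pos (by rw [hD1]; positivity) ?_ (by rw [hD1]; linarith)
      rw [hD1, hτ, hy]
      push_cast
      linarith
    · have hs' : (1 : ℝ) ≤ s := by exact_mod_cast hs
      have hD1 : 1 ≤ D := by
        have h1 := (abs_le.1 hD).1
        have h2 : 0 ≤ (1 - 2 * ω₀) * s := mul_nonneg (by linarith) (by linarith)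
        linarith
      have hsD : 1 ≤ Real.sqrt D := Real.one_le_sqrt.2 hD1
      have hsD2 : Real.sqrt D ^ 2 = D := Real.sq_sqrt (by linarith)
      refine hexp _ (Real.sqrt D) _ (by linarith) (by positivity) ?_ ?_
      · have h1 : 0 ≤ 1 / 2 * ((2 * Real.sqrt ϑ - Real.sqrt r) * scale p +
            2 * excessLevel r ϑ α K p) * ((s : ℝ) - 1) := by
          have h2 : 0 ≤ (2 * Real.sqrt ϑ - Real.sqrt r) * scale p :=
            mul_nonneg (by linarith) hs0.le
          have h3 : 0 ≤ (s : ℝ) - 1 := by linarith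
          positivity
        -- `½ τ √D ≥ ½ √r √(2 log p) ≥ (√r - √ϑ) √(2 log p)`
        have h4 : y * scale p ≤ 1 / 2 * Real.sqrt r * scale p := by
          apply mul_le_mul_of_nonneg_right _ hs0.le
          rw [hy]; linarith
        have h5 : Real.sqrt D * (y * scale p) ≤ D * (1 / 2 * Real.sqrt r * scale p) := by
          have : Real.sqrt D ≤ D := by
            refine (le_mul_of_one_le_right (zero_le_one.trans hsD) hsD).trans_eq ?_
            rw [← sq, hsD2]
          exact mul_le_mul this h4 (by positivity) (by linarith)
        rw [hτ]
        linarith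
      · rw [hsD2]
        linarith [le_mul_of_one_le_left (hh0 p) hD1])
  refine key.trans ?_
  have g1 : (p : ℝ) ^ ρ * dens ϑ p ^ 2 = (p : ℝ) ^ (ρ + -ϑ * 2) := by
    rw [dens, ← Real.rpow_natCast ((p : ℝ) ^ (-ϑ)), ← Real.rpow_mul hp0.le, ← Real.rpow_add hp0]
    norm_num
  have g2 : dens ϑ p * ((1 + (m + 1) * ((p : ℝ) ^ ρ) ^ m) * (p : ℝ) ^ (-(zeta r ϑ - ν / 2))) ≤
      (m + 2) * (p : ℝ) ^ (-ϑ + (ρ * m + -(zeta r ϑ - ν / 2))) := by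
    rw [Real.rpow_add hp0, Real.rpow_add hp0, ← Real.rpow_natCast ((p : ℝ) ^ ρ),
      ← Real.rpow_mul hp0.le, dens]
    have h1 : 1 ≤ (p : ℝ) ^ (ρ * m) := Real.one_le_rpow hp1'.le (by positivity)
    have h2 : 1 + ((m : ℝ) + 1) * (p : ℝ) ^ (ρ * m) ≤ (m + 2) * (p : ℝ) ^ (ρ * m) := by linarith
    calc _ ≤ (p : ℝ) ^ (-ϑ) * (((m + 2) * (p : ℝ) ^ (ρ * m)) *
          (p : ℝ) ^ (-(zeta r ϑ - ν / 2))) := by gcongr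
      _ = _ := by ring
  rw [g1]
  linarith

end

/-! ### False rejections -/

section

variable {ϑ r φ γ A ω₀ q : ℝ}

/-- At an isolated index the slack dominates every error: the tail at the level
`√(2 ϑ log p) + w - err` is at most `κ p^{-ϑ}`, for every `κ > 0`. -/
lemma eventually_isolated_tail {α K c c₁ κ : ℝ} (hϑ₀ : 0 < ϑ) (hϑ₁ : ϑ < 1) (hr : ϑ < r)
    (hζ : zeta r ϑ ≤ ϑ) (hK : 1 ≤ K) (hc : 0 < c) (hc₁ : 0 < c₁) (hκ : 0 < κ) (m : ℕ) :
    ∀ᶠ p : ℕ in atTop,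
      0 ≤ 1 / 2 * tau r p + 1 / 2 * (tune₂ r ϑ α K p ^ 2 / tau r p) -
        cmpErr (tau r p) ((p : ℝ) ^ (-c)) ((p : ℝ) ^ (-c₁)) m ∧
      Real.exp (-((1 / 2 * tau r p + 1 / 2 * (tune₂ r ϑ α K p ^ 2 / tau r p) -
        cmpErr (tau r p) ((p : ℝ) ^ (-c)) ((p : ℝ) ^ (-c₁)) m) ^ 2 /
          (2 * (1 + (p : ℝ) ^ (-c) * ((m : ℝ) + 1) ^ 2)))) ≤ κ * (p : ℝ) ^ (-ϑ) := by
  have hr0 : 0 < r := hϑ₀.trans hr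
  have hb : 0 < Real.sqrt ϑ := Real.sqrt_pos.2 hϑ₀
  have hb1 : Real.sqrt ϑ ≤ 1 := Real.sqrt_le_one.2 hϑ₁.le
  filter_upwards [eventually_gt_atTop 0, eventually_tune₂ (α := α) hϑ₀ hr hζ hK,
    eventually_cmpErr_le hr0.le hc hc₁ m (show (0 : ℝ) < 1 / 2 by norm_num),
    tendsto_scale.eventually_ge_atTop (1 / Real.sqrt ϑ),
    tendsto_log_nat.eventually_ge_atTop (|Real.log κ|),
    (tendsto_slack r ϑ α hK).eventually_ge_atTop (|Real.log κ| + 2),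
    eventually_log_mul_rpow_neg_le (2 * ((m : ℝ) + 1) ^ 2) 1 hc one_pos]
    with p hp ht₂ hcmp hs hL hsl hh
  obtain ⟨hw0, hw1, hw, ht₂⟩ := ht₂
  obtain ⟨hs1, hcmp⟩ := hcmp
  have hp0 : (0 : ℝ) < p := by exact_mod_cast hp
  have hs2 := scale_sq hp
  have hτ : tau r p = Real.sqrt r * scale p := sqrt_eq_scale hr0.le p
  have hτ0 : 0 ≤ tau r p := Real.sqrt_nonneg _
  have herr0 := cmpErr_nonneg (m := m) hτ0 (by positivity : 0 ≤ (p : ℝ) ^ (-c))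
    (by positivity : 0 ≤ (p : ℝ) ^ (-c₁))
  set err := cmpErr (tau r p) ((p : ℝ) ^ (-c)) ((p : ℝ) ^ (-c₁)) m
  set w := excessLevel r ϑ α K p
  have hx : 1 / 2 * tau r p + 1 / 2 * (tune₂ r ϑ α K p ^ 2 / tau r p) - err =
      Real.sqrt ϑ * scale p + w - err := by
    rw [ht₂, hτ]; ring
  have herr : err ≤ 1 / 2 := (le_mul_of_one_le_right herr0 hs1).trans hcmp
  rw [div_le_iff₀ hb] at hs
  rw [hx]
  refine ⟨by linarith, ?_⟩
  set h := (p : ℝ) ^ (-c) * ((m : ℝ) + 1) ^ 2 with hhdef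
  have hh0 : 0 ≤ h := by positivity
  have hκ' := le_abs_self (-Real.log κ)
  rw [abs_neg] at hκ'
  have hLh : h * (ϑ * Real.log p - Real.log κ) ≤ 1 := by
    have h1 : ϑ * Real.log p ≤ Real.log p :=
      mul_le_of_le_one_left ((abs_nonneg _).trans hL) hϑ₁.le
    calc h * (ϑ * Real.log p - Real.log κ) ≤ h * (2 * Real.log p) := by
          gcongr; linarith
      _ = 2 * ((m : ℝ) + 1) ^ 2 * Real.log p ^ 1 * (p : ℝ) ^ (-c) := by rw [hhdef]; ring
      _ ≤ 1 := hh
  have hterm : (Real.sqrt ϑ * scale p + w) * err ≤ 5 / 8 := by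
    calc (Real.sqrt ϑ * scale p + w) * err ≤ (5 / 4 * scale p) * err := by
          gcongr
          have := mul_le_mul_of_nonneg_right hb1 (zero_le_one.trans hs1)
          linarith
      _ ≤ 5 / 8 := by linarith
  have hsq : 2 * (ϑ * Real.log p) + 2 * slack r ϑ α K p - 5 / 4 ≤
      (Real.sqrt ϑ * scale p + w - err) ^ 2 := by
    have e : (Real.sqrt ϑ * scale p + w - err) ^ 2 = Real.sqrt ϑ ^ 2 * scale p ^ 2 +
        2 * (Real.sqrt ϑ * scale p * w) + w ^ 2 - 2 * ((Real.sqrt ϑ * scale p + w) * err) +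
        err ^ 2 := by ring
    rw [e, hw, hs2, Real.sq_sqrt hϑ₀.le]
    linarith [sq_nonneg w, sq_nonneg err]
  have hκp : κ * (p : ℝ) ^ (-ϑ) = Real.exp (Real.log κ + Real.log p * -ϑ) := by
    rw [Real.exp_add, Real.exp_log hκ, Real.rpow_def_of_pos hp0]
  rw [hκp, Real.exp_le_exp, neg_le, le_div_iff₀ (by positivity)]
  linarith

/-- Sets of `s ≥ 2` indices have a polynomially smaller tail: their quadratic form `V` satisfies
`V ≥ 2 - 2 ω₀ > 1`. -/
lemma eventually_larger_set_tail {α K c c₁ y G : ℝ} (hϑ₀ : 0 < ϑ) (hr : ϑ < r)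
    (hζ : zeta r ϑ ≤ ϑ) (hω₀ : 0 < ω₀) (hω₁ : ω₀ < 1 / 2) (hK : 1 ≤ K) (hc : 0 < c) (hc₁ : 0 < c₁)
    (hy : y = Real.sqrt ϑ + 1 / 2 * Real.sqrt r * (Real.sqrt (2 - 2 * ω₀) - 1)) (hG : 0 < G)
    (hyG : y ^ 2 - ϑ = 2 * G) (m : ℕ) :
    ∀ᶠ p : ℕ in atTop, ∀ s : ℕ, 2 ≤ s → ∀ V : ℝ, |V - s| ≤ 2 * ω₀ * (s - 1) →
      0 ≤ 1 / 2 * tau r p * V + 1 / 2 * (tune₂ r ϑ α K p ^ 2 / tau r p) * s -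
        cmpErr (tau r p) ((p : ℝ) ^ (-c)) ((p : ℝ) ^ (-c₁)) m ∧
      Real.exp (-((1 / 2 * tau r p * V + 1 / 2 * (tune₂ r ϑ α K p ^ 2 / tau r p) * s -
        cmpErr (tau r p) ((p : ℝ) ^ (-c)) ((p : ℝ) ^ (-c₁)) m) ^ 2 /
          (2 * (V + (p : ℝ) ^ (-c) * ((m : ℝ) + 1) ^ 2)))) ≤ (p : ℝ) ^ (-(ϑ + G)) := by
  have hr0 : 0 < r := hϑ₀.trans hr
  have hb : 0 < Real.sqrt ϑ := Real.sqrt_pos.2 hϑ₀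
  have hab : Real.sqrt r ≤ 2 * Real.sqrt ϑ := by
    have : Real.sqrt r - Real.sqrt ϑ ≤ Real.sqrt ϑ := Real.le_sqrt_of_sq_le hζ
    linarith
  have hy0 : 0 < y := by
    have : 1 ≤ Real.sqrt (2 - 2 * ω₀) := Real.one_le_sqrt.2 (by linarith)
    have : 0 ≤ 1 / 2 * Real.sqrt r * (Real.sqrt (2 - 2 * ω₀) - 1) :=
      mul_nonneg (by positivity) (by linarith)
    linarith
  have hh0 : ∀ p : ℕ, 0 ≤ (p : ℝ) ^ (-c) * ((m : ℝ) + 1) ^ 2 := fun p => by positivity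
  have hh : ∀ ε : ℝ, 0 < ε → ∀ᶠ p : ℕ in atTop, (p : ℝ) ^ (-c) * ((m : ℝ) + 1) ^ 2 ≤ ε := by
    intro ε hε
    filter_upwards [eventually_mul_rpow_neg_le (((m : ℝ) + 1) ^ 2) hc hε] with p hp
    linarith
  filter_upwards [eventually_gt_atTop 0, eventually_tune₂ (α := α) hϑ₀ hr hζ hK,
    eventually_tail_exponent hy0 hG hh0 hh,
    eventually_cmpErr_le hr0.le hc hc₁ m (show (0 : ℝ) < 1 / 2 by norm_num)]
    with p hp ht₂ htail hcmp s hs V hV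
  obtain ⟨hw0, hw1, -, ht₂⟩ := ht₂
  obtain ⟨hs1, hcmp⟩ := hcmp
  obtain ⟨hys, htail⟩ := htail
  have hs0 : 0 < scale p := by linarith
  have hτ : tau r p = Real.sqrt r * scale p := sqrt_eq_scale hr0.le p
  have hτ0 : 0 ≤ tau r p := Real.sqrt_nonneg _
  have herr0 := cmpErr_nonneg (m := m) hτ0 (by positivity : 0 ≤ (p : ℝ) ^ (-c))
    (by positivity : 0 ≤ (p : ℝ) ^ (-c₁))
  set err := cmpErr (tau r p) ((p : ℝ) ^ (-c)) ((p : ℝ) ^ (-c₁)) m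
  set w := excessLevel r ϑ α K p
  have herr : err ≤ 1 / 2 := (le_mul_of_one_le_right herr0 hs1).trans hcmp
  have hs' : (2 : ℝ) ≤ s := by exact_mod_cast hs
  obtain ⟨hV1, hV2⟩ := abs_le.1 hV
  have hVlow : 2 - 2 * ω₀ ≤ V := by
    have : 0 ≤ (1 - 2 * ω₀) * ((s : ℝ) - 2) := mul_nonneg (by linarith) (by linarith)
    linarith
  have hV0 : 0 < V := by linarith
  have hVup : V ≤ (s : ℝ) ^ 2 := by
    have h1 : 0 ≤ (1 - 2 * ω₀) * ((s : ℝ) - 1) := mul_nonneg (by linarith) (by linarith)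
    linarith [sq_nonneg ((s : ℝ) - 1)]
  have hsqV : Real.sqrt V ^ 2 = V := Real.sq_sqrt hV0.le
  have hsV1 : 1 ≤ Real.sqrt V := Real.one_le_sqrt.2 (by linarith)
  have hsV2 : Real.sqrt (2 - 2 * ω₀) ≤ Real.sqrt V := Real.sqrt_le_sqrt hVlow
  have hsVs : Real.sqrt V ≤ s := Real.sqrt_le_iff.2 ⟨by linarith, hVup⟩
  have hx : Real.sqrt V * (y * scale p - 1) ≤
      1 / 2 * tau r p * V + 1 / 2 * (tune₂ r ϑ α K p ^ 2 / tau r p) * s - err := by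
    rw [ht₂, hτ]
    have h0 : 0 ≤ (Real.sqrt ϑ - 1 / 2 * Real.sqrt r) * scale p :=
      mul_nonneg (by linarith) hs0.le
    have h1 : (Real.sqrt ϑ - 1 / 2 * Real.sqrt r) * scale p * Real.sqrt V ≤
        (Real.sqrt ϑ - 1 / 2 * Real.sqrt r) * scale p * s := mul_le_mul_of_nonneg_left hsVs h0
    have h2 : 1 / 2 * Real.sqrt r * scale p * (Real.sqrt (2 - 2 * ω₀) * Real.sqrt V) ≤
        1 / 2 * Real.sqrt r * scale p * V := by
      apply mul_le_mul_of_nonneg_left _ (by positivity)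
      calc _ ≤ Real.sqrt V * Real.sqrt V := by gcongr
        _ = V := by rw [← sq, hsqV]
    have h3 : 0 ≤ w * s := by positivity
    rw [hy]
    linarith
  refine ⟨le_trans (mul_nonneg (by linarith) (by linarith)) hx, exp_neg_le_rpow_neg hp ?_⟩
  have hexp : ϑ + G = y ^ 2 - G := by linarith
  rw [hexp]
  refine htail.trans (tail_exponent_le (by linarith) (by linarith) (hh0 p)
    (by linarith [hh0 p]) hx ?_)
  rw [hsqV]
  linarith [le_mul_of_one_le_left (hh0 p) (show 1 ≤ V by linarith)]

/-- The conditions under which a signal that is isolated in the ball of a null index prevents the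
rejection of that index. -/
lemma eventually_isolated_signal {c c₁ ε : ℝ} (hϑ₀ : 0 < ϑ) (hr : ϑ < r) (hω₁ : ω₀ < 1 / 2)
    (hq₀ : 0 < q) (hqϑ : q ≤ ϑ) (hc : 0 < c) (hc₁ : 0 < c₁) (m : ℕ)
    (hε₁ : (m + 1) * ε ≤ (1 / 2 - ω₀) / 4) (hε₂ : ε * Real.sqrt r ≤ Real.sqrt q / 4)
    (hε₃ : ε * Real.sqrt r ≤ (Real.sqrt r - Real.sqrt q) / 4) :
    ∀ᶠ p : ℕ in atTop, (p : ℝ) ^ (-c) ≤ (Real.log p ^ 2)⁻¹ →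
      (p : ℝ) ^ (-c₁) ≤ tune₁ q p / 4 →
      2 * ((Real.log p ^ 2)⁻¹ + (p : ℝ) ^ (-c)) * tau r p + (p : ℝ) ^ (-c₁) + ε * tau r p ≤
        tune₁ q p ∧
      tune₁ q p < tau r p - (p : ℝ) ^ (-c₁) - ε * tau r p ∧
      cmpErr (tau r p) ((p : ℝ) ^ (-c)) ((p : ℝ) ^ (-c₁) + ε * tau r p) m <
        (1 / 2 - ω₀) * tau r p := by
  have hr0 : 0 < r := hϑ₀.trans hr
  have ha : 0 < Real.sqrt r := Real.sqrt_pos.2 hr0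
  have hsq : 0 < Real.sqrt q := Real.sqrt_pos.2 hq₀
  have hqr : 0 < Real.sqrt r - Real.sqrt q := sub_pos.2 (Real.sqrt_lt_sqrt hq₀.le (by linarith))
  have hω' : 0 < 1 / 2 - ω₀ := by linarith
  filter_upwards [eventually_gt_atTop 0,
    eventually_cmpErr_le hr0.le hc hc₁ m (show (0 : ℝ) < 1 / 2 by norm_num),
    tendsto_scale.eventually_ge_atTop (4 / (Real.sqrt r - Real.sqrt q)),
    tendsto_scale.eventually_ge_atTop (1 / ((1 / 2 - ω₀) * Real.sqrt r)),
    tendsto_log_nat.eventually_ge_atTop 1,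
    tendsto_log_nat.eventually_ge_atTop (8 * Real.sqrt r / Real.sqrt q)]
    with p hp hcmp hs₁ hs₂ hL1 hL hd he
  obtain ⟨hs1, hcmp⟩ := hcmp
  have hs0 : 0 < scale p := by linarith
  have hτ : tau r p = Real.sqrt r * scale p := sqrt_eq_scale hr0.le p
  have ht₁ : tune₁ q p = Real.sqrt q * scale p := sqrt_eq_scale hq₀.le p
  have hτ0 : 0 ≤ tau r p := Real.sqrt_nonneg _
  have he0 : 0 ≤ (p : ℝ) ^ (-c₁) := by positivity
  have hd0 : 0 ≤ (p : ℝ) ^ (-c) := by positivity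
  have hadd : cmpErr (tau r p) ((p : ℝ) ^ (-c)) ((p : ℝ) ^ (-c₁) + ε * tau r p) m =
      cmpErr (tau r p) ((p : ℝ) ^ (-c)) ((p : ℝ) ^ (-c₁)) m + (m + 1) * ε * tau r p := by
    unfold cmpErr; ring
  have herr0 := cmpErr_nonneg (m := m) hτ0 hd0 he0
  have hee : (p : ℝ) ^ (-c₁) ≤ cmpErr (tau r p) ((p : ℝ) ^ (-c)) ((p : ℝ) ^ (-c₁)) m := by
    unfold cmpErr
    have h1 : 0 ≤ 1 / 2 * tau r p * ((p : ℝ) ^ (-c) * ((m : ℝ) ^ 2 + 1)) := by positivity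
    have h2 : 0 ≤ (m : ℝ) * (p : ℝ) ^ (-c₁) := by positivity
    linarith
  rw [hadd]
  set err := cmpErr (tau r p) ((p : ℝ) ^ (-c)) ((p : ℝ) ^ (-c₁)) m
  have herr : err ≤ 1 / 2 := (le_mul_of_one_le_right herr0 hs1).trans hcmp
  have h2 := mul_le_mul_of_nonneg_right hε₂ hs0.le
  have h3 := mul_le_mul_of_nonneg_right hε₃ hs0.le
  have h1 := mul_le_mul_of_nonneg_right hε₁ (mul_nonneg ha.le hs0.le)
  rw [div_le_iff₀' hqr] at hs₁
  rw [div_le_iff₀' (by positivity)] at hs₂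
  rw [div_le_iff₀' hsq] at hL
  refine ⟨?_, ?_, ?_⟩
  · have h4 : (Real.log p ^ 2)⁻¹ * (8 * Real.sqrt r) ≤ Real.sqrt q := by
      rw [inv_mul_le_iff₀ (by positivity)]
      calc 8 * Real.sqrt r ≤ Real.sqrt q * Real.log p := hL
        _ ≤ Real.sqrt q * Real.log p ^ 2 := by
          gcongr; exact le_self_pow₀ hL1 (by norm_num)
        _ = _ := by ring
    have h5 := mul_le_mul_of_nonneg_right h4 hs0.le
    have h6 : 2 * ((Real.log p ^ 2)⁻¹ + (p : ℝ) ^ (-c)) * tau r p ≤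
        2 * ((Real.log p ^ 2)⁻¹ + (Real.log p ^ 2)⁻¹) * tau r p := by gcongr
    rw [ht₁] at he ⊢
    rw [hτ] at h6 ⊢
    linarith
  · rw [ht₁, hτ]
    linarith
  · rw [hτ]
    have h7 : 0 < (1 / 2 - ω₀) * Real.sqrt r * scale p := by positivity
    linarith

set_option maxHeartbeats 1000000 in
/-- A null index is rejected with probability `o(p^{-ϑ})`. -/
lemma eventually_false_positive
    (hϑ₀ : 0 < ϑ) (hϑ₁ : ϑ < 1) (hr : ϑ < r) (hζ : zeta r ϑ ≤ ϑ) (hφ₀ : 1 - ϑ < φ)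
    (hγ₀ : 0 < γ) (hγ₁ : γ < 1) (hA : 0 < A) (hω₀ : 0 < ω₀) (hω₁ : ω₀ < 1 / 2) (hq₀ : 0 < q)
    (hq : q ≤ (r + ϑ - zeta r ϑ) ^ 2 / (4 * r)) {K α : ℝ} (hK : 1 ≤ K) {κ : ℝ} (hκ : 0 < κ) :
    ∀ᶠ p : ℕ in atTop, ∀ n : ℕ, |(n : ℝ) - (p : ℝ) ^ φ| < 1 →
      ∀ Ω : Matrix (Fin p) (Fin p) ℝ, CorrelationClass γ A ω₀ Ω →
      ∀ h₁ : Measure ℝ, IsProbabilityMeasure h₁ →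
        h₁ (Set.Icc (tau r p) ((1 + eta r ϑ ω₀) * tau r p))ᶜ = 0 →
      ∀ est : Design n p × (Fin n → ℝ) → Fin p → ℝ,
        IsProcedure (tune₁ q p) (tune₂ r ϑ α K p) (tau r p) est →
      ∀ i, (modelLaw n ϑ Ω h₁).real {ω | ω.2.1 i = 0 ∧ est (ω.1, response ω) i ≠ 0} ≤
        κ * (p : ℝ) ^ (-ϑ) := by
  have hr0 : 0 < r := hϑ₀.trans hr
  have ha : 0 < Real.sqrt r := Real.sqrt_pos.2 hr0
  have hb : 0 < Real.sqrt ϑ := Real.sqrt_pos.2 hϑ₀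
  have hsq : 0 < Real.sqrt q := Real.sqrt_pos.2 hq₀
  have hqϑ := q_le hϑ₀ hr hq
  have hqr : 0 < Real.sqrt r - Real.sqrt q := sub_pos.2 (Real.sqrt_lt_sqrt hq₀.le (by linarith))
  have hω' : 0 < 1 / 2 - ω₀ := by linarith
  obtain ⟨m, m', k₀, c, ρ₀, hc, hρ₀, H⟩ :=
    exists_regime (φ := φ) hϑ₀ hϑ₁ hr hφ₀ hγ₀ hγ₁ hA hω₀ hω₁ hq₀
  -- `2 G` is the polynomial gain of sets with at least two elements
  set y := Real.sqrt ϑ + 1 / 2 * Real.sqrt r * (Real.sqrt (2 - 2 * ω₀) - 1) with hy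
  have hyϑ : Real.sqrt ϑ < y := by
    have : 1 < Real.sqrt (2 - 2 * ω₀) := by
      rw [Real.lt_sqrt (by norm_num)]; linarith
    have : 0 < 1 / 2 * Real.sqrt r * (Real.sqrt (2 - 2 * ω₀) - 1) :=
      mul_pos (by positivity) (by linarith)
    linarith
  obtain ⟨G, hyG⟩ : ∃ G, y ^ 2 - ϑ = 2 * G := ⟨(y ^ 2 - ϑ) / 2, by ring⟩
  have hG : 0 < G := by
    have := pow_lt_pow_left₀ hyϑ hb.le (two_ne_zero)
    rw [Real.sq_sqrt hϑ₀.le] at this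
    linarith
  -- the size of the noise relative to the signals that the comparison tolerates
  set ε := min ((1 / 2 - ω₀) / (4 * (m + 1)))
    (min (Real.sqrt q / (4 * Real.sqrt r)) ((Real.sqrt r - Real.sqrt q) / (4 * Real.sqrt r)))
    with hεdef
  have hε : 0 < ε := by positivity
  have hε₁ : (m + 1) * ε ≤ (1 / 2 - ω₀) / 4 := by
    calc (m + 1) * ε ≤ (m + 1) * ((1 / 2 - ω₀) / (4 * (m + 1))) := by
          gcongr; exact min_le_left _ _
      _ = _ := by field_simp
  have hε₂ : ε * Real.sqrt r ≤ Real.sqrt q / 4 := by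
    calc ε * Real.sqrt r ≤ Real.sqrt q / (4 * Real.sqrt r) * Real.sqrt r := by
          gcongr; exact (min_le_right _ _).trans (min_le_left _ _)
      _ = _ := by field_simp
  have hε₃ : ε * Real.sqrt r ≤ (Real.sqrt r - Real.sqrt q) / 4 := by
    calc ε * Real.sqrt r ≤ (Real.sqrt r - Real.sqrt q) / (4 * Real.sqrt r) * Real.sqrt r := by
          gcongr; exact (min_le_right _ _).trans (min_le_right _ _)
      _ = _ := by field_simp
  set ρ := min ρ₀ (min (ϑ / 4) (min (ε ^ 2 * r / 8) (G / (2 * (m + 1))))) with hρ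
  have hρ0 : 0 < ρ := by positivity
  have hρ₁ : ρ ≤ ϑ / 4 := (min_le_right _ _).trans (min_le_left _ _)
  have hρ₂ : ρ ≤ ε ^ 2 * r / 8 :=
    (min_le_right _ _).trans ((min_le_right _ _).trans (min_le_left _ _))
  have hρ₃ : ρ * (m + 1) ≤ G / 2 := by
    calc ρ * (m + 1) ≤ G / (2 * (m + 1)) * (m + 1) := by
          gcongr
          exact (min_le_right _ _).trans ((min_le_right _ _).trans (min_le_right _ _))
      _ = G / 2 := by field_simp
  have hε2 : 0 < ε ^ 2 * r := by positivity
  obtain ⟨c₁, hc₁, Hp⟩ := H ρ hρ0 (min_le_left _ _)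
  filter_upwards [Hp, eventually_gt_atTop 1, tendsto_log_nat.eventually_ge_atTop 0,
    eventually_isolated_signal (ω₀ := ω₀) hϑ₀ hr hω₁ hq₀ hqϑ hc hc₁ m hε₁ hε₂ hε₃,
    eventually_isolated_tail (α := α) hϑ₀ hϑ₁ hr hζ hK hc hc₁ (show 0 < κ / 5 by positivity) m,
    eventually_larger_set_tail (α := α) hϑ₀ hr hζ hω₀ hω₁ hK hc hc₁ hy hG hyG m,
    eventually_mul_rpow_le (5 / κ) (show (-2 : ℝ) < -ϑ by linarith),
    eventually_mul_rpow_le (5 / κ) (show ρ * 2 + -ϑ * 2 < -ϑ by linarith),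
    eventually_mul_rpow_le (5 / κ * 2) (show ρ * 2 + (-ϑ + -(ε ^ 2 * r / 2)) < -ϑ by linarith),
    eventually_mul_rpow_le (5 / κ * (m + 1)) (show ρ * m + -(ϑ + G) < -ϑ by linarith)]
    with p hreg hp1 hL hsig htail₁ htail₂ f1 f2 f3 f4 n hn Ω hΩ h₁ hh₁ hsupp est hest i
  obtain ⟨t, δ, R, hR, hbad⟩ := hreg n hn
  have hp : 0 < p := by omega
  have hp0 : (0 : ℝ) < p := by exact_mod_cast hp
  have hp1' : (1 : ℝ) < p := by exact_mod_cast hp1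
  have hτ : tau r p = Real.sqrt r * scale p := sqrt_eq_scale hr0.le p
  have htd := hR.td_le
  have htpos := hR.t_pos
  have hd := hR.d_pos
  obtain ⟨hlow, hsurv, hgap⟩ := hsig (by linarith) hR.e_le
  have hE3 : Real.exp (-((ε * tau r p) ^ 2 / (2 * (1 + (p : ℝ) ^ (-c))))) ≤
      (p : ℝ) ^ (-(ε ^ 2 * r / 2)) := by
    apply exp_neg_le_rpow_neg hp
    have hd1 : (p : ℝ) ^ (-c) ≤ 1 := Real.rpow_le_one_of_one_le_of_nonpos hp1'.le (by linarith)
    rw [le_div_iff₀ (by positivity), hτ, mul_pow, mul_pow,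
      Real.sq_sqrt hr0.le, scale_sq hp]
    have h1 : 0 ≤ ε ^ 2 * r * Real.log p := by positivity
    linarith [mul_le_mul_of_nonneg_left hd1 h1]
  have key := hR.false_positive_le hΩ hsupp hest i hε.le hlow hsurv hgap htail₁.1 htail₁.2
    (fun s _ hs V hV => htail₂ s hs V hV) (by positivity) hE3
  refine key.trans ?_
  have g2 : ((p : ℝ) ^ ρ) ^ 2 * dens ϑ p ^ 2 = (p : ℝ) ^ (ρ * 2 + -ϑ * 2) := by
    rw [dens, ← Real.rpow_natCast, ← Real.rpow_natCast, ← Real.rpow_mul hp0.le,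
      ← Real.rpow_mul hp0.le, ← Real.rpow_add hp0]
    norm_num
  have g3 : ((p : ℝ) ^ ρ) ^ 2 * (2 * (dens ϑ p * (p : ℝ) ^ (-(ε ^ 2 * r / 2)))) =
      2 * (p : ℝ) ^ (ρ * 2 + (-ϑ + -(ε ^ 2 * r / 2))) := by
    rw [dens, Real.rpow_add hp0, Real.rpow_add hp0, ← Real.rpow_natCast, ← Real.rpow_mul hp0.le]
    push_cast
    ring
  have g4 : ((m : ℝ) + 1) * ((p : ℝ) ^ ρ) ^ m * (p : ℝ) ^ (-(ϑ + G)) =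
      (m + 1) * (p : ℝ) ^ (ρ * m + -(ϑ + G)) := by
    rw [Real.rpow_add hp0, ← Real.rpow_natCast, ← Real.rpow_mul hp0.le]
    ring
  rw [g2, g3, g4]
  have hscale : ∀ x C : ℝ, 5 / κ * C * x ≤ (p : ℝ) ^ (-ϑ) → C * x ≤ κ / 5 * (p : ℝ) ^ (-ϑ) := by
    intro x C hx
    calc C * x = κ / 5 * (5 / κ * C * x) := by field_simp
      _ ≤ _ := by gcongr
  have k1 := hscale ((p : ℝ) ^ (-2 : ℝ)) 1 (by rw [mul_one]; exact f1)
  have k2 := hscale ((p : ℝ) ^ (ρ * 2 + -ϑ * 2)) 1 (by rw [mul_one]; exact f2)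
  have k3 := hscale _ _ f3
  have k4 := hscale _ _ f4
  linarith

end

/-! ### Error rates from the errors at single indices -/

section

variable {n p : ℕ}

lemma measurable_response : Measurable (response (n := n) (p := p)) := by
  refine measurable_pi_iff.2 fun k => ?_
  simp only [response, designMatrix, Pi.add_apply, Matrix.mulVec, dotProduct, Matrix.of_apply]
  fun_prop

lemma measurable_decision {est : Design n p × (Fin n → ℝ) → Fin p → ℝ} (hest : Measurable est)
    (i : Fin p) : Measurable fun ω => decision est ω i :=
  measurable_ind.comp ((measurable_pi_apply i).comp
    (hest.comp (measurable_fst.prodMk measurable_response)))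

lemma measurable_theta (i : Fin p) : Measurable fun ω => theta (n := n) ω i :=
  measurable_ind.comp ((measurable_pi_apply i).comp (measurable_fst.comp measurable_snd))

lemma theta_eq_indicator (i : Fin p) :
    (fun ω => theta (n := n) ω i) = Set.indicator {ω | ω.2.1 i ≠ 0} 1 := by
  ext ω
  by_cases h : ω.2.1 i = 0 <;> simp [theta, ind, h]

lemma one_sub_theta_mul_decision_eq_indicator (est : Design n p × (Fin n → ℝ) → Fin p → ℝ)
    (i : Fin p) : (fun ω => (1 - theta ω i) * decision est ω i) =
      Set.indicator {ω | ω.2.1 i = 0 ∧ est (ω.1, response ω) i ≠ 0} 1 := by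
  ext ω
  by_cases h : ω.2.1 i = 0 <;> by_cases h' : est (ω.1, response ω) i = 0 <;>
    simp [theta, decision, ind, h, h']

lemma theta_mul_one_sub_decision_eq_indicator (est : Design n p × (Fin n → ℝ) → Fin p → ℝ)
    (i : Fin p) : (fun ω => theta ω i * (1 - decision est ω i)) =
      Set.indicator {ω | ω.2.1 i ≠ 0 ∧ est (ω.1, response ω) i = 0} 1 := by
  ext ω
  by_cases h : ω.2.1 i = 0 <;> by_cases h' : est (ω.1, response ω) i = 0 <;>
    simp [theta, decision, ind, h, h']

lemma ind_mem_Icc (x : ℝ) : ind x ∈ Set.Icc (0 : ℝ) 1 := by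
  unfold ind; split_ifs <;> simp

/-- The rates in terms of the errors at single indices: each index is a signal with probability `π`,
falsely rejected with probability at most `a` and missed with probability at most `b`. At least half
of the signals are rejected on average, and at least half of all hypotheses are accepted. -/
lemma rates_le {μ : Measure (Design n p × (Fin p → ℝ) × (Fin n → ℝ))} [IsProbabilityMeasure μ]
    {est : Design n p × (Fin n → ℝ) → Fin p → ℝ} (hest : Measurable est) (hp : 0 < p)
    {π a b : ℝ} (hS : ∀ i : Fin p, μ.real {ω | ω.2.1 i ≠ 0} = π)
    (hFP : ∀ i, μ.real {ω | ω.2.1 i = 0 ∧ est (ω.1, response ω) i ≠ 0} ≤ a)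
    (hFN : ∀ i, μ.real {ω | ω.2.1 i ≠ 0 ∧ est (ω.1, response ω) i = 0} ≤ b)
    (hπ : 0 < π) (hb : b ≤ π / 2) (ha : π + a ≤ 1 / 2) :
    0 < expRejections μ est ∧ 0 < expAcceptances μ est ∧
      mFDR μ est ≤ 2 * (a / π) ∧ mFNR μ est ≤ 2 * b := by
  have hp0 : (0 : ℝ) < p := by exact_mod_cast hp
  have hbdd : ∀ {f : Design n p × (Fin p → ℝ) × (Fin n → ℝ) → ℝ}, Measurable f →
      (∀ ω, f ω ∈ Set.Icc (0 : ℝ) 1) → Integrable f μ := fun hf h =>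
    Integrable.of_bound hf.aestronglyMeasurable 1 (ae_of_all _ fun ω => by
      rw [Real.norm_eq_abs, abs_of_nonneg (h ω).1]; exact (h ω).2)
  have hθ : ∀ i, Integrable (fun ω => theta (n := n) ω i) μ := fun i =>
    hbdd (measurable_theta i) fun ω => ind_mem_Icc _
  have hδ : ∀ i, Integrable (fun ω => decision est ω i) μ := fun i =>
    hbdd (measurable_decision hest i) fun ω => ind_mem_Icc _
  have hmem : ∀ x y : ℝ, (1 - ind x) * ind y ∈ Set.Icc (0 : ℝ) 1 ∧
      ind x * (1 - ind y) ∈ Set.Icc (0 : ℝ) 1 := fun x y => by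
    unfold ind; split_ifs <;> simp
  have hfp : ∀ i, Integrable (fun ω => (1 - theta ω i) * decision est ω i) μ := fun i =>
    hbdd ((measurable_const.sub (measurable_theta i)).mul (measurable_decision hest i))
      fun ω => (hmem _ _).1
  have hfn : ∀ i, Integrable (fun ω => theta ω i * (1 - decision est ω i)) μ := fun i =>
    hbdd ((measurable_theta i).mul (measurable_const.sub (measurable_decision hest i)))
      fun ω => (hmem _ _).2
  have mθ : ∀ i : Fin p, MeasurableSet {ω : Design n p × (Fin p → ℝ) × (Fin n → ℝ) |
      ω.2.1 i = 0} := fun i =>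
    measurableSet_eq_fun ((measurable_pi_apply i).comp (measurable_fst.comp measurable_snd))
      measurable_const
  have mδ : ∀ i : Fin p, MeasurableSet {ω : Design n p × (Fin p → ℝ) × (Fin n → ℝ) |
      est (ω.1, response ω) i = 0} := fun i =>
    measurableSet_eq_fun ((measurable_pi_apply i).comp
      (hest.comp (measurable_fst.prodMk measurable_response))) measurable_const
  have iθ : ∀ i, ∫ ω, theta (n := n) ω i ∂μ = π := fun i => by
    rw [theta_eq_indicator, integral_indicator_one]
    · exact hS i
    · exact (mθ i).compl
  have ifp : ∀ i, ∫ ω, (1 - theta ω i) * decision est ω i ∂μ ≤ a := fun i => by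
    rw [one_sub_theta_mul_decision_eq_indicator, integral_indicator_one]
    · exact hFP i
    · exact (mθ i).inter (mδ i).compl
  have ifn : ∀ i, ∫ ω, theta ω i * (1 - decision est ω i) ∂μ ≤ b := fun i => by
    rw [theta_mul_one_sub_decision_eq_indicator, integral_indicator_one]
    · exact hFN i
    · exact (mθ i).compl.inter (mδ i)
  -- `δ = θ + (1 - θ) δ - θ (1 - δ)`
  have iδ : ∀ i, ∫ ω, decision est ω i ∂μ = π + ∫ ω, (1 - theta ω i) * decision est ω i ∂μ -
      ∫ ω, theta ω i * (1 - decision est ω i) ∂μ := fun i => by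
    rw [← iθ i, ← integral_add (hθ i) (hfp i),
      ← integral_sub (f := fun ω => theta ω i + (1 - theta ω i) * decision est ω i)
        ((hθ i).add (hfp i)) (hfn i)]
    congr 1; ext ω; ring
  have nfp : ∀ i, 0 ≤ ∫ ω, (1 - theta ω i) * decision est ω i ∂μ := fun i =>
    integral_nonneg fun ω => (hmem _ _).1.1
  have nfn : ∀ i, 0 ≤ ∫ ω, theta ω i * (1 - decision est ω i) ∂μ := fun i =>
    integral_nonneg fun ω => (hmem _ _).2.1
  have hsum : ∀ {f : Fin p → ℝ} {x : ℝ}, (∀ i, f i ≤ x) → ∑ i, f i ≤ p * x := fun h => by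
    refine (Finset.sum_le_sum fun i _ => h i).trans_eq ?_
    simp
  have hsum' : ∀ {f : Fin p → ℝ} {x : ℝ}, (∀ i, x ≤ f i) → p * x ≤ ∑ i, f i := fun h => by
    refine le_of_eq_of_le ?_ (Finset.sum_le_sum fun i _ => h i)
    simp
  have hrej : p * (π / 2) ≤ expRejections μ est := by
    unfold expRejections
    rw [integral_finsetSum _ fun i _ => hδ i]
    exact hsum' fun i => by rw [iδ i]; linarith [nfp i, ifn i]
  have hacc : p * (1 / 2) ≤ expAcceptances μ est := by
    unfold expAcceptances
    have h1 : ∀ i, Integrable (fun ω => 1 - decision est ω i) μ := fun i =>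
      (integrable_const 1).sub (hδ i)
    rw [integral_finsetSum _ fun i _ => h1 i]
    refine hsum' fun i => ?_
    rw [integral_sub (integrable_const 1) (hδ i), iδ i]
    simp only [integral_const, probReal_univ, smul_eq_mul, mul_one]
    linarith [nfn i, ifp i]
  have ha0 : 0 ≤ a := (nfp ⟨0, hp⟩).trans (ifp _)
  have hb0 : 0 ≤ b := (nfn ⟨0, hp⟩).trans (ifn _)
  have hrej0 : 0 < expRejections μ est := lt_of_lt_of_le (by positivity) hrej
  have hacc0 : 0 < expAcceptances μ est := lt_of_lt_of_le (by positivity) hacc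
  refine ⟨hrej0, hacc0, ?_, ?_⟩
  · unfold mFDR
    rw [div_le_iff₀ hrej0, integral_finsetSum _ fun i _ => hfp i]
    calc _ ≤ p * a := hsum ifp
      _ = 2 * (a / π) * (p * (π / 2)) := by field_simp
      _ ≤ _ := by gcongr
  · unfold mFNR
    rw [div_le_iff₀ hacc0, integral_finsetSum _ fun i _ => hfn i]
    calc _ ≤ p * b := hsum ifn
      _ = 2 * b * (p * (1 / 2)) := by ring
      _ ≤ _ := by gcongr

end

/-! ### Multi-log terms -/

/-- A property that holds eventually at every level `p^ν`, `ν > 0`, and is monotone in the level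
holds eventually at a multi-log level. -/
lemma exists_isMultiLog {R : ℕ → ℝ → Prop} (hmono : ∀ p x y, x ≤ y → R p x → R p y)
    (hR : ∀ ν : ℝ, 0 < ν → ∀ᶠ p : ℕ in atTop, R p ((p : ℝ) ^ ν)) :
    ∃ L : ℕ → ℝ, IsMultiLog L ∧ ∀ᶠ p in atTop, R p (L p) := by
  -- the infimum of the admissible exponents tends to zero
  set N : ℕ → Set ℝ := fun p => {ν | 0 ≤ ν ∧ R p ((p : ℝ) ^ ν)} with hN
  set f : ℕ → ℝ := fun p => sInf (N p) + 1 / (p : ℝ) with hf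
  have hbdd : ∀ p, BddBelow (N p) := fun p => ⟨0, fun ν hν => hν.1⟩
  have h0 : ∀ p, 0 ≤ sInf (N p) := fun p => Real.sInf_nonneg fun ν hν => hν.1
  have hf0 : ∀ p, 0 ≤ f p := fun p => add_nonneg (h0 p) (by positivity)
  have hlim : ∀ ν : ℝ, 0 < ν → ∀ᶠ p in atTop, f p ≤ ν := by
    intro ν hν
    filter_upwards [hR (ν / 2) (by positivity),
      (tendsto_const_div_atTop_nhds_zero_nat (1 : ℝ)).eventually_le_const
        (show (0 : ℝ) < ν / 2 by positivity)] with p h1 h2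
    have := csInf_le (hbdd p) (show ν / 2 ∈ N p from ⟨by positivity, h1⟩)
    simp only [hf]
    linarith
  refine ⟨fun p => if p = 0 then 1 else (p : ℝ) ^ f p, ⟨?_, ?_, ?_⟩, ?_⟩
  · intro p
    split_ifs with h
    · exact one_pos
    · exact Real.rpow_pos_of_pos (by exact_mod_cast Nat.pos_of_ne_zero h) _
  · intro ϰ hϰ
    refine tendsto_atTop_mono' _ ?_ ((tendsto_rpow_atTop hϰ).comp tendsto_natCast_atTop_atTop)
    filter_upwards [eventually_gt_atTop 0] with p hp
    have hp1 : (1 : ℝ) ≤ p := by exact_mod_cast hp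
    rw [if_neg hp.ne']
    exact le_mul_of_one_le_left (Real.rpow_nonneg p.cast_nonneg _) (Real.one_le_rpow hp1 (hf0 p))
  · intro ϰ hϰ
    refine squeeze_zero' (Eventually.of_forall fun p => mul_nonneg ?_ ?_) ?_
      ((tendsto_rpow_neg_atTop (half_pos hϰ)).comp tendsto_natCast_atTop_atTop)
    · split_ifs
      · exact zero_le_one
      · exact Real.rpow_nonneg p.cast_nonneg _
    · exact Real.rpow_nonneg p.cast_nonneg _
    · filter_upwards [eventually_gt_atTop 0, hlim (ϰ / 2) (by positivity)] with p hp h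
      have hp0 : (0 : ℝ) < p := by exact_mod_cast hp
      have hp1 : (1 : ℝ) ≤ p := by exact_mod_cast hp
      rw [if_neg hp.ne', ← Real.rpow_add hp0]
      exact Real.rpow_le_rpow_of_exponent_le hp1 (by linarith)
  · filter_upwards [eventually_gt_atTop 0, hR 1 one_pos] with p hp h1
    have hp1 : (1 : ℝ) ≤ p := by exact_mod_cast hp
    have hp0 : (0 : ℝ) < p := by linarith
    rw [if_neg hp.ne']
    obtain ⟨ν, hν, hνf⟩ := exists_lt_of_csInf_lt (⟨1, zero_le_one, h1⟩ : (N p).Nonempty)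
      (show sInf (N p) < f p by simp only [hf]; linarith [one_div_pos.2 hp0])
    exact hmono p _ _ (Real.rpow_le_rpow_of_exponent_le hp1 hνf.le) hν.2

end UPT

end

theorem mainTheorem1 (ϑ r φ γ A ω₀ q : ℝ)
    (hϑ₀ : 0 < ϑ) (hϑ₁ : ϑ < 1) (hr : ϑ < r) (hζ : UPT.zeta r ϑ ≤ ϑ)
    (hφ₀ : 1 - ϑ < φ) (hφ₁ : φ < 1)
    (hγ₀ : 0 < γ) (hγ₁ : γ < 1) (hA : 0 < A) (hω₀ : 0 < ω₀) (hω₁ : ω₀ < 1 / 2)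
    (hq₀ : 0 < q) (hq : q ≤ (r + ϑ - UPT.zeta r ϑ) ^ 2 / (4 * r)) :
    ∃ K₀ : ℝ, ∀ K : ℝ, K₀ ≤ K → ∀ α : ℝ, 0 < α → α < 1 →
      ∃ o L : ℕ → ℝ, Tendsto o atTop (𝓝 0) ∧ UPT.IsMultiLog L ∧
        ∀ᶠ p : ℕ in atTop, ∀ n : ℕ, |(n : ℝ) - (p : ℝ) ^ φ| < 1 →
          ∀ Ω : Matrix (Fin p) (Fin p) ℝ, UPT.CorrelationClass γ A ω₀ Ω →
          ∀ h₁ : Measure ℝ, IsProbabilityMeasure h₁ →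
            h₁ (Set.Icc (UPT.tau r p) ((1 + UPT.eta r ϑ ω₀) * UPT.tau r p))ᶜ = 0 →
          ∀ est : UPT.Design n p × (Fin n → ℝ) → Fin p → ℝ,
            UPT.IsProcedure (UPT.tune₁ q p) (UPT.tune₂ r ϑ α K p) (UPT.tune₃ r p) est →
            0 < UPT.expRejections (UPT.modelLaw n ϑ Ω h₁) est ∧
            0 < UPT.expAcceptances (UPT.modelLaw n ϑ Ω h₁) est ∧
            UPT.mFDR (UPT.modelLaw n ϑ Ω h₁) est ≤ α * (1 + o p) ∧
            UPT.mFNR (UPT.modelLaw n ϑ Ω h₁) est ≤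
              L p * (p : ℝ) ^ (-(ϑ + (Real.sqrt r - Real.sqrt ϑ) ^ 2)) := by
  refine ⟨1, fun K hK α hα₀ _ => ?_⟩
  have hζ0 : 0 < UPT.zeta r ϑ := by
    have := sub_pos.2 (Real.sqrt_lt_sqrt hϑ₀.le hr)
    unfold UPT.zeta
    positivity
  -- the rates at a fixed polynomial loss `p^ν` in the second one
  have main : ∀ ν : ℝ, 0 < ν → ∀ᶠ p : ℕ in atTop, ∀ n : ℕ, |(n : ℝ) - (p : ℝ) ^ φ| < 1 →
      ∀ Ω : Matrix (Fin p) (Fin p) ℝ, UPT.CorrelationClass γ A ω₀ Ω →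
      ∀ h₁ : Measure ℝ, IsProbabilityMeasure h₁ →
        h₁ (Set.Icc (UPT.tau r p) ((1 + UPT.eta r ϑ ω₀) * UPT.tau r p))ᶜ = 0 →
      ∀ est : UPT.Design n p × (Fin n → ℝ) → Fin p → ℝ,
        UPT.IsProcedure (UPT.tune₁ q p) (UPT.tune₂ r ϑ α K p) (UPT.tau r p) est →
        0 < UPT.expRejections (UPT.modelLaw n ϑ Ω h₁) est ∧
        0 < UPT.expAcceptances (UPT.modelLaw n ϑ Ω h₁) est ∧
        UPT.mFDR (UPT.modelLaw n ϑ Ω h₁) est ≤ α ∧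
        UPT.mFNR (UPT.modelLaw n ϑ Ω h₁) est ≤
          (p : ℝ) ^ ν * (p : ℝ) ^ (-(ϑ + UPT.zeta r ϑ)) := by
    intro ν hν
    set ν' := min (ν / 2) (UPT.zeta r ϑ / 2) with hν'
    have hν'0 : 0 < ν' := by positivity
    have hν'1 : ν' ≤ ν / 2 := min_le_left _ _
    have hν'2 : ν' ≤ UPT.zeta r ϑ / 2 := min_le_right _ _
    filter_upwards [eventually_gt_atTop 1,
      UPT.eventually_false_positive hϑ₀ hϑ₁ hr hζ hφ₀ hγ₀ hγ₁ hA hω₀ hω₁ hq₀ hq (α := α) hK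
        (half_pos hα₀),
      UPT.eventually_false_negative hϑ₀ hϑ₁ hr hζ hφ₀ hγ₀ hγ₁ hA hω₀ hω₁ hq₀ hq (α := α) hK hν'0,
      UPT.eventually_mul_rpow_le 2 (show -(ϑ + UPT.zeta r ϑ) + ν' < -ϑ by linarith),
      UPT.eventually_mul_rpow_le 2 (show -(ϑ + UPT.zeta r ϑ) + ν' < ν + -(ϑ + UPT.zeta r ϑ) by
        linarith),
      UPT.eventually_mul_rpow_neg_le (1 + α / 2) hϑ₀ (show (0 : ℝ) < 1 / 2 by norm_num)]
      with p hp1 hFP hFN k1 k2 k3 n hn Ω hΩ h₁ hh₁ hsupp est hest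
    have hp : 0 < p := by omega
    have hp0 : (0 : ℝ) < p := by exact_mod_cast hp
    have hτ : 0 < UPT.tau r p := by
      have := Real.log_pos (show (1 : ℝ) < p by exact_mod_cast hp1)
      have := hϑ₀.trans hr
      exact Real.sqrt_pos.2 (by positivity)
    have h0 := UPT.support_zero hτ hsupp
    have hprob := UPT.isProbabilityMeasure_modelLaw (n := n) Ω h₁ hϑ₀ hp
    have hπ : 0 < (p : ℝ) ^ (-ϑ) := by positivity
    have hS : ∀ i : Fin p, (UPT.modelLaw n ϑ Ω h₁).real {ω | ω.2.1 i ≠ 0} = (p : ℝ) ^ (-ϑ) :=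
      fun i => by simpa [UPT.dens] using UPT.model_signals_event (n := n) Ω h₁ hϑ₀ hp h0 {i}
    obtain ⟨g1, g2, g3, g4⟩ := UPT.rates_le hest.measurable hp hS
      (hFP n hn Ω hΩ h₁ hh₁ hsupp est hest) (hFN n hn Ω hΩ h₁ hh₁ hsupp est hest) hπ
      (by linarith) (by linarith)
    refine ⟨g1, g2, g3.trans_eq ?_, g4.trans ?_⟩
    · field_simp
    · rw [← Real.rpow_add hp0]
      exact k2
  -- `p^ν` is improved to a multi-log term
  obtain ⟨L, hL, hev⟩ := UPT.exists_isMultiLog (R := fun p x =>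
    ∀ n : ℕ, |(n : ℝ) - (p : ℝ) ^ φ| < 1 →
      ∀ Ω : Matrix (Fin p) (Fin p) ℝ, UPT.CorrelationClass γ A ω₀ Ω →
      ∀ h₁ : Measure ℝ, IsProbabilityMeasure h₁ →
        h₁ (Set.Icc (UPT.tau r p) ((1 + UPT.eta r ϑ ω₀) * UPT.tau r p))ᶜ = 0 →
      ∀ est : UPT.Design n p × (Fin n → ℝ) → Fin p → ℝ,
        UPT.IsProcedure (UPT.tune₁ q p) (UPT.tune₂ r ϑ α K p) (UPT.tau r p) est →
        0 < UPT.expRejections (UPT.modelLaw n ϑ Ω h₁) est ∧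
        0 < UPT.expAcceptances (UPT.modelLaw n ϑ Ω h₁) est ∧
        UPT.mFDR (UPT.modelLaw n ϑ Ω h₁) est ≤ α ∧
        UPT.mFNR (UPT.modelLaw n ϑ Ω h₁) est ≤ x * (p : ℝ) ^ (-(ϑ + UPT.zeta r ϑ)))
    (fun p x y hxy h n hn Ω hΩ h₁ hh₁ hsupp est hest => by
      obtain ⟨g1, g2, g3, g4⟩ := h n hn Ω hΩ h₁ hh₁ hsupp est hest
      exact ⟨g1, g2, g3, g4.trans (by gcongr)⟩) main
  refine ⟨fun _ => 0, L, tendsto_const_nhds, hL, ?_⟩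
  filter_upwards [hev] with p h n hn Ω hΩ h₁ hh₁ hsupp est hest
  rw [add_zero, mul_one]
  exact h n hn Ω hΩ h₁ hh₁ hsupp est hest
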